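/- Let $a>0$, $q=e^{-1/a}$, $k\in\mathbb C$, $t=q^k$, where $q^z:=e^{-z/a}$ and $t^z:=q^{kz}$ for $z\in\mathbb C$; put $X=q^x$. Let $\mathcal H$ be the double affine Hecke algebra of type $A_1$ over $\mathbb C$: generators $T^{\pm1},X^{\pm1},Y^{\pm1}$, relations $TXT=X^{-1}$, $TY^{-1}T=Y$, $Y^{-1}X^{-1}YXT^2=q^{-1/2}$, $(T-t^{1/2})(T+t^{-1/2})=0$. Let $\varkappa$ be its $\mathbb C$-linear anti-involution with $T^\varkappa=T$, $X^\varkappa=T^{-1}XT$, $Y^\varkappa=q^{-1/4}XY$. The operator $T$ acts on $\mathbb C[X^{\pm1}]$ by $T=t^{1/2}s+\frac{t^{1/2}-t^{-1/2}}{X^2-1}(s-1)$, $s(X)=X^{-1}$. For $f,g\in\mathbb C[X^{\pm1}]$ let $F=f\,T(g)$, and write $F(x)$ for its value at $X=q^x$. Put $$\mu(x)=\prod_{i\ge0}\frac{(1-q^{i+2x})(1-q^{i+1-2x})}{(1-q^{i+k+2x})(1-q^{i+k+1-2x})},\qquad G(k)=\sqrt{\pi a}\prod_{j\ge1}\frac{1-q^{k+j}}{1-q^{2k+j}},$$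 $$\Phi_0^k=\frac1{\imath}\int_{\imath\mathbb R}F(x)q^{-x^2}\mu(x)\,dx,\qquad A(z)=\sqrt{\pi a}\sum_{m\in\mathbb Z}q^{m^2+2mz},\qquad A'(z)=\frac{\sqrt{\pi a}}2\sum_{m\in\mathbb Z}q^{m^2/4+mz}.$$ **Theorem.** Let $\Re k<0$, $\Re k\notin\mathbb Z$, and $q^{2k+j}\ne1$ for all integers $j\ge1$ (that is, $k$ is not a pole of $G$). Let $m=[\Re(-k)]$ be the integer part, and let $n_\#=\frac{n-k}2$ for $n\le0$ and $n_\#=\frac{n+k}2$ for $n>0$. 1. There is exactly one linear functional $\varrho:\mathcal H\to\mathbb C$ with $\varrho\big((Y^\varkappa)^{b}T^\epsilon Y^{c}\big)=t^{(b+\epsilon+c)/2}$ for all $b,c\in\mathbb Z$, $\epsilon\in\{0,1\}$. Put $\{f,g\}=\varrho\big(f(X)^\varkappa g(X)\big)$ (the Shapovalov form). 2. The set $\tilde K=\{n_\#:|n|\le m\}$ equals $\{-\frac k2\}\cup\{\pm\frac{k+j}2:1\le j\le m\}$. For $\tilde k\in\tilde K$ let $\mu^\bullet(\tilde k)$ be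 the value at $\tilde k$ of $\mu$ with its vanishing denominator factor cancelled, i.e. of $(1-q^{k+j+2x})\mu(x)$ at $x=-\frac{k+j}2$ ($0\le j\le m$) and of $(1-q^{k+j-2x})\mu(x)$ at $x=\frac{k+j}2$ ($1\le j\le m$) (limits as $x\to\tilde k$, which exist). Then $\mu^\bullet(-\frac k2)\neq0$ and, for $1\le j\le m$, with $j_+=j-1$, $j_-=j$, $$\mu^\bullet\big(\pm\tfrac{k+j}2\big)\big/\mu^\bullet\big(-\tfrac k2\big)=t^{-j_\pm}\prod_{i=1}^{j_\pm}\frac{1-t^2q^i}{1-q^i}.$$ 3. For all $f,g\in\mathbb C[X^{\pm1}]$ the integral $\Phi_0^k$ converges absolutely. If $F\in\mathbb C[X^{\pm2}]$, then $$t^{1/2}\,G(k)\{f,g\}=\Phi_0^k+\mu^\bullet\big(-\tfrac k2\big)\sum_{\tilde k\in\tilde K}A(\tilde k)\,\frac{\mu^\bullet(\tilde k)}{\mu^\bullet(-\frac k2)}\,F(\tilde k).$$ 4. For arbitrary $F\in\mathbb C[X^{\pm1}]$ the summation is doubled: $$t^{1/2}\,G(k)\{f,g\}=\Phi_0^k+\mu^\bullet\big(-\tfrac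 k2\big)\sum_{\tilde k\in\tilde K}\frac{\mu^\bullet(\tilde k)}{\mu^\bullet(-\frac k2)}\Big(A'(\tilde k)F(\tilde k)+A'(\tilde k+\pi\imath a)F(\tilde k+\pi\imath a)\Big).$$ The poles of $\mu$ are exactly the $x$ for which $q^{-1/2}X$ or $X^{-1}$ is of the form $\pm q^{n/2}t^{1/2}$ with an integer $n\ge0$. -/

import Mathlib

open scoped Topology

namespace DAHA

noncomputable section

/-- The power `q ^ z` for `q = exp (-1 / a)`, that is `exp (-z / a)`. With `t = q ^ k` one has
`t ^ z = q ^ (k * z)`, and the coordinate is `X = q ^ x`. -/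
def qpow (a : ℝ) (z : ℂ) : ℂ := Complex.exp (-z / a)

lemma qpow_ne_zero (a : ℝ) (z : ℂ) : qpow a z ≠ 0 := Complex.exp_ne_zero _

lemma qpow_add (a : ℝ) (z w : ℂ) : qpow a (z + w) = qpow a z * qpow a w := by
  unfold qpow
  rw [← Complex.exp_add]
  congr 1
  ring

lemma qpow_zero (a : ℝ) : qpow a 0 = 1 := by simp [qpow]

/-! ### The double affine Hecke algebra of type `A₁` -/

/-- Generators; `Xi`, `Yi`, `Ti` are the inverses of `X`, `Y`, `T`. -/
inductive Gen
  | X | Xi | Y | Yi | T | Ti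

/-- `gen g` is the free generator attached to `g`. -/
abbrev gen (g : Gen) : FreeAlgebra ℂ Gen := FreeAlgebra.ι ℂ g

/-- The defining relations: those of the (`q`-extended) elliptic braid group
`T X T = X⁻¹`, `T Y⁻¹ T = Y`, `Y⁻¹ X⁻¹ Y X T² = q ^ (-1/2)`, and the Hecke relation
`(T - t ^ (1/2)) (T + t ^ (-1/2)) = 0`. -/
inductive Rel (a : ℝ) (k : ℂ) : FreeAlgebra ℂ Gen → FreeAlgebra ℂ Gen → Prop
  | X_Xi : Rel a k (gen .X * gen .Xi) 1
  | Xi_X : Rel a k (gen .Xi * gen .X) 1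
  | Y_Yi : Rel a k (gen .Y * gen .Yi) 1
  | Yi_Y : Rel a k (gen .Yi * gen .Y) 1
  | T_Ti : Rel a k (gen .T * gen .Ti) 1
  | Ti_T : Rel a k (gen .Ti * gen .T) 1
  | TXT : Rel a k (gen .T * gen .X * gen .T) (gen .Xi)
  | TYT : Rel a k (gen .T * gen .Yi * gen .T) (gen .Y)
  | YXYX : Rel a k (gen .Yi * gen .Xi * gen .Y * gen .X * gen .T ^ 2)
      (algebraMap ℂ _ (qpow a (-(1 / 2))))
  | quad : Rel a k ((gen .T - algebraMap ℂ _ (qpow a (k / 2))) *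
      (gen .T + algebraMap ℂ _ (qpow a (-(k / 2))))) 0

/-- The double affine Hecke algebra of type `A₁` over `ℂ` with `q = exp (-1 / a)`, `t = q ^ k`. -/
abbrev Alg (a : ℝ) (k : ℂ) : Type := RingQuot (Rel a k)

/-- The image of a generator in the double affine Hecke algebra. -/
def el (a : ℝ) (k : ℂ) (g : Gen) : Alg a k := RingQuot.mkAlgHom ℂ (Rel a k) (gen g)

section relations

variable (a : ℝ) (k : ℂ)

lemma X_Xi : el a k .X * el a k .Xi = 1 := by
  simpa [el] using RingQuot.mkAlgHom_rel ℂ (Rel.X_Xi (a := a) (k := k))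

lemma Xi_X : el a k .Xi * el a k .X = 1 := by
  simpa [el] using RingQuot.mkAlgHom_rel ℂ (Rel.Xi_X (a := a) (k := k))

lemma Y_Yi : el a k .Y * el a k .Yi = 1 := by
  simpa [el] using RingQuot.mkAlgHom_rel ℂ (Rel.Y_Yi (a := a) (k := k))

lemma Yi_Y : el a k .Yi * el a k .Y = 1 := by
  simpa [el] using RingQuot.mkAlgHom_rel ℂ (Rel.Yi_Y (a := a) (k := k))

lemma T_Ti : el a k .T * el a k .Ti = 1 := by
  simpa [el] using RingQuot.mkAlgHom_rel ℂ (Rel.T_Ti (a := a) (k := k))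

lemma Ti_T : el a k .Ti * el a k .T = 1 := by
  simpa [el] using RingQuot.mkAlgHom_rel ℂ (Rel.Ti_T (a := a) (k := k))

lemma TXT : el a k .T * el a k .X * el a k .T = el a k .Xi := by
  simpa [el] using RingQuot.mkAlgHom_rel ℂ (Rel.TXT (a := a) (k := k))

lemma TYT : el a k .T * el a k .Yi * el a k .T = el a k .Y := by
  simpa [el] using RingQuot.mkAlgHom_rel ℂ (Rel.TYT (a := a) (k := k))

lemma YXYX : el a k .Yi * el a k .Xi * el a k .Y * el a k .X * el a k .T ^ 2 =
    algebraMap ℂ _ (qpow a (-(1 / 2))) := by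
  simpa [el] using RingQuot.mkAlgHom_rel ℂ (Rel.YXYX (a := a) (k := k))

lemma quad : (el a k .T - algebraMap ℂ _ (qpow a (k / 2))) *
    (el a k .T + algebraMap ℂ _ (qpow a (-(k / 2)))) = 0 := by
  simpa [el] using RingQuot.mkAlgHom_rel ℂ (Rel.quad (a := a) (k := k))

end relations

/-- `X` as a unit of the algebra. -/
def unitX (a : ℝ) (k : ℂ) : (Alg a k)ˣ := ⟨el a k .X, el a k .Xi, X_Xi a k, Xi_X a k⟩

/-- `Y` as a unit of the algebra. -/
def unitY (a : ℝ) (k : ℂ) : (Alg a k)ˣ := ⟨el a k .Y, el a k .Yi, Y_Yi a k, Yi_Y a k⟩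

/-- `T` as a unit of the algebra. -/
def unitT (a : ℝ) (k : ℂ) : (Alg a k)ˣ := ⟨el a k .T, el a k .Ti, T_Ti a k, Ti_T a k⟩

/-! ### The Shapovalov anti-involution `ϰ` and the coinvariant -/

/-- The values of `ϰ` on generators: `T ↦ T`, `X ↦ T⁻¹ X T`, `Y ↦ q ^ (-1/4) X Y`. -/
def kappaGen (a : ℝ) (k : ℂ) : Gen → Alg a k
  | .X => el a k .Ti * el a k .X * el a k .T
  | .Xi => el a k .Ti * el a k .Xi * el a k .T
  | .Y => qpow a (-(1 / 4)) • (el a k .X * el a k .Y)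
  | .Yi => qpow a (1 / 4) • (el a k .Yi * el a k .Xi)
  | .T => el a k .T
  | .Ti => el a k .Ti

section antiInvolution

variable (a : ℝ) (k : ℂ)

lemma T_Yi : el a k .T * el a k .Yi = el a k .Y * el a k .Ti := by
  rw [← TYT, mul_assoc, T_Ti, mul_one]

lemma Ti_Xi : el a k .Ti * el a k .Xi = el a k .X * el a k .T := by
  rw [← TXT, ← mul_assoc, ← mul_assoc, Ti_T, one_mul]

lemma YXTT : el a k .Y * el a k .X * el a k .T ^ 2 =
    qpow a (-(1 / 2)) • (el a k .X * el a k .Y) := by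
  have h := congrArg (fun z => el a k .X * (el a k .Y * z)) (YXYX a k)
  simp only [Algebra.algebraMap_eq_smul_one, mul_smul_comm, mul_one] at h
  rw [← h]
  have e : el a k .X * (el a k .Y * (el a k .Yi * el a k .Xi * el a k .Y * el a k .X *
      el a k .T ^ 2)) = el a k .X * ((el a k .Y * el a k .Yi) * el a k .Xi) *
      (el a k .Y * el a k .X * el a k .T ^ 2) := by noncomm_ring
  rw [e, Y_Yi, one_mul, X_Xi, one_mul]

lemma kappa_X_Xi : kappaGen a k .X * kappaGen a k .Xi = 1 := by
  have e : kappaGen a k .X * kappaGen a k .Xi = el a k .Ti * (el a k .X *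
      (el a k .T * el a k .Ti) * el a k .Xi) * el a k .T := by
    simp only [kappaGen]; noncomm_ring
  rw [e, T_Ti, mul_one, X_Xi, mul_one, Ti_T]

lemma kappa_Xi_X : kappaGen a k .Xi * kappaGen a k .X = 1 := by
  have e : kappaGen a k .Xi * kappaGen a k .X = el a k .Ti * (el a k .Xi *
      (el a k .T * el a k .Ti) * el a k .X) * el a k .T := by
    simp only [kappaGen]; noncomm_ring
  rw [e, T_Ti, mul_one, Xi_X, mul_one, Ti_T]

lemma kappa_Y_Yi : kappaGen a k .Y * kappaGen a k .Yi = 1 := by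
  simp only [kappaGen, smul_mul_smul_comm, ← qpow_add]
  have e : el a k .X * el a k .Y * (el a k .Yi * el a k .Xi) =
      el a k .X * (el a k .Y * el a k .Yi) * el a k .Xi := by noncomm_ring
  rw [e, Y_Yi, mul_one, X_Xi]
  simp [qpow_zero]

lemma kappa_Yi_Y : kappaGen a k .Yi * kappaGen a k .Y = 1 := by
  simp only [kappaGen, smul_mul_smul_comm, ← qpow_add]
  have e : el a k .Yi * el a k .Xi * (el a k .X * el a k .Y) =
      el a k .Yi * (el a k .Xi * el a k .X) * el a k .Y := by noncomm_ring
  rw [e, Xi_X, mul_one, Yi_Y]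
  simp [qpow_zero]

lemma kappa_TXT : kappaGen a k .T * kappaGen a k .X * kappaGen a k .T = kappaGen a k .Xi := by
  have e : kappaGen a k .T * kappaGen a k .X * kappaGen a k .T =
      (el a k .T * el a k .Ti) * (el a k .X * el a k .T) * el a k .T := by
    simp only [kappaGen]; noncomm_ring
  rw [e, T_Ti, one_mul, ← Ti_Xi]
  rfl

lemma kappa_TYT : kappaGen a k .T * kappaGen a k .Yi * kappaGen a k .T = kappaGen a k .Y := by
  simp only [kappaGen, mul_smul_comm, smul_mul_assoc]
  have e : el a k .T * (el a k .Yi * el a k .Xi) * el a k .T =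
      (el a k .T * el a k .Yi) * el a k .Xi * el a k .T := by noncomm_ring
  have e2 : el a k .Y * el a k .Ti * el a k .Xi * el a k .T =
      el a k .Y * (el a k .Ti * el a k .Xi) * el a k .T := by noncomm_ring
  have e3 : el a k .Y * (el a k .X * el a k .T) * el a k .T =
      el a k .Y * el a k .X * el a k .T ^ 2 := by noncomm_ring
  rw [e, T_Yi, e2, Ti_Xi, e3, YXTT, smul_smul, ← qpow_add]
  norm_num

lemma kappa_YXYX : kappaGen a k .T ^ 2 * (kappaGen a k .X * (kappaGen a k .Y *
    (kappaGen a k .Xi * kappaGen a k .Yi))) = algebraMap ℂ _ (qpow a (-(1 / 2))) := by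
  simp only [kappaGen, mul_smul_comm, smul_mul_assoc, smul_smul, ← qpow_add]
  have e : el a k .T ^ 2 * (el a k .Ti * el a k .X * el a k .T * (el a k .X * el a k .Y *
      (el a k .Ti * el a k .Xi * el a k .T * (el a k .Yi * el a k .Xi)))) =
      el a k .T * (el a k .T * el a k .Ti) * el a k .X * el a k .T * el a k .X * (el a k .Y *
      (el a k .Ti * el a k .Xi) * el a k .T) * (el a k .Yi * el a k .Xi) := by noncomm_ring
  have e3 : el a k .Y * (el a k .X * el a k .T) * el a k .T =
      el a k .Y * el a k .X * el a k .T ^ 2 := by noncomm_ring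
  have e4 : el a k .X * el a k .Y * (el a k .Yi * el a k .Xi) =
      el a k .X * (el a k .Y * el a k .Yi) * el a k .Xi := by noncomm_ring
  rw [e, T_Ti, mul_one, TXT, Xi_X, one_mul, Ti_Xi, e3, YXTT, smul_mul_assoc, e4, Y_Yi, mul_one,
    X_Xi, smul_smul, ← qpow_add, Algebra.algebraMap_eq_smul_one]
  norm_num

lemma kappa_quad : (kappaGen a k .T + algebraMap ℂ _ (qpow a (-(k / 2)))) *
    (kappaGen a k .T - algebraMap ℂ _ (qpow a (k / 2))) = 0 := by
  rw [← quad a k]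
  simp only [kappaGen, Algebra.algebraMap_eq_smul_one, add_mul, mul_sub, sub_mul, mul_add,
    mul_smul_comm, smul_mul_assoc, mul_one, one_mul, smul_add, smul_sub, smul_smul]
  rw [mul_comm (qpow a (k / 2))]
  abel

end antiInvolution

open MulOpposite in
/-- `ϰ` as an algebra homomorphism to the opposite algebra. -/
def kappaHom (a : ℝ) (k : ℂ) : Alg a k →ₐ[ℂ] (Alg a k)ᵐᵒᵖ :=
  RingQuot.liftAlgHom ℂ ⟨FreeAlgebra.lift ℂ fun g => op (kappaGen a k g), by
    intro x y h
    apply unop_injective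
    cases h <;>
      simp only [map_mul, map_add, map_sub, map_pow, map_one, map_zero, FreeAlgebra.lift_ι_apply,
        AlgHom.commutes, unop_mul, unop_op, unop_one, unop_zero, unop_add, unop_sub, unop_pow,
        MulOpposite.algebraMap_apply]
    · exact kappa_Xi_X a k
    · exact kappa_X_Xi a k
    · exact kappa_Yi_Y a k
    · exact kappa_Y_Yi a k
    · exact Ti_T a k
    · exact T_Ti a k
    · rw [← mul_assoc]; exact kappa_TXT a k
    · rw [← mul_assoc]; exact kappa_TYT a k
    · exact kappa_YXYX a k
    · exact kappa_quad a k⟩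

/-- The Shapovalov anti-involution `ϰ` of the algebra: `ϰ (A * B) = ϰ B * ϰ A`, `ϰ T = T`,
`ϰ X = T⁻¹ X T`, `ϰ Y = q ^ (-1/4) X Y`. -/
def kappa (a : ℝ) (k : ℂ) : Alg a k →ₗ[ℂ] Alg a k :=
  (MulOpposite.opLinearEquiv ℂ).symm.toLinearMap ∘ₗ (kappaHom a k).toLinearMap

lemma kappa_el (a : ℝ) (k : ℂ) (g : Gen) : kappa a k (el a k g) = kappaGen a k g := by
  simp [kappa, kappaHom, el]

lemma kappa_mul (a : ℝ) (k : ℂ) (A B : Alg a k) :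
    kappa a k (A * B) = kappa a k B * kappa a k A := by
  simp [kappa]

lemma kappa_one (a : ℝ) (k : ℂ) : kappa a k 1 = 1 := by
  simp [kappa]

/-- `ϰ Y` as a unit of the algebra. -/
def unitKappaY (a : ℝ) (k : ℂ) : (Alg a k)ˣ where
  val := kappa a k (el a k .Y)
  inv := kappa a k (el a k .Yi)
  val_inv := by rw [← kappa_mul, Yi_Y, kappa_one]
  inv_val := by rw [← kappa_mul, Y_Yi, kappa_one]

/-- `ϱ` is the coinvariant attached to `ϰ` and to the character `T ↦ t ^ (1/2)`,
`Y ↦ t ^ (1/2)`: a linear functional on the algebra with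
`ϱ ((ϰ Y) ^ m * T ^ ε * Y ^ n) = t ^ ((m + ε + n) / 2)` for `m n : ℤ` and `ε = 0, 1`. -/
def IsCoinvariant (a : ℝ) (k : ℂ) (ϱ : Alg a k →ₗ[ℂ] ℂ) : Prop :=
  ∀ (m n : ℤ) (ε : Fin 2),
    ϱ (((unitKappaY a k ^ m : (Alg a k)ˣ) : Alg a k) * el a k .T ^ (ε : ℕ) *
      ((unitY a k ^ n : (Alg a k)ˣ) : Alg a k)) =
      qpow a (k * (((m : ℂ) + ((ε : ℕ) : ℂ) + (n : ℂ)) / 2))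

/-- The form `{A, B} = ϱ (ϰ A * B)` on the algebra. -/
def form {a : ℝ} {k : ℂ} (ϱ : Alg a k →ₗ[ℂ] ℂ) (A B : Alg a k) : ℂ := ϱ (kappa a k A * B)

/-- The element `f(X)` of the algebra attached to a Laurent polynomial `f`. -/
def ofX (a : ℝ) (k : ℂ) (f : LaurentPolynomial ℂ) : Alg a k := f.smeval (unitX a k)

/-! ### The Demazure-Lusztig operator on Laurent polynomials

The polynomial representation lives on `ℂ[X, X⁻¹]`, that is `LaurentPolynomial ℂ` with
`LaurentPolynomial.T n` in the role of `X ^ n`. -/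

/-- The operator `(X ^ 2 - 1)⁻¹ (s - 1)`, where `s f (X) = f (X⁻¹)`, given on monomials by
`X ^ n ↦ - sign n * ∑ i < |n|, X ^ (2 i - |n|)`; see `X_sq_sub_one_mul_divDiff`. -/
def divDiff (f : LaurentPolynomial ℂ) : LaurentPolynomial ℂ :=
  f.coeff.sum fun n c => LaurentPolynomial.C (-(n.sign : ℂ) * c) *
    ∑ i ∈ Finset.range n.natAbs, LaurentPolynomial.T (2 * (i : ℤ) - (n.natAbs : ℤ))

lemma geom_aux (p : ℕ) (N : ℤ) :
    ((LaurentPolynomial.T 2 : LaurentPolynomial ℂ) - 1) *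
      ∑ i ∈ Finset.range p, LaurentPolynomial.T (2 * (i : ℤ) - N) =
      LaurentPolynomial.T (2 * (p : ℤ) - N) - LaurentPolynomial.T (-N) := by
  induction p with
  | zero => simp
  | succ p ih =>
    rw [Finset.sum_range_succ, mul_add, ih, sub_mul, ← LaurentPolynomial.T_add, one_mul]
    have : (2 : ℤ) + (2 * (p : ℤ) - N) = 2 * ((p + 1 : ℕ) : ℤ) - N := by push_cast; ring
    rw [this]
    ring

lemma X_sq_sub_one_mul_divDiff (f : LaurentPolynomial ℂ) :
    (LaurentPolynomial.T 2 - 1) * divDiff f = LaurentPolynomial.invert f - f := by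
  induction f using LaurentPolynomial.induction_on' with
  | add p q hp hq =>
    have hadd : divDiff (p + q) = divDiff p + divDiff q := by
      unfold divDiff
      rw [AddMonoidAlgebra.coeff_add, Finsupp.sum_add_index']
      · intro n; simp
      · intro n c d; rw [mul_add, map_add, add_mul]
    rw [hadd, mul_add, hp, hq, map_add]
    ring
  | C_mul_T n c =>
    have hmon : divDiff (LaurentPolynomial.C c * LaurentPolynomial.T n) =
        LaurentPolynomial.C (-(n.sign : ℂ) * c) *
        ∑ i ∈ Finset.range n.natAbs, LaurentPolynomial.T (2 * (i : ℤ) - (n.natAbs : ℤ)) := by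
      unfold divDiff
      rw [← LaurentPolynomial.single_eq_C_mul_T, AddMonoidAlgebra.coeff_single,
        Finsupp.sum_single_index]
      simp
    rw [hmon, mul_left_comm, geom_aux, map_mul LaurentPolynomial.invert,
      LaurentPolynomial.invert_C, LaurentPolynomial.invert_T, map_mul]
    rcases lt_trichotomy n 0 with h | h | h
    · have h1 : (n.natAbs : ℤ) = -n := by omega
      rw [Int.sign_eq_neg_one_of_neg h, h1]
      have h2 : 2 * -n - -n = -n := by ring
      rw [h2]
      simp only [neg_neg, Int.cast_neg, Int.cast_one, map_one]
      ring
    · subst h; simp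
    · have h1 : (n.natAbs : ℤ) = n := by omega
      rw [Int.sign_eq_one_of_pos h, h1]
      have h2 : 2 * n - n = n := by ring
      rw [h2]
      simp only [Int.cast_one, map_neg, map_one]
      ring

/-- The action of `T` on Laurent polynomials:
`t ^ (1/2) s + (t ^ (1/2) - t ^ (-1/2)) (X ^ 2 - 1)⁻¹ (s - 1)`. -/
def opT (a : ℝ) (k : ℂ) (f : LaurentPolynomial ℂ) : LaurentPolynomial ℂ :=
  qpow a (k / 2) • LaurentPolynomial.invert f +
    (qpow a (k / 2) - qpow a (-(k / 2))) • divDiff f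

/-- The value at `x` of a Laurent polynomial in `X = q ^ x`. -/
def evalq (a : ℝ) (f : LaurentPolynomial ℂ) (x : ℂ) : ℂ :=
  f.eval₂ (RingHom.id ℂ) (Units.mk0 (qpow a x) (qpow_ne_zero a x))

/-- `F = f T(g)`. -/
def bigF (a : ℝ) (k : ℂ) (f g : LaurentPolynomial ℂ) : LaurentPolynomial ℂ := f * opT a k g

/-- Membership in `ℂ[X ^ 2, X ^ (-2)]`. -/
def IsEven (F : LaurentPolynomial ℂ) : Prop := ∀ n ∈ F.coeff.support, Even n

/-! ### The analytic side -/

/-- The truncated theta function `μ`. -/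
def mu (a : ℝ) (k x : ℂ) : ℂ :=
  ∏' i : ℕ, ((1 - qpow a (i + 2 * x)) * (1 - qpow a (i + 1 - 2 * x))) /
    ((1 - qpow a (i + k + 2 * x)) * (1 - qpow a (i + k + 1 - 2 * x)))

/-- `z`, with `0` replaced by `1`. -/
def omitZero (z : ℂ) : ℂ := if z = 0 then 1 else z

/-- `μ•`: the value of the product `μ` at `x` after the denominator factors vanishing at `x`
have been removed. -/
def muBullet (a : ℝ) (k x : ℂ) : ℂ :=
  ∏' i : ℕ, ((1 - qpow a (i + 2 * x)) * (1 - qpow a (i + 1 - 2 * x))) /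
    (omitZero (1 - qpow a (i + k + 2 * x)) * omitZero (1 - qpow a (i + k + 1 - 2 * x)))

/-- `G(k)`. -/
def G (a : ℝ) (k : ℂ) : ℂ :=
  (Real.sqrt (Real.pi * a) : ℂ) *
    ∏' j : ℕ, (1 - qpow a (k + (j + 1))) / (1 - qpow a (2 * k + (j + 1)))

/-- The integrand `F(x) q ^ (-x²) μ(x)` at the point `x = ε + i y`. -/
def integrand (a : ℝ) (k : ℂ) (ε : ℝ) (F : LaurentPolynomial ℂ) (y : ℝ) : ℂ :=
  evalq a F (ε + Complex.I * y) * qpow a (-(ε + Complex.I * y) ^ 2) *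
    mu a k (ε + Complex.I * y)

/-- `i⁻¹ ∫ F(x) q ^ (-x²) μ(x) dx` over the line `ε + iℝ` (with `dx = i dy`). -/
def Phi (a : ℝ) (k : ℂ) (ε : ℝ) (F : LaurentPolynomial ℂ) : ℂ :=
  ∫ y : ℝ, integrand a k ε F y

/-- `A(z) = √(πa) ∑ q ^ (m² + 2 m z)`, the sum over all integers `m`. -/
def A (a : ℝ) (z : ℂ) : ℂ :=
  (Real.sqrt (Real.pi * a) : ℂ) * ∑' m : ℤ, qpow a ((m : ℂ) ^ 2 + 2 * m * z)

/-- The half-step analogue of `A`: `(√(πa) / 2) ∑ q ^ (m² / 4 + m z)`, the sum over all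
integers `m`. -/
def Ahalf (a : ℝ) (z : ℂ) : ℂ :=
  (Real.sqrt (Real.pi * a) : ℂ) / 2 * ∑' m : ℤ, qpow a ((m : ℂ) ^ 2 / 4 + m * z)

/-- `n♯`: `(n - k) / 2` for `n ≤ 0` and `(n + k) / 2` for `n > 0`. -/
def sharp (k : ℂ) (n : ℤ) : ℂ := if n ≤ 0 then ((n : ℂ) - k) / 2 else ((n : ℂ) + k) / 2

/-- The integer part of `Re (-k)` (used for `Re k < 0`). -/
def jumps (k : ℂ) : ℕ := ⌊(-k).re⌋₊

/-- `K̃ = {n♯ : |n| ≤ m}` with `m = [Re (-k)]`. -/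
def Ktilde (k : ℂ) : Finset ℂ := (Finset.Icc (-(jumps k : ℤ)) (jumps k)).image (sharp k)

end

end DAHA

namespace DAHA

noncomputable section

open Filter Finset

/-! ### The infinite q-Pochhammer symbol -/

/-! In the variable `u = X ^ 2` the function `μ` is the weight `(u)_∞ (q/u)_∞ / ((αu)_∞ (β/u)_∞)` at
`α = t`, `β = tq`. When `α` and `β` lie in the open unit disc, Ramanujan's bilateral sum expands it
on `|u| = 1` with the explicit coefficients `coef`, up to a constant. For `Re k < 0` some poles have
crossed the unit circle and `coef` grows geometrically. The true Fourier coefficients are then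
`corr`: `coef` corrected by one geometric sequence per crossed pole (`hasExpansion`).

Integrating termwise against the Gaussian replaces `X ^ p * u ^ n` by `√(πa) q ^ ((2n + p)² / 4)`.
The integral therefore splits. Each geometric sequence becomes a theta series, which is the
contribution of a point of `K̃` (`tsum_muCorr`, `Ahalf_add`, `A_mul`). The uncorrected coefficients
give the functional `momentLin`, which makes sense for every `k` because Gaussian decay beats
geometric growth. Hence `Phi_add_residues`, with no analytic continuation in `k`.

On the algebraic side, symmetries of `coef` say that `momentLin` is an eigenfunctional of `T` and is
invariant under `q ^ (-1/4) X π`, where `π` is the substitution `X ↦ q ^ (1/2) X⁻¹`. As `Y = π T` in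
the polynomial representation, `H ↦ momentLin (H 1) / momentLin 1` is a coinvariant, and it turns
the Shapovalov form into `momentLin F / momentLin 1`, up to `t ^ (1/2)` (`form_coinv`). Uniqueness
holds because the elements `(ϰ Y) ^ m T ^ ε Y ^ n` span the algebra. Finally, a recursion `t ↦ tq`
evaluates `momentLin 1` (`moment_zero`), and this produces the factor `G(k)`. -/

/-- `∏ (1 - z q ^ i)` over `i ≥ 0`. -/
def qPoch (q z : ℂ) : ℂ := ∏' i : ℕ, (1 - z * q ^ i)

variable {q : ℂ}

lemma summable_mul_pow (hq : ‖q‖ < 1) (z : ℂ) : Summable fun i : ℕ => ‖-(z * q ^ i)‖ := by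
  simpa using (summable_geometric_of_lt_one (norm_nonneg _) hq).mul_left ‖z‖

lemma multipliable_qPoch (hq : ‖q‖ < 1) (z : ℂ) : Multipliable fun i : ℕ => 1 - z * q ^ i := by
  simpa [sub_eq_add_neg] using multipliable_one_add_of_summable (summable_mul_pow hq z)

lemma hasProd_qPoch (hq : ‖q‖ < 1) (z : ℂ) : HasProd (fun i : ℕ => 1 - z * q ^ i) (qPoch q z) :=
  (multipliable_qPoch hq z).hasProd

lemma qPoch_zero : qPoch q 0 = 1 := by simp [qPoch]

lemma qPoch_ne_zero (hq : ‖q‖ < 1) {z : ℂ} (hz : ∀ i : ℕ, z * q ^ i ≠ 1) : qPoch q z ≠ 0 := by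
  have := tprod_one_add_ne_zero_of_summable (f := fun i : ℕ => -(z * q ^ i))
    (fun i h => hz i (by linear_combination -h)) (summable_mul_pow hq z)
  simpa [qPoch, sub_eq_add_neg] using this

lemma qPoch_eq_prod_mul (hq : ‖q‖ < 1) (z : ℂ) (n : ℕ) :
    qPoch q z = (∏ i ∈ range n, (1 - z * q ^ i)) * qPoch q (z * q ^ n) := by
  have h : Multipliable fun i : ℕ => 1 - z * q ^ (i + n) := by
    refine (multipliable_qPoch hq (z * q ^ n)).congr fun i => ?_
    rw [pow_add]; ring
  rw [qPoch, ← h.prod_mul_tprod_nat_mul' (f := fun i : ℕ => 1 - z * q ^ i), qPoch]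
  congr 1
  refine tprod_congr fun i => ?_
  rw [pow_add]; ring

lemma qPoch_eq_mul (hq : ‖q‖ < 1) (z : ℂ) : qPoch q z = (1 - z) * qPoch q (z * q) := by
  simpa using qPoch_eq_prod_mul hq z 1

lemma qPoch_eq_zero (hq : ‖q‖ < 1) {z : ℂ} {i : ℕ} (h : z * q ^ i = 1) : qPoch q z = 0 := by
  rw [qPoch_eq_prod_mul hq z (i + 1), prod_range_succ, h]
  simp

lemma qPoch_ne_zero_iff (hq : ‖q‖ < 1) {z : ℂ} : qPoch q z ≠ 0 ↔ ∀ i : ℕ, z * q ^ i ≠ 1 :=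
  ⟨fun h _ hi => h (qPoch_eq_zero hq hi), qPoch_ne_zero hq⟩

lemma differentiable_qPoch (hq : ‖q‖ < 1) : Differentiable ℂ (qPoch q) := by
  have hloc : HasProdLocallyUniformlyOn (fun (i : ℕ) (z : ℂ) => 1 + -(z * q ^ i))
      (fun z => ∏' i : ℕ, (1 + -(z * q ^ i))) Set.univ := by
    apply hasProdLocallyUniformlyOn_of_forall_compact isOpen_univ
    intro K _ hK
    obtain ⟨R, hR⟩ := hK.isBounded.exists_norm_le
    refine ((summable_geometric_of_lt_one (norm_nonneg _) hq).mul_left R).hasProdUniformlyOn_nat_one_add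
      hK (.of_forall fun n x hx => ?_) (fun _ => by fun_prop)
    rw [norm_neg, norm_mul, norm_pow]
    exact mul_le_mul_of_nonneg_right (hR x hx) (by positivity)
  have h := hloc.differentiableOn
    (.of_forall fun _ => by simpa [Finset.prod_fn] using
      DifferentiableOn.finsetProd (fun _ _ => by fun_prop)) isOpen_univ
  have e : qPoch q = fun z => ∏' i : ℕ, (1 + -(z * q ^ i)) := by
    funext z; simp [qPoch, sub_eq_add_neg]
  rw [e]
  exact differentiableOn_univ.mp h

lemma continuous_qPoch (hq : ‖q‖ < 1) : Continuous (qPoch q) := (differentiable_qPoch hq).continuous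

lemma exists_qPoch_bound (hq : ‖q‖ < 1) (R : ℝ) : ∃ C : ℝ, 0 < C ∧ ∀ z : ℂ, ‖z‖ ≤ R → ‖qPoch q z‖ ≤ C := by
  obtain ⟨C, hC⟩ := (isCompact_closedBall (0 : ℂ) R).exists_bound_of_continuousOn
    (continuous_qPoch hq).continuousOn
  exact ⟨max C 1, by positivity, fun z hz => (hC z (by simpa using hz)).trans (le_max_left _ _)⟩

lemma tendsto_mul_pow (hq : ‖q‖ < 1) (z : ℂ) : Tendsto (fun n : ℕ => z * q ^ n) atTop (𝓝 0) := by
  simpa using (tendsto_pow_atTop_nhds_zero_of_norm_lt_one hq).const_mul z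

lemma tendsto_qPoch_mul_pow (hq : ‖q‖ < 1) (z : ℂ) :
    Tendsto (fun n : ℕ => qPoch q (z * q ^ n)) atTop (𝓝 1) := by
  have h := ((continuous_qPoch hq).tendsto 0).comp (tendsto_mul_pow hq z)
  rwa [qPoch_zero] at h

lemma tendsto_prod_qPoch (hq : ‖q‖ < 1) (z : ℂ) :
    Tendsto (fun n : ℕ => ∏ i ∈ range n, (1 - z * q ^ i)) atTop (𝓝 (qPoch q z)) :=
  (hasProd_qPoch hq z).tendsto_prod_nat

lemma hasProd_div {ι : Type*} {f g : ι → ℂ} {a b : ℂ} (hf : HasProd f a) (hg : HasProd g b)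
    (hb : b ≠ 0) : HasProd (fun i => f i / g i) (a / b) := by
  have h : Tendsto (fun s : Finset ι => (∏ i ∈ s, f i) / ∏ i ∈ s, g i) atTop (𝓝 (a / b)) :=
    Tendsto.div hf hg hb
  simpa [HasProd, Finset.prod_div_distrib] using h

lemma hasProd_of_eq_zero {ι : Type*} {f : ι → ℂ} {i : ι} (h : f i = 0) : HasProd f 0 := by
  classical
  refine tendsto_const_nhds.congr' ?_
  filter_upwards [eventually_ge_atTop {i}] with s hs
  exact (Finset.prod_eq_zero (hs (by simp)) h).symm

/-- The product formula holds in all cases, with the convention `x / 0 = 0`. -/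
lemma tprod_div_qPoch (hq : ‖q‖ < 1) (z₁ z₂ w₁ w₂ : ℂ) :
    ∏' i : ℕ, ((1 - z₁ * q ^ i) * (1 - z₂ * q ^ i)) / ((1 - w₁ * q ^ i) * (1 - w₂ * q ^ i)) =
      qPoch q z₁ * qPoch q z₂ / (qPoch q w₁ * qPoch q w₂) := by
  -- If the denominator vanishes, some factor on the left is itself a division by zero, hence `0`,
  -- so the whole product is `0`, like the right-hand side.
  by_cases h : qPoch q w₁ * qPoch q w₂ = 0
  · rw [h, div_zero]
    have : ∃ i : ℕ, (1 - w₁ * q ^ i) * (1 - w₂ * q ^ i) = 0 := by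
      by_contra! hc
      refine mul_ne_zero (qPoch_ne_zero hq fun i hi => hc i ?_)
        (qPoch_ne_zero hq fun i hi => hc i ?_) h <;> simp [hi]
    obtain ⟨i, hi⟩ := this
    exact (hasProd_of_eq_zero (i := i) (by rw [hi, div_zero])).tprod_eq
  · exact (hasProd_div ((hasProd_qPoch hq z₁).mul (hasProd_qPoch hq z₂))
      ((hasProd_qPoch hq w₁).mul (hasProd_qPoch hq w₂)) h).tprod_eq

end

end DAHA

namespace DAHA

noncomputable section

open Filter Finset

/-! ### Coefficients of the bilateral series -/

/-- The coefficient of `u ^ n`, `n ≥ 0`, in the bilateral expansion (up to a constant) of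
`(u)_∞ (q / u)_∞ / ((α u)_∞ (β / u)_∞)`. -/
def coefNat (q α β : ℂ) (n : ℕ) : ℂ :=
  qPoch q (α * q) * qPoch q (β * q ^ n) * ∏ i ∈ range n, (α - q ^ i)

/-- The coefficient of `u ^ n`, `n ∈ ℤ`, in the bilateral expansion (up to a constant) of
`(u)_∞ (q / u)_∞ / ((α u)_∞ (β / u)_∞)`. -/
def coef (q α β : ℂ) (n : ℤ) : ℂ :=
  if 0 < n then coefNat q α β n.toNat else -coefNat q β α (1 - n).toNat

variable {q : ℂ}

/-- Under `u ↦ u⁻¹` with `α`, `β` exchanged the weight is multiplied by `-u⁻¹`; this accounts for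
the sign and for `1 - n` in place of `-n`. -/
lemma coef_swap (α β : ℂ) (n : ℤ) : coef q α β n = -coef q β α (1 - n) := by
  unfold coef
  split_ifs with h1 h2 h2
  · omega
  · simp
  · rfl
  · omega

lemma coef_neg_natCast (α β : ℂ) (n : ℕ) : coef q α β (-(n : ℤ)) = -coefNat q β α (n + 1) := by
  have : (1 - -(n : ℤ)).toNat = n + 1 := by omega
  rw [coef, if_neg (by omega), this]

/-- The two branches of `coef` agree at `n = 0`, so the positive formula may be used from `0` on. -/
lemma coef_natCast (hq : ‖q‖ < 1) (α β : ℂ) (n : ℕ) : coef q α β n = coefNat q α β n := by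
  rcases n with _ | n
  · have h := coef_neg_natCast (q := q) α β 0
    rw [Nat.cast_zero, neg_zero] at h
    rw [Nat.cast_zero, h]
    simp only [coefNat, zero_add, prod_range_one, pow_zero, pow_one, mul_one, prod_range_zero]
    rw [qPoch_eq_mul hq β]
    ring
  · rw [coef, if_pos (by omega)]
    rfl

lemma prod_shift (α : ℂ) (n : ℕ) :
    ∏ i ∈ range (n + 1), (α * q - q ^ i) = (α * q - 1) * q ^ n * ∏ i ∈ range n, (α - q ^ i) := by
  rw [prod_range_succ']
  have : ∀ i ∈ range n, α * q - q ^ (i + 1) = q * (α - q ^ i) := fun i _ => by ring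
  rw [prod_congr rfl this, prod_mul_distrib, prod_const, card_range, pow_zero]
  ring

lemma coefNat_succ (hq : ‖q‖ < 1) (α β : ℂ) (n : ℕ) :
    coefNat q α β (n + 1) - α * coefNat q α β n = (1 - α * β) * coefNat q (α * q) β (n + 1) := by
  simp only [coefNat]
  rw [prod_shift, prod_range_succ, qPoch_eq_mul hq (β * q ^ n), qPoch_eq_mul hq (α * q),
    mul_assoc β (q ^ n) q, ← pow_succ]
  ring

/-- The coefficients transform under multiplication by `1 - α u`. -/
lemma coef_sub (hq : ‖q‖ < 1) (α β : ℂ) (n : ℤ) :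
    coef q α β n - α * coef q α β (n - 1) = (1 - α * β) * coef q (α * q) β n := by
  rcases lt_or_ge 0 n with h | h
  · obtain ⟨m, rfl⟩ : ∃ m : ℕ, n = ((m + 1 : ℕ) : ℤ) := ⟨(n - 1).toNat, by omega⟩
    have e : ((m + 1 : ℕ) : ℤ) - 1 = (m : ℕ) := by push_cast; ring
    rw [e, coef_natCast hq, coef_natCast hq, coef_natCast hq, coefNat_succ hq]
  · obtain ⟨m, rfl⟩ : ∃ m : ℕ, n = -(m : ℤ) := ⟨(-n).toNat, by omega⟩
    have e : -(m : ℤ) - 1 = -((m + 1 : ℕ) : ℤ) := by push_cast; ring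
    rw [e, coef_neg_natCast, coef_neg_natCast, coef_neg_natCast]
    simp only [coefNat]
    rw [prod_range_succ (fun i => β - q ^ i) (m + 1), qPoch_eq_mul hq (α * q ^ (m + 1)),
      mul_assoc α (q ^ (m + 1)) q, ← pow_succ, mul_assoc α q, ← pow_succ']
    ring

/-- Coefficient form of the functional equation relating the weight with parameters `αq, β` at `u`
to the one with `α, βq` at `qu`: the quotient is `-u`. For `β = αq` it yields the symmetry `c_{-n} =
q ^ n c_n`. -/
lemma coef_add_one (hq : ‖q‖ < 1) (hq0 : q ≠ 0) (α β : ℂ) (n : ℤ) :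
    coef q (α * q) β (n + 1) = -q ^ n * coef q α (β * q) n := by
  have key : ∀ (α β : ℂ) (m : ℕ), coef q (α * q) β (m + 1) = -q ^ m * coef q α (β * q) m := by
    intro α β m
    rw [← Nat.cast_succ, coef_natCast hq, coef_natCast hq]
    simp only [coefNat]
    rw [prod_shift, qPoch_eq_mul hq (α * q), mul_assoc β q, ← pow_succ']
    ring
  rcases le_or_gt 0 n with h | h
  · lift n to ℕ using h
    simpa using key α β n
  · obtain ⟨m, rfl⟩ : ∃ m : ℕ, n = -(m : ℤ) := ⟨(-n).toNat, by omega⟩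
    have h1 := key β α m
    rw [coef_swap (α * q) β, coef_swap α (β * q)]
    have e1 : 1 - (-(m : ℤ) + 1) = m := by ring
    have e2 : 1 - -(m : ℤ) = m + 1 := by ring
    rw [e1, e2, h1, zpow_neg, zpow_natCast]
    have : q ^ m ≠ 0 := pow_ne_zero _ hq0
    field_simp

/-! ### Summability -/

/-- Consecutive products have ratio `α - q ^ n`, which tends to `α`. -/
lemma summable_coefNat (hq : ‖q‖ < 1) {α : ℂ} (β : ℂ) (hα : ‖α‖ < 1) :
    Summable (coefNat q α β) := by
  obtain ⟨C, hC, hb⟩ := exists_qPoch_bound hq ‖β‖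
  obtain ⟨r, hr1, hr2⟩ := exists_between hα
  have hP : Summable fun n : ℕ => ∏ i ∈ range n, (α - q ^ i) := by
    refine summable_of_ratio_norm_eventually_le (r := r) hr2 ?_
    have ht : Tendsto (fun n : ℕ => ‖α - q ^ n‖) atTop (𝓝 ‖α‖) := by
      simpa using (((tendsto_pow_atTop_nhds_zero_of_norm_lt_one hq).const_sub α).norm)
    filter_upwards [ht.eventually_le_const hr1] with n hn
    rw [prod_range_succ, norm_mul, mul_comm]
    exact mul_le_mul_of_nonneg_right hn (norm_nonneg _)
  refine Summable.of_norm_bounded (g := fun n => ‖qPoch q (α * q)‖ * C * ‖∏ i ∈ range n, (α - q ^ i)‖)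
    (hP.norm.mul_left _) fun n => ?_
  rw [coefNat, norm_mul, norm_mul]
  gcongr
  refine hb _ ?_
  rw [norm_mul, norm_pow]
  exact mul_le_of_le_one_right (norm_nonneg _) (pow_le_one₀ (norm_nonneg _) hq.le)

lemma summable_coef_of (hq : ‖q‖ < 1) {α β : ℂ} (h1 : Summable (coefNat q α β))
    (h2 : Summable (coefNat q β α)) : Summable (coef q α β) := by
  refine Summable.of_nat_of_neg ?_ ?_
  · simpa only [coef_natCast hq] using h1
  · simp only [coef_neg_natCast]
    exact ((summable_nat_add_iff 1).mpr h2).neg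

lemma summable_coef (hq : ‖q‖ < 1) {α β : ℂ} (hα : ‖α‖ < 1) (hβ : ‖β‖ < 1) :
    Summable (coef q α β) :=
  summable_coef_of hq (summable_coefNat hq β hα) (summable_coefNat hq α hβ)

/-- A bound for the coefficients, uniform for small `α` and `β`. -/
lemma exists_coef_bound (hq : ‖q‖ < 1) : ∃ B : ℤ → ℝ, Summable B ∧
    ∀ α β : ℂ, ‖α‖ ≤ 1 / 2 → ‖β‖ ≤ 1 / 2 → ∀ n, ‖coef q α β n‖ ≤ B n := by
  obtain ⟨C, hC, hb⟩ := exists_qPoch_bound hq 1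
  set P : ℕ → ℝ := fun n => C * C * ∏ i ∈ range n, (1 / 2 + ‖q‖ ^ i) with hPdef
  have hP : Summable P := by
    refine Summable.mul_left _ ?_
    refine summable_of_ratio_norm_eventually_le (r := 3 / 4) (by norm_num) ?_
    have ht : Tendsto (fun n : ℕ => 1 / 2 + ‖q‖ ^ n) atTop (𝓝 (1 / 2)) := by
      simpa using (tendsto_pow_atTop_nhds_zero_of_lt_one (norm_nonneg _) hq).const_add (1 / 2 : ℝ)
    filter_upwards [ht.eventually_le_const (show (1 / 2 : ℝ) < 3 / 4 by norm_num)] with n hn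
    rw [prod_range_succ, norm_mul, mul_comm]
    refine mul_le_mul_of_nonneg_right ?_ (norm_nonneg _)
    rwa [Real.norm_of_nonneg (by positivity)]
  have hbound : ∀ α β : ℂ, ‖α‖ ≤ 1 / 2 → ‖β‖ ≤ 1 / 2 → ∀ n, ‖coefNat q α β n‖ ≤ P n := by
    intro α β hα hβ n
    have hsm : ∀ (z : ℂ) (n : ℕ), ‖z‖ ≤ 1 / 2 → ‖z * q ^ n‖ ≤ 1 := fun z n hz => by
      rw [norm_mul, norm_pow]
      exact mul_le_one₀ (hz.trans (by norm_num)) (by positivity) (pow_le_one₀ (norm_nonneg _) hq.le)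
    rw [coefNat, norm_mul, norm_mul, norm_prod]
    simp only [hPdef]
    gcongr with i _
    · exact hb _ (by simpa using hsm α 1 hα)
    · exact hb _ (hsm β n hβ)
    · refine (norm_sub_le _ _).trans ?_
      rw [norm_pow]
      gcongr
  refine ⟨fun n => if 0 ≤ n then P n.toNat else P (1 - n).toNat, ?_, ?_⟩
  · refine Summable.of_nat_of_neg_add_one ?_ ?_
    · simpa using hP
    · refine ((summable_nat_add_iff 2).mpr hP).congr fun n => ?_
      have e : (1 - -((n : ℤ) + 1)).toNat = n + 2 := by omega
      rw [if_neg (by omega), e]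
  · intro α β hα hβ n
    rcases le_or_gt 0 n with h | h
    · lift n to ℕ using h
      simpa [coef_natCast hq] using hbound α β hα hβ n
    · rw [coef, if_neg (by omega), norm_neg]
      simpa only [if_neg h.not_ge] using hbound β α hβ hα _

end

end DAHA

namespace DAHA

noncomputable section

open Filter Finset

variable {q : ℂ}

/-! ### Ramanujan's bilateral summation on the unit circle -/

lemma tendsto_coefNat_mul_pow (hq : ‖q‖ < 1) (α β : ℂ) (n : ℕ) :
    Tendsto (fun N : ℕ => coefNat q (α * q ^ N) (β * q ^ N) n) atTop (𝓝 (coefNat q 0 0 n)) := by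
  have hc : Continuous fun p : ℂ × ℂ => coefNat q p.1 p.2 n := by
    have := continuous_qPoch hq
    unfold coefNat
    fun_prop
  have := (hc.tendsto (0, 0)).comp
    ((tendsto_mul_pow hq α).prodMk_nhds (tendsto_mul_pow hq β))
  exact this

lemma tendsto_coef_mul_pow (hq : ‖q‖ < 1) (α β : ℂ) (n : ℤ) :
    Tendsto (fun N : ℕ => coef q (α * q ^ N) (β * q ^ N) n) atTop (𝓝 (coef q 0 0 n)) := by
  unfold coef
  split_ifs
  · exact tendsto_coefNat_mul_pow hq α β _
  · exact (tendsto_coefNat_mul_pow hq β α _).neg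

/-- Sums against a bounded sequence are continuous at `α = β = 0`. -/
lemma tendsto_tsum_coef_mul (hq : ‖q‖ < 1) (α β : ℂ) (w : ℤ → ℂ) (hw : ∀ n, ‖w n‖ ≤ 1) :
    Tendsto (fun N : ℕ => ∑' n : ℤ, coef q (α * q ^ N) (β * q ^ N) n * w n) atTop
      (𝓝 (∑' n : ℤ, coef q 0 0 n * w n)) := by
  obtain ⟨B, hB, hb⟩ := exists_coef_bound hq
  refine tendsto_tsum_of_dominated_convergence hB
    (fun n => (tendsto_coef_mul_pow hq α β n).mul_const _) ?_
  have h0 : ∀ z : ℂ, ∀ᶠ N : ℕ in atTop, ‖z * q ^ N‖ ≤ 1 / 2 := fun z =>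
    ((tendsto_mul_pow hq z).norm.eventually_le_const (by simp))
  filter_upwards [h0 α, h0 β] with N h1 h2 n
  rw [norm_mul]
  exact (mul_le_of_le_one_right (norm_nonneg _) (hw n)).trans (hb _ _ h1 h2 n)

lemma norm_zpow_eq_one {u : ℂ} (hu : ‖u‖ = 1) (n : ℤ) : ‖u ^ n‖ = 1 := by
  rw [norm_zpow, hu, one_zpow]

lemma ne_zero_of_norm_eq_one {u : ℂ} (hu : ‖u‖ = 1) : u ≠ 0 := by
  rintro rfl; simp at hu

lemma summable_mul_zpow {g : ℤ → ℂ} (hg : Summable g) {u : ℂ} (hu : ‖u‖ = 1) :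
    Summable fun n => g n * u ^ n :=
  Summable.of_norm_bounded hg.norm fun n => by rw [norm_mul, norm_zpow_eq_one hu, mul_one]

lemma summable_sub_one {g : ℤ → ℂ} (hg : Summable g) : Summable fun n => g (n - 1) :=
  (Equiv.subRight (1 : ℤ)).summable_iff.mpr hg

lemma summable_one_sub {g : ℤ → ℂ} (hg : Summable g) : Summable fun n => g (1 - n) :=
  (Equiv.subLeft (1 : ℤ)).summable_iff.mpr hg

/-- Multiplication of a bilateral series by `1 - w u`. -/
lemma tsum_sub_mul_zpow {g : ℤ → ℂ} (hg : Summable g) (w : ℂ) {u : ℂ} (hu : ‖u‖ = 1) :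
    ∑' n, (g n - w * g (n - 1)) * u ^ n = (1 - w * u) * ∑' n, g n * u ^ n := by
  have h1 := summable_mul_zpow hg hu
  have h2 := summable_mul_zpow (summable_sub_one hg) hu
  have e : ∑' n, g (n - 1) * u ^ n = u * ∑' n, g n * u ^ n := by
    rw [← (Equiv.addRight (1 : ℤ)).tsum_eq, ← tsum_mul_left]
    refine tsum_congr fun n => ?_
    simp only [Equiv.coe_addRight, add_sub_cancel_right, zpow_add_one₀ (ne_zero_of_norm_eq_one hu)]
    ring
  calc ∑' n, (g n - w * g (n - 1)) * u ^ n
      = ∑' n, (g n * u ^ n - w * (g (n - 1) * u ^ n)) := tsum_congr fun n => by ring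
    _ = ∑' n, g n * u ^ n - w * ∑' n, g (n - 1) * u ^ n := by
        rw [h1.tsum_sub (h2.mul_left w), tsum_mul_left]
    _ = _ := by rw [e]; ring

/-- Reflection of a bilateral series. -/
lemma tsum_neg_one_sub (g : ℤ → ℂ) {u : ℂ} (hu : u ≠ 0) :
    ∑' n, -g (1 - n) * u ^ n = -u * ∑' n, g n * u⁻¹ ^ n := by
  rw [← (Equiv.subLeft (1 : ℤ)).tsum_eq, ← tsum_mul_left]
  refine tsum_congr fun n => ?_
  simp only [Equiv.subLeft_apply, sub_sub_cancel, inv_zpow', zpow_sub₀ hu, zpow_one, zpow_neg]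
  field_simp

lemma tsum_coef_swap (α β : ℂ) {u : ℂ} (hu : u ≠ 0) :
    ∑' n, coef q α β n * u ^ n = -u * ∑' n, coef q β α n * u⁻¹ ^ n := by
  rw [← tsum_neg_one_sub _ hu]
  exact tsum_congr fun n => by rw [coef_swap α β]

lemma one_sub_mul_tsum_coef (hq : ‖q‖ < 1) {α β u : ℂ} (hs : Summable (coef q α β)) (hu : ‖u‖ = 1) :
    (1 - α * u) * ∑' n, coef q α β n * u ^ n =
      (1 - α * β) * ∑' n, coef q (α * q) β n * u ^ n := by
  rw [← tsum_sub_mul_zpow hs α hu, ← tsum_mul_left]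
  exact tsum_congr fun n => by rw [coef_sub hq]; ring

lemma one_sub_div_mul_tsum_coef (hq : ‖q‖ < 1) {α β u : ℂ} (hs : Summable (coef q β α))
    (hu : ‖u‖ = 1) :
    (1 - β * u⁻¹) * ∑' n, coef q α β n * u ^ n =
      (1 - α * β) * ∑' n, coef q α (β * q) n * u ^ n := by
  have hu0 := ne_zero_of_norm_eq_one hu
  rw [tsum_coef_swap α β hu0, tsum_coef_swap α (β * q) hu0]
  have := one_sub_mul_tsum_coef hq hs (u := u⁻¹) (by simp [hu])
  linear_combination (-u) * this

lemma norm_mul_pow_lt_one (hq : ‖q‖ < 1) {α : ℂ} (hα : ‖α‖ < 1) (n : ℕ) : ‖α * q ^ n‖ < 1 := by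
  rw [norm_mul, norm_pow]
  exact (mul_le_of_le_one_right (norm_nonneg _) (pow_le_one₀ (norm_nonneg _) hq.le)).trans_lt hα

/-- Apply the recursion in `α` and then the one in `β`, `N` times. Each application multiplies one
parameter by `q`, so the factors `1 - αβ q ^ i` occur for `2N` consecutive exponents. -/
lemma prod_mul_tsum_coef (hq : ‖q‖ < 1) {α β u : ℂ} (hα : ‖α‖ < 1) (hβ : ‖β‖ < 1) (hu : ‖u‖ = 1)
    (N : ℕ) :
    (∏ i ∈ range N, (1 - α * u * q ^ i)) * (∏ i ∈ range N, (1 - β * u⁻¹ * q ^ i)) *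
        ∑' n, coef q α β n * u ^ n =
      (∏ i ∈ range (2 * N), (1 - α * β * q ^ i)) *
        ∑' n, coef q (α * q ^ N) (β * q ^ N) n * u ^ n := by
  induction N with
  | zero => simp
  | succ N ih =>
    have a1 := norm_mul_pow_lt_one hq hα N
    have b1 := norm_mul_pow_lt_one hq hβ N
    have a2 := norm_mul_pow_lt_one hq hα (N + 1)
    have h1 := one_sub_mul_tsum_coef hq (summable_coef hq a1 b1) hu
    have h2 := one_sub_div_mul_tsum_coef hq (summable_coef hq b1 a2) hu
    rw [mul_assoc α (q ^ N) q, ← pow_succ] at h1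
    rw [mul_assoc β (q ^ N) q, ← pow_succ] at h2
    rw [show 2 * (N + 1) = 2 * N + 1 + 1 by ring, prod_range_succ, prod_range_succ, prod_range_succ,
      prod_range_succ]
    have e1 : α * q ^ N * (β * q ^ N) = α * β * q ^ (2 * N) := by ring
    have e2 : α * q ^ (N + 1) * (β * q ^ N) = α * β * q ^ (2 * N + 1) := by ring
    rw [e1] at h1
    rw [e2] at h2
    linear_combination (1 - α * u * q ^ N) * (1 - β * u⁻¹ * q ^ N) * ih +
      (∏ i ∈ range (2 * N), (1 - α * β * q ^ i)) * (1 - β * u⁻¹ * q ^ N) * h1 +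
      (∏ i ∈ range (2 * N), (1 - α * β * q ^ i)) * (1 - α * β * q ^ (2 * N)) * h2

/-- Let `N → ∞` in `prod_mul_tsum_coef`: both parameters tend to `0`, and the uniform bound on the
coefficients allows the limit inside the sum. -/
lemma qPoch_mul_tsum_coef (hq : ‖q‖ < 1) {α β u : ℂ} (hα : ‖α‖ < 1) (hβ : ‖β‖ < 1)
    (hu : ‖u‖ = 1) :
    qPoch q (α * u) * qPoch q (β * u⁻¹) * ∑' n, coef q α β n * u ^ n =
      qPoch q (α * β) * ∑' n, coef q 0 0 n * u ^ n := by
  refine tendsto_nhds_unique (((tendsto_prod_qPoch hq (α * u)).mul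
    (tendsto_prod_qPoch hq (β * u⁻¹))).mul_const _) ?_
  refine Tendsto.congr (fun N => (prod_mul_tsum_coef hq hα hβ hu N).symm) ?_
  refine Tendsto.mul ?_ (tendsto_tsum_coef_mul hq α β _ fun n => (norm_zpow_eq_one hu n).le)
  exact (tendsto_prod_qPoch hq (α * β)).comp
    (tendsto_atTop_mono (fun n => by dsimp only [id]; omega) tendsto_id : Tendsto (fun n : ℕ => 2 * n) atTop atTop)

/-- For `α = 1`, `β = q` the bilateral series has a single term. -/
lemma coef_one_self (hq : ‖q‖ < 1) (n : ℤ) :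
    coef q 1 q n = if n = 0 then qPoch q q ^ 2 else 0 := by
  split_ifs with h
  · subst h
    have := coef_natCast hq 1 q 0
    rw [Nat.cast_zero] at this
    rw [this]
    simp [coefNat, sq]
  · rcases lt_or_gt_of_ne h with h | h
    · obtain ⟨m, rfl⟩ : ∃ m : ℕ, n = -((m + 1 : ℕ) : ℤ) := ⟨(-n - 1).toNat, by omega⟩
      rw [coef_neg_natCast, coefNat, prod_eq_zero (i := 1) (by simp) (by simp)]
      simp
    · obtain ⟨m, rfl⟩ : ∃ m : ℕ, n = ((m + 1 : ℕ) : ℤ) := ⟨(n - 1).toNat, by omega⟩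
      rw [coef_natCast hq, coefNat, prod_eq_zero (i := 0) (by simp) (by simp)]
      simp

lemma summable_coef_one_self (hq : ‖q‖ < 1) : Summable (coef q 1 q) := by
  refine summable_of_ne_finset_zero (s := {0}) fun n hn => ?_
  rw [coef_one_self hq, if_neg (by simpa using hn)]

lemma qPoch_self_ne_zero (hq : ‖q‖ < 1) : qPoch q q ≠ 0 := by
  refine qPoch_ne_zero hq fun i hi => ?_
  have h := congrArg norm hi
  rw [← pow_succ', norm_pow, norm_one] at h
  exact (pow_lt_one₀ (norm_nonneg _) hq (by omega)).ne h

/-- The Jacobi triple product on the unit circle. -/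
lemma tsum_coef_zero (hq : ‖q‖ < 1) {u : ℂ} (hu : ‖u‖ = 1) :
    ∑' n, coef q 0 0 n * u ^ n = qPoch q q * (qPoch q u * qPoch q (q * u⁻¹)) := by
  -- The single-term series at `α = 1`, `β = q` fixes the constant. Since `α = 1` is on the
  -- boundary, one recursion step first moves it to `α = q`, inside the disc.
  have h1 := one_sub_mul_tsum_coef hq (summable_coef_one_self hq) hu
  have h2 := qPoch_mul_tsum_coef hq hq hq hu
  have e : ∑' n, coef q 1 q n * u ^ n = qPoch q q ^ 2 := by
    rw [tsum_eq_single 0 fun n hn => by rw [coef_one_self hq, if_neg hn, zero_mul],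
      coef_one_self hq]
    simp
  rw [e, one_mul, one_mul] at h1
  have h3 := qPoch_eq_mul hq u
  have h4 := qPoch_eq_mul hq q
  rw [mul_comm q u] at h2
  have hne : qPoch q (q * q) ≠ 0 := by
    intro h
    exact qPoch_self_ne_zero hq (by rw [h4, h, mul_zero])
  have hne' : (1 - q : ℂ) ≠ 0 := by
    intro h
    exact qPoch_self_ne_zero hq (by rw [h4, h, zero_mul])
  apply mul_left_cancel₀ (mul_ne_zero hne' hne)
  rw [h3]
  linear_combination (-(1 - q)) * h2 - qPoch q (u * q) * qPoch q (q * u⁻¹) * h1 +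
    qPoch q (u * q) * qPoch q (q * u⁻¹) * (1 - u) * qPoch q q * h4

/-- The weight `(u)_∞ (q / u)_∞ / ((α u)_∞ (β / u)_∞)`. -/
def weight (q α β u : ℂ) : ℂ :=
  qPoch q u * qPoch q (q * u⁻¹) / (qPoch q (α * u) * qPoch q (β * u⁻¹))

/-- Ramanujan's bilateral summation. -/
lemma tsum_coef (hq : ‖q‖ < 1) {α β u : ℂ} (hα : ‖α‖ < 1) (hβ : ‖β‖ < 1) (hu : ‖u‖ = 1) :
    ∑' n, coef q α β n * u ^ n = qPoch q q * qPoch q (α * β) * weight q α β u := by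
  have hne : ∀ {α u : ℂ}, ‖α‖ < 1 → ‖u‖ = 1 → qPoch q (α * u) ≠ 0 := by
    intro α u hα hu
    refine qPoch_ne_zero hq fun i hi => ?_
    have h : ‖α * u * q ^ i‖ < 1 := norm_mul_pow_lt_one hq (by rwa [norm_mul, hu, mul_one]) i
    rw [hi, norm_one] at h
    exact h.false
  have h := qPoch_mul_tsum_coef hq hα hβ hu
  rw [tsum_coef_zero hq hu] at h
  have h1 := hne hα hu
  have h2 := hne hβ (show ‖u⁻¹‖ = 1 by simp [hu])
  rw [weight, mul_div_assoc', eq_div_iff (mul_ne_zero h1 h2)]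
  linear_combination h

end

end DAHA

namespace DAHA

noncomputable section

open Filter Finset

variable {q : ℂ}

/-! ### Crossing poles -/

/-- Solving `g n - w g (n - 1) = h n` backwards. -/
lemma summable_of_sub_mul {g h : ℤ → ℂ} {w : ℂ} (hw : 1 < ‖w‖) (hh : Summable h)
    (hg : ∀ n, g n - w * g (n - 1) = h n)
    (ht : ∀ n : ℤ, Tendsto (fun m : ℕ => w⁻¹ ^ m * g (n + m)) atTop (𝓝 0)) : Summable g := by
  have hw0 : w ≠ 0 := by rintro rfl; simp at hw; linarith
  have hw1 : ‖w⁻¹‖ < 1 := by rw [norm_inv]; exact inv_lt_one_of_one_lt₀ hw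
  have hgeo : Summable fun i : ℕ => ‖w⁻¹ ^ (i + 1)‖ := by
    simpa using (summable_nat_add_iff 1).mpr (summable_geometric_of_lt_one (norm_nonneg _) hw1)
  -- The double family is a reindexed piece of a product of two absolutely summable ones, so its
  -- sums over `i` are summable in `n`.
  have hprod : Summable fun x : ℤ × ℕ => w⁻¹ ^ (x.2 + 1) * h (x.1 + (x.2 + 1)) := by
    have h1 : Summable fun x : ℕ × ℤ => w⁻¹ ^ (x.1 + 1) * h x.2 :=
      summable_mul_of_summable_norm (f := fun i : ℕ => w⁻¹ ^ (i + 1)) hgeo hh.norm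
    have hinj : Function.Injective fun x : ℤ × ℕ => (x.2, x.1 + ((x.2 : ℤ) + 1)) := by
      rintro ⟨a, b⟩ ⟨c, d⟩ hx
      simp only [Prod.mk.injEq] at hx ⊢
      omega
    refine (h1.comp_injective hinj).congr fun x => ?_
    rfl
  -- The growth hypothesis `ht` rules out the homogeneous solutions `c w ^ n`; what remains is this
  -- convergent formula.
  suffices hsum : ∀ n, g n = -∑' i : ℕ, w⁻¹ ^ (i + 1) * h (n + (i + 1)) by
    rw [funext hsum]
    exact hprod.prod.neg
  intro n
  have hfin : ∀ m : ℕ, g n = w⁻¹ ^ m * g (n + m) -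
      ∑ i ∈ range m, w⁻¹ ^ (i + 1) * h (n + (i + 1)) := by
    intro m
    induction m with
    | zero => simp
    | succ m ih =>
      rw [ih, sum_range_succ, ← hg]
      have e : n + ((m : ℤ) + 1) - 1 = n + m := by ring
      rw [e, pow_succ]
      push_cast
      field_simp
      ring
  have hs : HasSum (fun i : ℕ => w⁻¹ ^ (i + 1) * h (n + (i + 1)))
      (∑' i : ℕ, w⁻¹ ^ (i + 1) * h (n + (i + 1))) := (hprod.prod_factor n).hasSum
  have hlim := (ht n).sub hs.tendsto_sum_nat
  have := tendsto_nhds_unique (hlim.congr fun m => (hfin m).symm) tendsto_const_nhds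
  rw [zero_sub] at this
  exact this.symm

/-- The residue (up to a constant) of the weight at `u = (α q ^ j)⁻¹`. -/
def res (q α β : ℂ) (j : ℕ) : ℂ :=
  qPoch q (α * q ^ j)⁻¹ * qPoch q (α * q ^ (j + 1)) *
    ∏ i ∈ range j, (1 - α * β * q ^ i) / (1 - (q ^ (i + 1))⁻¹)

lemma one_sub_inv_pow_ne_zero (hq : ‖q‖ < 1) (j : ℕ) : (1 : ℂ) - (q ^ (j + 1))⁻¹ ≠ 0 := by
  intro h
  have h1 : (q ^ (j + 1))⁻¹ = 1 := by linear_combination -h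
  have h2 := congrArg norm (inv_eq_one.mp h1)
  rw [norm_pow, norm_one] at h2
  exact (pow_lt_one₀ (norm_nonneg _) hq (by omega)).ne h2

/-- Replacing `α` by `αq` removes the pole `j = 0` and relabels `j + 1` as `j`. The factor is the
value of `1 - αu` at the pole `u = (α q ^ (j + 1))⁻¹`. -/
lemma res_succ (hq : ‖q‖ < 1) (α β : ℂ) (j : ℕ) :
    res q α β (j + 1) * (1 - (q ^ (j + 1))⁻¹) = (1 - α * β) * res q (α * q) β j := by
  have e : ∏ i ∈ range (j + 1), (1 - α * β * q ^ i) =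
      (1 - α * β) * ∏ i ∈ range j, (1 - α * q * β * q ^ i) := by
    rw [prod_range_succ', mul_comm]
    congr 1
    · ring
    · exact prod_congr rfl fun i _ => by ring
  have h := one_sub_inv_pow_ne_zero hq j
  simp only [res, prod_div_distrib]
  rw [e, prod_range_succ, mul_assoc α q (q ^ j), ← pow_succ', mul_assoc α q (q ^ (j + 1)),
    ← pow_succ', mul_comm (∏ i ∈ range j, (1 - (q ^ (i + 1))⁻¹)), mul_div_mul_comm]
  linear_combination qPoch q (α * q ^ (j + 1))⁻¹ * qPoch q (α * q ^ (j + 1 + 1)) *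
    ((∏ i ∈ range j, (1 - α * q * β * q ^ i)) / ∏ i ∈ range j, (1 - (q ^ (i + 1))⁻¹)) *
    div_mul_cancel₀ (1 - α * β) h

/-- Here the pole stays in place, and the factor is the value of `1 - β/u` at `u = (α q ^ j)⁻¹`. -/
lemma res_mul (α β : ℂ) (j : ℕ) :
    res q α β j * (1 - α * β * q ^ j) = (1 - α * β) * res q α (β * q) j := by
  have e : (∏ i ∈ range j, (1 - α * β * q ^ i)) * (1 - α * β * q ^ j) =
      (1 - α * β) * ∏ i ∈ range j, (1 - α * (β * q) * q ^ i) := by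
    rw [← prod_range_succ, prod_range_succ', mul_comm]
    congr 1
    · ring
    · exact prod_congr rfl fun i _ => by ring
  simp only [res, prod_div_distrib]
  simp only [div_eq_mul_inv]
  linear_combination qPoch q (α * q ^ j)⁻¹ * qPoch q (α * q ^ (j + 1)) *
    (∏ i ∈ range j, (1 - (q ^ (i + 1))⁻¹))⁻¹ * e

/-- The bilateral coefficients corrected by the residues at the first `A` poles of one family and
the first `B` poles of the other one. -/
def corr (q α β : ℂ) (A B : ℕ) (n : ℤ) : ℂ :=
  coef q α β n - ∑ j ∈ range A, res q α β j * (α * q ^ j) ^ n +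
    ∑ j ∈ range B, res q β α j * (β * q ^ j) ^ (1 - n)

lemma corr_swap (α β : ℂ) (A B : ℕ) (n : ℤ) : corr q α β A B n = -corr q β α B A (1 - n) := by
  unfold corr
  rw [coef_swap α β n, sub_sub_cancel]
  ring

/-- The recursion of `coef` survives the correction: the `j = 0` geometric sequence is killed by `g
n - α g (n - 1)`, the later ones shift by `res_succ`, and the other family follows `res_mul`. -/
lemma corr_sub (hq : ‖q‖ < 1) (hq0 : q ≠ 0) {α β : ℂ} (hα : α ≠ 0) {B : ℕ} (hβ : 0 < B → β ≠ 0)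
    (A : ℕ) (n : ℤ) :
    corr q α β (A + 1) B n - α * corr q α β (A + 1) B (n - 1) =
      (1 - α * β) * corr q (α * q) β A B n := by
  have h1 : ∑ j ∈ range (A + 1), res q α β j * (α * q ^ j) ^ n -
      α * ∑ j ∈ range (A + 1), res q α β j * (α * q ^ j) ^ (n - 1) =
      (1 - α * β) * ∑ j ∈ range A, res q (α * q) β j * (α * q * q ^ j) ^ n := by
    rw [mul_sum, mul_sum, ← sum_sub_distrib, sum_range_succ', pow_zero, mul_one,
      zpow_sub_one₀ hα]
    rw [show res q α β 0 * α ^ n - α * (res q α β 0 * (α ^ n * α⁻¹)) = 0 by field_simp; ring, add_zero]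
    refine sum_congr rfl fun j _ => ?_
    have hne : α * q ^ (j + 1) ≠ 0 := mul_ne_zero hα (pow_ne_zero _ hq0)
    have hr := res_succ hq α β j
    rw [mul_assoc α q, ← pow_succ', zpow_sub_one₀ hne, mul_inv]
    calc _ = res q α β (j + 1) * (1 - α * α⁻¹ * (q ^ (j + 1))⁻¹) * (α * q ^ (j + 1)) ^ n := by ring
      _ = _ := by rw [mul_inv_cancel₀ hα, one_mul, hr]; ring
  have h2 : ∑ j ∈ range B, res q β α j * (β * q ^ j) ^ (1 - n) -
      α * ∑ j ∈ range B, res q β α j * (β * q ^ j) ^ (1 - (n - 1)) =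
      (1 - α * β) * ∑ j ∈ range B, res q β (α * q) j * (β * q ^ j) ^ (1 - n) := by
    rw [mul_sum, mul_sum, ← sum_sub_distrib]
    refine sum_congr rfl fun j hj => ?_
    have hne : β * q ^ j ≠ 0 :=
      mul_ne_zero (hβ (by have := mem_range.mp hj; omega)) (pow_ne_zero _ hq0)
    have hr := res_mul (q := q) β α j
    rw [show 1 - (n - 1) = (1 - n) + 1 by ring, zpow_add_one₀ hne]
    linear_combination (β * q ^ j) ^ (1 - n) * hr
  have h3 := coef_sub hq α β n
  unfold corr
  linear_combination h3 - h1 + h2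

/-- The coefficients grow like `res_0 α ^ m`, and the correction subtracts exactly this leading
term. All other geometric terms are of smaller order, so the growth hypothesis of
`summable_of_sub_mul` is met. -/
lemma tendsto_corr (hq : ‖q‖ < 1) (hq0 : q ≠ 0) {α β : ℂ} {A B : ℕ} (hα : 1 < ‖α‖)
    (hβ : ∀ j < B, 1 < ‖β * q ^ j‖) :
    Tendsto (fun m : ℕ => α⁻¹ ^ m * corr q α β (A + 1) B m) atTop (𝓝 0) := by
  have hα0 : α ≠ 0 := by rintro rfl; simp at hα; linarith
  have h1 : Tendsto (fun m : ℕ => α⁻¹ ^ m * coef q α β m) atTop (𝓝 (res q α β 0)) := by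
    have e : ∀ m : ℕ, α⁻¹ ^ m * coef q α β m =
        qPoch q (α * q) * qPoch q (β * q ^ m) * ∏ i ∈ range m, (1 - α⁻¹ * q ^ i) := by
      intro m
      have : ∀ i ∈ range m, 1 - α⁻¹ * q ^ i = α⁻¹ * (α - q ^ i) := fun i _ => by field_simp
      rw [coef_natCast hq, coefNat, prod_congr rfl this, prod_mul_distrib, prod_const, card_range]
      ring
    have hl := ((tendsto_qPoch_mul_pow hq β).const_mul (qPoch q (α * q))).mul
      (tendsto_prod_qPoch hq α⁻¹)
    refine (hl.congr fun m => (e m).symm).trans (le_of_eq ?_)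
    simp [res, mul_comm]
  have h2 : Tendsto (fun m : ℕ => ∑ j ∈ range A,
      α⁻¹ ^ m * (res q α β (j + 1) * (α * q ^ (j + 1)) ^ (m : ℤ))) atTop (𝓝 0) := by
    rw [← sum_const_zero (s := range A)]
    refine tendsto_finsetSum _ fun j _ => ?_
    have e : ∀ m : ℕ, α⁻¹ ^ m * (res q α β (j + 1) * (α * q ^ (j + 1)) ^ (m : ℤ)) =
        res q α β (j + 1) * (q ^ (j + 1)) ^ m := by
      intro m
      rw [zpow_natCast, mul_pow, inv_pow]
      field_simp
    simp only [e]
    refine tendsto_mul_pow ?_ _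
    rw [norm_pow]
    exact pow_lt_one₀ (norm_nonneg _) hq (by omega)
  have h3 : Tendsto (fun m : ℕ => ∑ j ∈ range B,
      α⁻¹ ^ m * (res q β α j * (β * q ^ j) ^ (1 - (m : ℤ)))) atTop (𝓝 0) := by
    rw [← sum_const_zero (s := range B)]
    refine tendsto_finsetSum _ fun j hj => ?_
    have hb := hβ j (mem_range.mp hj)
    have hne : β * q ^ j ≠ 0 := by intro h; rw [h] at hb; simp at hb; linarith
    have e : ∀ m : ℕ, α⁻¹ ^ m * (res q β α j * (β * q ^ j) ^ (1 - (m : ℤ))) =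
        res q β α j * (β * q ^ j) * ((α * (β * q ^ j))⁻¹) ^ m := by
      intro m
      rw [zpow_sub₀ hne, zpow_natCast, zpow_one, mul_inv, mul_pow α⁻¹, inv_pow (β * q ^ j),
        div_eq_mul_inv]
      ring
    simp only [e]
    refine tendsto_mul_pow ?_ _
    rw [norm_inv, norm_mul]
    exact inv_lt_one_of_one_lt₀ (one_lt_mul_of_lt_of_le hα hb.le)
  have h4 := ((h1.sub (h2.add (tendsto_const_nhds (x := res q α β 0)))).add h3)
  simp only [zero_add, sub_self, add_zero] at h4
  refine h4.congr fun m => ?_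
  unfold corr
  rw [sum_range_succ', mul_add, mul_sub, mul_add, mul_sum, mul_sum, pow_zero, mul_one, zpow_natCast]
  have : α⁻¹ ^ m * (res q α β 0 * α ^ m) = res q α β 0 := by
    rw [inv_pow]; field_simp
  rw [this]

/-- The expansion of the weight on the unit circle has the corrected coefficients. -/
def HasExpansion (q α β : ℂ) (A B : ℕ) : Prop :=
  Summable (corr q α β A B) ∧ ∀ u : ℂ, ‖u‖ = 1 →
    ∑' n, corr q α β A B n * u ^ n = qPoch q q * qPoch q (α * β) * weight q α β u

lemma weight_swap (hq : ‖q‖ < 1) (α β : ℂ) {u : ℂ} (hu : u ≠ 0) :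
    weight q β α u⁻¹ * -u = weight q α β u := by
  have h1 := qPoch_eq_mul hq u⁻¹
  have h2 := qPoch_eq_mul hq u
  simp only [weight, inv_inv]
  rw [h1, h2, mul_comm q u, mul_comm q u⁻¹, mul_comm (qPoch q (β * u⁻¹)), div_mul_eq_mul_div]
  congr 1
  linear_combination qPoch q (u⁻¹ * q) * qPoch q (u * q) * mul_inv_cancel₀ hu

lemma HasExpansion.swap (hq : ‖q‖ < 1) {α β : ℂ} {A B : ℕ} (h : HasExpansion q α β A B) :
    HasExpansion q β α B A := by
  have e : corr q β α B A = fun n => -corr q α β A B (1 - n) := funext fun n => corr_swap _ _ _ _ _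
  refine ⟨?_, fun u hu => ?_⟩
  · rw [e]
    exact (summable_one_sub h.1).neg
  · have hu0 := ne_zero_of_norm_eq_one hu
    rw [e, tsum_neg_one_sub _ hu0, h.2 u⁻¹ (by simp [hu]), ← weight_swap hq β α hu0, mul_comm α β]
    ring

/-- Dividing the expansion for `αq` by `1 - αu`, which has no zero on the unit circle because `|α| >
1`. The recursion identifies the quotient series with the corrected coefficients having one more
pole. -/
lemma HasExpansion.step (hq : ‖q‖ < 1) (hq0 : q ≠ 0) {α β : ℂ} {A B : ℕ} (hα : 1 < ‖α‖)
    (hβ : ∀ j < B, 1 < ‖β * q ^ j‖) (h : HasExpansion q (α * q) β A B) :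
    HasExpansion q α β (A + 1) B := by
  have hα0 : α ≠ 0 := by rintro rfl; simp at hα; linarith
  have hβ0 : 0 < B → β ≠ 0 := by
    rintro hB rfl
    have := hβ 0 hB
    simp at this
    linarith
  have hrec := corr_sub hq hq0 hα0 hβ0 A
  have hs : Summable (corr q α β (A + 1) B) := by
    refine summable_of_sub_mul hα (h.1.mul_left (1 - α * β)) hrec fun n => ?_
    -- This limit is based at index `0`; multiplication by `α ^ n` moves the base point to `n`.
    have ht := tendsto_corr hq hq0 (A := A) hα hβ
    have h0 : Tendsto (fun m : ℕ => ((n : ℤ) + m).toNat) atTop atTop := by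
      refine tendsto_atTop.mpr fun b => ?_
      filter_upwards [eventually_ge_atTop (b + n.natAbs)] with m hm
      omega
    have h1 := (ht.comp h0).const_mul (α ^ n)
    rw [mul_zero] at h1
    refine h1.congr' ?_
    filter_upwards [eventually_ge_atTop n.natAbs] with m hm
    have e : ((n + m).toNat : ℤ) = n + m := by omega
    simp only [Function.comp]
    rw [← zpow_natCast α⁻¹ (n + m).toNat, e, ← mul_assoc, inv_zpow', neg_add, zpow_add₀ hα0,
      zpow_neg, zpow_neg, zpow_natCast, ← mul_assoc, mul_inv_cancel₀ (zpow_ne_zero _ hα0), one_mul,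
      inv_pow]
  refine ⟨hs, fun u hu => ?_⟩
  have h1 := tsum_sub_mul_zpow hs α hu
  have h2 : ∑' n, (corr q α β (A + 1) B n - α * corr q α β (A + 1) B (n - 1)) * u ^ n =
      (1 - α * β) * ∑' n, corr q (α * q) β A B n * u ^ n := by
    rw [← tsum_mul_left]
    exact tsum_congr fun n => by rw [hrec]; ring
  have hne : 1 - α * u ≠ 0 := by
    intro h0
    have := congrArg norm (show α * u = 1 by linear_combination -h0)
    rw [norm_mul, hu, mul_one, norm_one] at this
    exact hα.ne' this
  rw [h2, h.2 u hu] at h1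
  apply mul_left_cancel₀ hne
  rw [← h1, qPoch_eq_mul hq (α * β), weight, weight, qPoch_eq_mul hq (α * u)]
  rw [show α * β * q = α * q * β by ring, show α * u * q = α * q * u by ring]
  -- When the remaining denominator vanishes, both sides are `0` because division by zero is `0`.
  by_cases h3 : qPoch q (α * q * u) * qPoch q (β * u⁻¹) = 0
  · rw [mul_assoc (1 - α * u), h3]; simp
  · have h4 := left_ne_zero_of_mul h3
    have h5 := right_ne_zero_of_mul h3
    rw [mul_div_assoc', mul_div_assoc', mul_div_assoc', mul_div_assoc',
      div_eq_div_iff (mul_ne_zero h4 h5) (mul_ne_zero (mul_ne_zero hne h4) h5)]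
    ring

lemma hasExpansion_left (hq : ‖q‖ < 1) (hq0 : q ≠ 0) {β : ℂ} {B : ℕ}
    (hβ : ∀ j < B, 1 < ‖β * q ^ j‖) (A : ℕ) : ∀ {α : ℂ}, (∀ j < A, 1 < ‖α * q ^ j‖) →
    HasExpansion q (α * q ^ A) β 0 B → HasExpansion q α β A B := by
  induction A with
  | zero => intro α _ h; simpa using h
  | succ A ih =>
    intro α hα h
    refine HasExpansion.step hq hq0 (by simpa using hα 0 (by omega)) hβ (ih ?_ ?_)
    · intro j hj
      have := hα (j + 1) (by omega)
      rwa [pow_succ', ← mul_assoc] at this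
    · rwa [pow_succ', ← mul_assoc] at h

/-- The expansion of the weight on the unit circle. -/
theorem hasExpansion (hq : ‖q‖ < 1) (hq0 : q ≠ 0) {α β : ℂ} {A B : ℕ}
    (hα : ∀ j < A, 1 < ‖α * q ^ j‖) (hα' : ‖α * q ^ A‖ < 1)
    (hβ : ∀ j < B, 1 < ‖β * q ^ j‖) (hβ' : ‖β * q ^ B‖ < 1) : HasExpansion q α β A B := by
  -- The base case has both parameters `α q ^ A`, `β q ^ B` inside the disc. The `β`-poles are
  -- crossed first, in swapped form, and then the `α`-poles.
  refine hasExpansion_left hq hq0 hβ A hα (HasExpansion.swap hq ?_)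
  refine hasExpansion_left hq hq0 (by simp) B hβ ?_
  refine ⟨?_, fun u hu => ?_⟩
  · refine (summable_congr fun n => ?_).mpr (summable_coef hq hβ' hα')
    simp [corr]
  · simpa [corr] using tsum_coef hq hβ' hα' hu

end

end DAHA

namespace DAHA

noncomputable section

open Filter Finset

/-! ### Gaussian moments of the bilateral series -/

section

variable {a : ℝ}

lemma norm_qpow (a : ℝ) (z : ℂ) : ‖qpow a z‖ = Real.exp (-z.re / a) := by
  rw [qpow, Complex.norm_exp, Complex.div_ofReal_re, Complex.neg_re]

lemma norm_qpow_one_lt (ha : 0 < a) : ‖qpow a 1‖ < 1 := by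
  rw [norm_qpow, Real.exp_lt_one_iff, Complex.one_re]
  exact div_neg_of_neg_of_pos (by norm_num) ha

lemma qpow_natCast (a : ℝ) (n : ℕ) : qpow a n = qpow a 1 ^ n := by
  rw [qpow, qpow, ← Complex.exp_nat_mul]
  congr 1
  ring

lemma qpow_neg (a : ℝ) (z : ℂ) : qpow a (-z) = (qpow a z)⁻¹ :=
  eq_inv_of_mul_eq_one_left (by rw [← qpow_add, neg_add_cancel, qpow_zero])

lemma qpow_intCast (a : ℝ) (n : ℤ) : qpow a n = qpow a 1 ^ n := by
  rw [qpow, qpow, ← Complex.exp_int_mul]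
  congr 1
  ring

lemma qpow_int_mul (a : ℝ) (n : ℤ) (z : ℂ) : qpow a (n * z) = qpow a z ^ n := by
  rw [qpow, qpow, ← Complex.exp_int_mul]
  congr 1
  ring

lemma qpow_nat_mul (a : ℝ) (n : ℕ) (z : ℂ) : qpow a (n * z) = qpow a z ^ n := by
  rw [qpow, qpow, ← Complex.exp_nat_mul]
  congr 1
  ring

/-- The Gaussian weight `q ^ ((2 n + p)² / 4)`. -/
def gaussWt (a : ℝ) (p n : ℤ) : ℂ := qpow a ((2 * n + p) ^ 2 / 4)

lemma norm_gaussWt_le (ha : 0 < a) (p n : ℤ) : ‖gaussWt a p n‖ ≤ 1 := by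
  have e : ((2 * n + p : ℂ) ^ 2 / 4) = (((2 * n + p) ^ 2 / 4 : ℝ) : ℂ) := by push_cast; ring
  rw [gaussWt, norm_qpow, e, Complex.ofReal_re, Real.exp_le_one_iff, neg_div, neg_nonpos]
  positivity

lemma gaussWt_add_two (a : ℝ) (p n : ℤ) : gaussWt a (p + 2) (n - 1) = gaussWt a p n := by
  unfold gaussWt
  congr 1
  push_cast
  ring

/-- Up to a constant the terms are those of Jacobi's theta function at `τ = i / (πa)`, for which
`exp (πi n² τ) = q ^ (n²)`. -/
lemma summable_zpow_mul_gaussWt (ha : 0 < a) {w : ℂ} (hw : w ≠ 0) (p : ℤ) :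
    Summable fun n : ℤ => w ^ n * gaussWt a p n := by
  have hτ : 0 < (Complex.I / (Real.pi * a) : ℂ).im := by
    have : (Complex.I / (Real.pi * a) : ℂ) = ((1 / (Real.pi * a) : ℝ) : ℂ) * Complex.I := by
      push_cast; ring
    rw [this, Complex.im_ofReal_mul, Complex.I_im, mul_one]
    positivity
  have h := ((summable_jacobiTheta₂_term_iff
    ((Complex.log w - p / a) / (2 * Real.pi * Complex.I)) _).mpr hτ).mul_left
      (qpow a ((p : ℂ) ^ 2 / 4))
  refine h.congr fun n => ?_
  have ha' : (a : ℂ) ≠ 0 := by exact_mod_cast ha.ne'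
  have hπ : (Real.pi : ℂ) ≠ 0 := by exact_mod_cast Real.pi_ne_zero
  rw [jacobiTheta₂_term, gaussWt, qpow, qpow, ← Complex.exp_add]
  have hwn : w ^ n = Complex.exp (n * Complex.log w) := by
    rw [Complex.exp_int_mul, Complex.exp_log hw]
  rw [hwn, ← Complex.exp_add]
  congr 1
  field_simp
  linear_combination ((n : ℂ) ^ 2 * 4) * Complex.I_sq

/-- Growth is at most geometric in both directions for arbitrary `α` and `β`. This is why Gaussian
moments need no restriction to the unit disc. -/
lemma exists_coef_le_pow {q : ℂ} (hq : ‖q‖ < 1) (α β : ℂ) : ∃ C R : ℝ, 0 < C ∧ 0 < R ∧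
    ∀ n : ℤ, ‖coef q α β n‖ ≤ C * (R ^ n + (R⁻¹) ^ n) := by
  set M : ℝ := max ‖α‖ ‖β‖ with hM
  have hα : ‖α‖ ≤ M := le_max_left _ _
  have hβ : ‖β‖ ≤ M := le_max_right _ _
  have hM0 : 0 ≤ M := (norm_nonneg _).trans hα
  obtain ⟨C, hC, hb⟩ := exists_qPoch_bound hq M
  set R : ℝ := M + 1
  have hR : 1 ≤ R := by simp only [R]; linarith
  have key : ∀ α β : ℂ, ‖α‖ ≤ M → ‖β‖ ≤ M → ∀ n, ‖coefNat q α β n‖ ≤ C * C * R ^ n := by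
    intro α β hα hβ n
    have hz : ∀ (z : ℂ) (n : ℕ), ‖z‖ ≤ M → ‖z * q ^ n‖ ≤ M := fun z n hz => by
      rw [norm_mul, norm_pow]
      exact (mul_le_of_le_one_right (norm_nonneg _) (pow_le_one₀ (norm_nonneg _) hq.le)).trans hz
    rw [coefNat, norm_mul, norm_mul, norm_prod]
    have hp : ∏ i ∈ range n, ‖α - q ^ i‖ ≤ R ^ n := by
      rw [← card_range n, ← prod_const, card_range]
      refine prod_le_prod (fun _ _ => norm_nonneg _) fun i _ => (norm_sub_le _ _).trans ?_
      rw [norm_pow]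
      exact add_le_add hα (pow_le_one₀ (norm_nonneg _) hq.le)
    gcongr
    · exact hb _ (by simpa using hz α 1 hα)
    · exact hb _ (hz β n hβ)
  refine ⟨C * C * R, R, by positivity, by positivity, fun n => ?_⟩
  have hR1 : R ^ n ≤ R * R ^ n := le_mul_of_one_le_left (by positivity) hR
  have hR2 : (0 : ℝ) < R ^ n := by positivity
  have hR3 : (0 : ℝ) < R⁻¹ ^ n := by positivity
  rcases le_or_gt 0 n with h | h
  · lift n to ℕ using h
    rw [coef_natCast hq]
    refine (key α β hα hβ n).trans ?_
    rw [mul_assoc (C * C)]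
    simp only [zpow_natCast] at *
    gcongr
    nlinarith
  · obtain ⟨m, rfl⟩ : ∃ m : ℕ, n = -(m : ℤ) := ⟨(-n).toNat, by omega⟩
    rw [coef_neg_natCast, norm_neg]
    refine (key β α hβ hα (m + 1)).trans ?_
    rw [mul_assoc (C * C), pow_succ', inv_zpow', neg_neg, zpow_natCast]
    gcongr
    linarith

lemma summable_coef_mul_gaussWt (ha : 0 < a) (α β : ℂ) (p : ℤ) :
    Summable fun n : ℤ => coef (qpow a 1) α β n * gaussWt a p n := by
  obtain ⟨C, R, hC, hR, hb⟩ := exists_coef_le_pow (norm_qpow_one_lt ha) α β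
  have h1 := (summable_zpow_mul_gaussWt ha (w := (R : ℂ)) (by exact_mod_cast hR.ne') p).norm
  have h2 := (summable_zpow_mul_gaussWt ha (w := (R⁻¹ : ℂ))
    (inv_ne_zero (by exact_mod_cast hR.ne')) p).norm
  refine Summable.of_norm_bounded ((h1.add h2).mul_left C) fun n => ?_
  rw [norm_mul, norm_mul, norm_mul, norm_zpow, norm_zpow, norm_inv, Complex.norm_real,
    Real.norm_of_nonneg hR.le, ← add_mul, ← mul_assoc]
  exact mul_le_mul_of_nonneg_right (hb n) (norm_nonneg _)

/-- The Gaussian moment of `X ^ p` against the bilateral series. -/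
def moment (a : ℝ) (α β : ℂ) (p : ℤ) : ℂ := ∑' n : ℤ, coef (qpow a 1) α β n * gaussWt a p n

/-- Multiplication by `1 - αu` with `u = X ^ 2`: raising `p` by `2` amounts to shifting `n`, so this
is `coef_sub` summed against the Gaussian. -/
lemma moment_sub (ha : 0 < a) (α β : ℂ) (p : ℤ) :
    moment a α β p - α * moment a α β (p + 2) =
      (1 - α * β) * moment a (α * qpow a 1) β p := by
  have h1 : moment a α β (p + 2) = ∑' n, coef (qpow a 1) α β (n - 1) * gaussWt a p n := by
    rw [moment, ← (Equiv.subRight (1 : ℤ)).tsum_eq]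
    exact tsum_congr fun n => by rw [Equiv.subRight_apply, gaussWt_add_two]
  have hs : Summable fun n => coef (qpow a 1) α β (n - 1) * gaussWt a p n := by
    refine ((Equiv.subRight (1 : ℤ)).summable_iff.mpr
      (summable_coef_mul_gaussWt ha α β (p + 2))).congr fun n => ?_
    simp [gaussWt_add_two]
  rw [h1, moment, moment, ← tsum_mul_left, ← tsum_mul_left,
    ← (summable_coef_mul_gaussWt ha α β p).tsum_sub (hs.mul_left α)]
  refine tsum_congr fun n => ?_
  rw [← mul_assoc, ← mul_assoc, ← coef_sub (norm_qpow_one_lt ha)]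
  ring

/-- Substitute `n ↦ 1 - n`; then `2n + p` becomes the negative of `2n - 2 - p`, and the Gaussian
weight sees only the square. -/
lemma moment_swap (a : ℝ) (α β : ℂ) (p : ℤ) : moment a α β p = -moment a β α (-2 - p) := by
  rw [moment, moment, ← (Equiv.subLeft (1 : ℤ)).tsum_eq, ← tsum_neg]
  refine tsum_congr fun n => ?_
  rw [Equiv.subLeft_apply, coef_swap α β, sub_sub_cancel, neg_mul]
  congr 2
  unfold gaussWt
  congr 1
  push_cast
  ring

/-- Comes from `c_{-n} = q ^ n c_n` at `β = αq` by completing the square. It expresses invariance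
under `q ^ (-1/4) X π`. -/
lemma moment_one_sub (ha : 0 < a) (t : ℂ) (p : ℤ) :
    qpow a (p / 2 - 1 / 4) * moment a t (t * qpow a 1) (1 - p) =
      moment a t (t * qpow a 1) p := by
  have hq0 := qpow_ne_zero a 1
  rw [moment, moment, ← (Equiv.neg ℤ).tsum_eq, ← tsum_mul_left]
  refine tsum_congr fun n => ?_
  have h := coef_add_one (norm_qpow_one_lt ha) hq0 t t n
  have e : coef (qpow a 1) t (t * qpow a 1) (-n) =
      qpow a n * coef (qpow a 1) t (t * qpow a 1) n := by
    rw [coef_swap, show 1 - -n = n + 1 by ring, h, qpow_intCast]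
    ring
  rw [Equiv.neg_apply, e]
  have e2 : qpow a (p / 2 - 1 / 4) * qpow a n * gaussWt a (1 - p) (-n) = gaussWt a p n := by
    unfold gaussWt
    rw [← qpow_add, ← qpow_add]
    congr 1
    push_cast
    ring
  rw [← e2]
  ring

/-- The symmetry of the moments corresponding to the operator `T`. -/
lemma moment_antisymm (ha : 0 < a) (t : ℂ) (p : ℤ) :
    moment a t (t * qpow a 1) p - t * moment a t (t * qpow a 1) (p + 2) =
      -(moment a t (t * qpow a 1) (-2 - p) - t * moment a t (t * qpow a 1) (-p)) := by
  have h1 := moment_sub ha t (t * qpow a 1) p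
  have h2 := moment_sub ha t (t * qpow a 1) (-2 - p)
  have h3 := moment_swap a (t * qpow a 1) (t * qpow a 1) p
  rw [show -2 - p + 2 = -p by ring] at h2
  rw [h1, h2, h3]
  ring

/-! ### Evaluation of the moment of `1` -/

/-- Write `M p` for the moments at `(t, tq)`. The two symmetries give `M 2 = tq M 0`, so
`moment_sub` yields equality of the zeroth moments at `(t, tq)` and `(tq, tq)` after cancelling `1 -
t²q`. At the symmetric pair `(tq, tq)`, the swap combined with one more `moment_sub` gives the
factor `(1 - t²q²) / (1 + tq)`. -/
lemma moment_zero_succ (ha : 0 < a) {t : ℂ} (h1 : t ^ 2 * qpow a 1 ≠ 1) (h2 : t * qpow a 1 ≠ -1) :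
    moment a t (t * qpow a 1) 0 =
      (1 - t * qpow a 1) * moment a (t * qpow a 1) (t * qpow a 1 * qpow a 1) 0 := by
  set q := qpow a 1 with hq
  have e0 := moment_sub ha t (t * q) 0
  have e1 := moment_one_sub ha t 1
  have e2 := moment_one_sub ha t 2
  have e3 := moment_antisymm ha t (-1)
  have e4 := moment_sub ha (t * q) (t * q) (-2)
  have e5 := moment_swap a (t * q) (t * q) 0
  have e6 := moment_swap a (t * q * q) (t * q) (-2)
  have hq2 : qpow a (3 / 4) * qpow a (1 / 4) = q := by
    rw [hq, ← qpow_add]; norm_num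
  simp only [← hq] at *
  norm_num at e0 e1 e2 e3 e4 e5 e6
  -- At `p = -1` the `T`-symmetry relates `M (-1) - t M 1` to its own negative.
  have e8 : moment a t (t * q) (-1) = t * moment a t (t * q) 1 := by
    linear_combination (1 / 2 : ℂ) * e3
  have e9 : moment a t (t * q) 2 = t * q * moment a t (t * q) 0 := by
    rw [← e2, e8, ← e1]
    linear_combination t * moment a t (t * q) 0 * hq2
  have h3 : 1 - t * (t * q) ≠ 0 := fun h => h1 (by linear_combination -h)
  have h4 : 1 + t * q ≠ 0 := fun h => h2 (by linear_combination h)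
  rw [e9] at e0
  have e10 : moment a (t * q) (t * q) 0 = moment a t (t * q) 0 :=
    mul_left_cancel₀ h3 (by linear_combination -e0)
  apply mul_left_cancel₀ h4
  rw [← e10]
  have e11 := moment_swap a (t * q) (t * q * q) 0
  norm_num at e11
  linear_combination e5 - e4 - (1 - t * q * (t * q)) * e11

lemma gaussWt_zero (a : ℝ) (n : ℤ) : gaussWt a 0 n = qpow a (n ^ 2) := by
  unfold gaussWt
  congr 1
  push_cast
  ring

lemma moment_zero_eq_prod (ha : 0 < a) {t : ℂ} (h1 : ∀ n : ℕ, t ^ 2 * qpow a 1 ^ (n + 1) ≠ 1)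
    (h2 : ∀ n : ℕ, t * qpow a 1 ^ (n + 1) ≠ -1) (N : ℕ) :
    moment a t (t * qpow a 1) 0 = (∏ i ∈ range N, (1 - t * qpow a 1 * qpow a 1 ^ i)) *
      moment a (t * qpow a 1 ^ N) (t * qpow a 1 * qpow a 1 ^ N) 0 := by
  induction N with
  | zero => simp
  | succ N ih =>
    have h := moment_zero_succ ha (t := t * qpow a 1 ^ N)
      (by have := h1 (2 * N); convert this using 1; ring)
      (by have := h2 N; convert this using 1; ring)
    rw [ih, prod_range_succ, show t * qpow a 1 * qpow a 1 ^ N = t * qpow a 1 ^ N * qpow a 1 by ring,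
      h, pow_succ]
    ring_nf

/-- Iterate `t ↦ tq` and let both parameters tend to `0`, with the Gaussian weight as the bounded
sequence. -/
lemma moment_zero_eq_mul (ha : 0 < a) {t : ℂ} (h1 : ∀ n : ℕ, t ^ 2 * qpow a 1 ^ (n + 1) ≠ 1)
    (h2 : ∀ n : ℕ, t * qpow a 1 ^ (n + 1) ≠ -1) :
    moment a t (t * qpow a 1) 0 = qPoch (qpow a 1) (t * qpow a 1) * moment a 0 0 0 := by
  have hq := norm_qpow_one_lt ha
  have hl := (tendsto_prod_qPoch hq (t * qpow a 1)).mul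
    (tendsto_tsum_coef_mul hq t (t * qpow a 1) _ (norm_gaussWt_le ha 0))
  exact (tendsto_nhds_unique (hl.congr fun N => (moment_zero_eq_prod ha h1 h2 N).symm)
    tendsto_const_nhds).symm

lemma one_ne_pow_mul {q : ℂ} (hq : ‖q‖ < 1) (n : ℕ) : ‖q ^ (n + 1)‖ ≠ 1 := by
  rw [norm_pow]
  exact (pow_lt_one₀ (norm_nonneg _) hq (by omega)).ne

/-- At `t = 1` the series has only its `n = 0` term, so the moment there is `(q)_∞²`, while the
recursion makes it `(q)_∞` times the moment wanted. -/
lemma moment_zero_zero (ha : 0 < a) : moment a 0 0 0 = qPoch (qpow a 1) (qpow a 1) := by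
  have hq := norm_qpow_one_lt ha
  have h := moment_zero_eq_mul ha (t := 1)
    (fun n hn => one_ne_pow_mul hq n (by rw [one_pow, one_mul] at hn; rw [hn, norm_one]))
    (fun n hn => one_ne_pow_mul hq n (by rw [one_mul] at hn; rw [hn, norm_neg, norm_one]))
  rw [one_mul, moment, tsum_eq_single 0 fun n hn => by rw [coef_one_self hq, if_neg hn, zero_mul],
    coef_one_self hq, if_pos rfl, gaussWt_zero, Int.cast_zero, zero_pow two_ne_zero, qpow_zero,
    mul_one, sq] at h
  exact (mul_left_cancel₀ (qPoch_self_ne_zero hq) h).symm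

/-- The normalisation: the Gaussian moment of `1`. -/
lemma moment_zero (ha : 0 < a) {t : ℂ} (h1 : ∀ n : ℕ, t ^ 2 * qpow a 1 ^ (n + 1) ≠ 1)
    (h2 : ∀ n : ℕ, t * qpow a 1 ^ (n + 1) ≠ -1) :
    moment a t (t * qpow a 1) 0 =
      qPoch (qpow a 1) (t * qpow a 1) * qPoch (qpow a 1) (qpow a 1) := by
  rw [moment_zero_eq_mul ha h1 h2, moment_zero_zero ha]

end

end

end DAHA

namespace DAHA

noncomputable section

open Filter Finset

/-! ### The polynomial representation -/

section

open LaurentPolynomial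

variable (a : ℝ) (k : ℂ)

local notation "𝓛" => LaurentPolynomial ℂ

/-- The linear map on Laurent polynomials with prescribed values on monomials. -/
def coeffLin {M : Type*} [AddCommGroup M] [Module ℂ M] (v : ℤ → M) : 𝓛 →ₗ[ℂ] M where
  toFun f := Finsupp.linearCombination ℂ v f.coeff
  map_add' f g := by rw [AddMonoidAlgebra.coeff_add, map_add]
  map_smul' c f := by rw [AddMonoidAlgebra.coeff_smul, map_smul]; rfl

lemma coeffLin_T {M : Type*} [AddCommGroup M] [Module ℂ M] (v : ℤ → M) (n : ℤ) :
    coeffLin v (T n) = v n := by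
  change Finsupp.linearCombination ℂ v (Finsupp.single n 1) = v n
  rw [Finsupp.linearCombination_single, one_smul]

lemma laurent_linearMap_ext {M : Type*} [AddCommMonoid M] [Module ℂ M] {φ ψ : 𝓛 →ₗ[ℂ] M}
    (h : ∀ n, φ (T n) = ψ (T n)) : φ = ψ := by
  refine LinearMap.ext fun f => ?_
  induction f using LaurentPolynomial.induction_on' with
  | add p q hp hq => rw [map_add, map_add, hp, hq]
  | C_mul_T n c => rw [← smul_eq_C_mul, map_smul, map_smul, h]

lemma X_sq_sub_one_ne_zero : (T 2 - 1 : 𝓛) ≠ 0 := by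
  intro h
  have := congrArg (fun f : 𝓛 => f.coeff 0) h
  rw [← T_zero] at this
  simp at this

lemma divDiff_unique {f g : 𝓛} (h : (T 2 - 1) * g = invert f - f) : divDiff f = g :=
  mul_left_cancel₀ X_sq_sub_one_ne_zero (by rw [X_sq_sub_one_mul_divDiff, h])

/-- `divDiff` as a linear map. -/
def divDiffLin : 𝓛 →ₗ[ℂ] 𝓛 where
  toFun := divDiff
  map_add' f g := divDiff_unique (by
    rw [mul_add, X_sq_sub_one_mul_divDiff, X_sq_sub_one_mul_divDiff, map_add]; ring)
  map_smul' c f := divDiff_unique (by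
    rw [RingHom.id_apply, mul_smul_comm, X_sq_sub_one_mul_divDiff, map_smul, smul_sub])

/-- `opT` as a linear map. -/
def opTLin : 𝓛 →ₗ[ℂ] 𝓛 :=
  qpow a (k / 2) • (invert (R := ℂ)).toLinearMap +
    (qpow a (k / 2) - qpow a (-(k / 2))) • divDiffLin

lemma opTLin_apply (f : 𝓛) : opTLin a k f = opT a k f := rfl

lemma invert_divDiff (f : 𝓛) : invert (divDiff f) = T 2 * divDiff f := by
  have h := congrArg (invert (R := ℂ)) (X_sq_sub_one_mul_divDiff f)
  rw [map_mul, map_sub, map_sub, map_one, invert_T, involutive_invert f] at h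
  have h2 := X_sq_sub_one_mul_divDiff f
  have e : (T 2 * T (-2) : 𝓛) = 1 := by rw [← T_add]; simp
  apply mul_left_cancel₀ X_sq_sub_one_ne_zero
  linear_combination (-T 2) * h + invert (divDiff f) * e - T 2 * h2

lemma divDiff_invert (f : 𝓛) : divDiff (invert f) = -divDiff f :=
  divDiff_unique (by rw [mul_neg, X_sq_sub_one_mul_divDiff, involutive_invert f]; ring)

lemma divDiff_divDiff (f : 𝓛) : divDiff (divDiff f) = divDiff f :=
  divDiff_unique (by rw [invert_divDiff]; ring)

lemma divDiff_T_mul (f : 𝓛) : divDiff (T 1 * f) = T (-1) * divDiff f - T (-1) * f := by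
  refine divDiff_unique ?_
  have h2 := X_sq_sub_one_mul_divDiff f
  have e : (T 2 * T (-1) : 𝓛) = T 1 := by rw [← T_add]; norm_num
  rw [map_mul, invert_T]
  linear_combination T (-1) * h2 - f * e

lemma qpow_half_mul_neg : qpow a (k / 2) * qpow a (-(k / 2)) = 1 := by
  rw [← qpow_add, add_neg_cancel, qpow_zero]

lemma opTLin_sq : opTLin a k * opTLin a k =
    (qpow a (k / 2) - qpow a (-(k / 2))) • opTLin a k + 1 := by
  refine LinearMap.ext fun f => ?_
  have h := X_sq_sub_one_mul_divDiff f
  have hd : ∀ g : 𝓛, divDiffLin g = divDiff g := fun _ => rfl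
  have e := congrArg (C (R := ℂ)) (qpow_half_mul_neg a k)
  rw [map_mul, map_one] at e
  simp only [Module.End.mul_apply, LinearMap.add_apply, LinearMap.smul_apply, opTLin, map_add,
    map_smul, AlgEquiv.toLinearMap_apply, involutive_invert f, hd, divDiff_invert, divDiff_divDiff,
    invert_divDiff, Module.End.one_apply]
  simp only [smul_eq_C_mul, map_sub]
  linear_combination (C (qpow a (k / 2)) * (C (qpow a (k / 2)) - C (qpow a (-(k / 2))))) * h +
    f * e

lemma opTLin_mulT : opTLin a k * LinearMap.mulLeft ℂ (T 1) = LinearMap.mulLeft ℂ (T (-1)) *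
    (opTLin a k - (qpow a (k / 2) - qpow a (-(k / 2))) • 1) := by
  refine LinearMap.ext fun f => ?_
  have hd : ∀ g : 𝓛, divDiffLin g = divDiff g := fun _ => rfl
  simp only [Module.End.mul_apply, LinearMap.add_apply, LinearMap.smul_apply, opTLin,
    LinearMap.sub_apply, AlgEquiv.toLinearMap_apply, hd, Module.End.one_apply,
    LinearMap.mulLeft_apply, divDiff_T_mul, map_mul, invert_T]
  simp only [smul_eq_C_mul, map_sub]
  ring

/-- The substitution `X ↦ q ^ (1/2) X⁻¹`. -/
def opPi : 𝓛 →ₗ[ℂ] 𝓛 := coeffLin fun n => qpow a (n / 2) • T (-n)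

lemma opPi_T (n : ℤ) : opPi a (T n) = qpow a (n / 2) • T (-n) := coeffLin_T _ n

lemma opPi_mul_self : opPi a * opPi a = 1 := by
  refine laurent_linearMap_ext fun n => ?_
  rw [Module.End.mul_apply, opPi_T, map_smul, opPi_T, smul_smul, ← qpow_add, neg_neg,
    Module.End.one_apply]
  push_cast
  rw [show (n : ℂ) / 2 + -n / 2 = 0 by ring, qpow_zero, one_smul]

/-- With `Y = π T`, the relation `Y⁻¹ X⁻¹ Y X T² = q ^ (-1/2)` regroups as `T⁻¹ (π X⁻¹ π) (T X T)
T`; this identity together with `T X T = X⁻¹` proves it. -/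
lemma opPi_conj : opPi a * (LinearMap.mulLeft ℂ (T (-1)) * opPi a) =
    qpow a (-(1 / 2)) • LinearMap.mulLeft ℂ (T 1) := by
  refine laurent_linearMap_ext fun n => ?_
  rw [Module.End.mul_apply, Module.End.mul_apply, opPi_T, map_smul, map_smul,
    LinearMap.mulLeft_apply, ← T_add, opPi_T, smul_smul, ← qpow_add, LinearMap.smul_apply,
    LinearMap.mulLeft_apply, ← T_add]
  congr 2
  · push_cast; ring
  · ring

/-- The operators of the generators in the polynomial representation. -/
def polyGen : Gen → Module.End ℂ 𝓛
  | .X => LinearMap.mulLeft ℂ (T 1)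
  | .Xi => LinearMap.mulLeft ℂ (T (-1))
  | .Y => opPi a * opTLin a k
  | .Yi => (opTLin a k - (qpow a (k / 2) - qpow a (-(k / 2))) • 1) * opPi a
  | .T => opTLin a k
  | .Ti => opTLin a k - (qpow a (k / 2) - qpow a (-(k / 2))) • 1

lemma opT_mul_inv : opTLin a k * (opTLin a k - (qpow a (k / 2) - qpow a (-(k / 2))) • 1) = 1 := by
  rw [mul_sub, opTLin_sq, mul_smul_comm, mul_one, add_sub_cancel_left]

lemma opT_inv_mul : (opTLin a k - (qpow a (k / 2) - qpow a (-(k / 2))) • 1) * opTLin a k = 1 := by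
  rw [sub_mul, opTLin_sq, smul_mul_assoc, one_mul, add_sub_cancel_left]

lemma mulT_mul_mulT_neg : LinearMap.mulLeft ℂ (T 1 : 𝓛) * LinearMap.mulLeft ℂ (T (-1)) = 1 := by
  refine LinearMap.ext fun f => ?_
  simp only [Module.End.mul_apply, LinearMap.mulLeft_apply, Module.End.one_apply, ← mul_assoc,
    ← T_add]
  simp

lemma mulT_neg_mul_mulT : LinearMap.mulLeft ℂ (T (-1) : 𝓛) * LinearMap.mulLeft ℂ (T 1) = 1 := by
  refine LinearMap.ext fun f => ?_
  simp only [Module.End.mul_apply, LinearMap.mulLeft_apply, Module.End.one_apply, ← mul_assoc,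
    ← T_add]
  simp

lemma opT_mulT_opT : opTLin a k * LinearMap.mulLeft ℂ (T 1) * opTLin a k =
    LinearMap.mulLeft ℂ (T (-1)) := by
  rw [opTLin_mulT, mul_assoc, opT_inv_mul, mul_one]

/-- The polynomial representation. -/
def polyRep : Alg a k →ₐ[ℂ] Module.End ℂ 𝓛 :=
  RingQuot.liftAlgHom ℂ ⟨FreeAlgebra.lift ℂ (polyGen a k), by
    intro x y h
    have h1 := opT_mul_inv a k
    have h2 := opT_inv_mul a k
    have h3 := opPi_mul_self a
    have h4 := opPi_conj a
    have h5 := opT_mulT_opT a k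
    have h6 := opTLin_sq a k
    cases h <;>
      simp only [map_mul, map_add, map_sub, map_pow, map_one, map_zero, FreeAlgebra.lift_ι_apply,
        AlgHom.commutes, polyGen]
    · exact mulT_mul_mulT_neg
    · exact mulT_neg_mul_mulT
    · rw [mul_assoc, ← mul_assoc (opTLin a k), h1, one_mul, h3]
    · rw [mul_assoc, ← mul_assoc (opPi a), h3, one_mul, h2]
    · exact h1
    · exact h2
    · exact h5
    · rw [← mul_assoc, h1, one_mul]
    · generalize opTLin a k - (qpow a (k / 2) - qpow a (-(k / 2))) • 1 = Ti at *
      rw [show Ti * opPi a * LinearMap.mulLeft ℂ (T (-1)) * (opPi a * opTLin a k) *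
        LinearMap.mulLeft ℂ (T 1) * opTLin a k ^ 2 =
        Ti * (opPi a * (LinearMap.mulLeft ℂ (T (-1)) * opPi a)) *
        (opTLin a k * LinearMap.mulLeft ℂ (T 1) * opTLin a k) * opTLin a k by
          simp only [sq, mul_assoc], h4, h5, mul_smul_comm, smul_mul_assoc, smul_mul_assoc,
          mul_assoc Ti, mulT_mul_mulT_neg, mul_one, h2, Algebra.algebraMap_eq_smul_one]
    · have e := qpow_half_mul_neg a k
      simp only [Algebra.algebraMap_eq_smul_one, sub_mul, mul_add, h6, mul_smul_comm,
        smul_mul_assoc, mul_one, one_mul]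
      rw [smul_sub, smul_smul, mul_comm (qpow a (-(k / 2))), e]
      module⟩

lemma polyRep_el (g : Gen) : polyRep a k (el a k g) = polyGen a k g := by
  simp [polyRep, el]

lemma polyRep_unitX_zpow (n : ℤ) :
    polyRep a k ((unitX a k ^ n : (Alg a k)ˣ) : Alg a k) = LinearMap.mulLeft ℂ (T n) := by
  have hX : polyRep a k (unitX a k : Alg a k) = LinearMap.mulLeft ℂ (T 1) := polyRep_el a k .X
  have hXi : polyRep a k (((unitX a k)⁻¹ : (Alg a k)ˣ) : Alg a k) = LinearMap.mulLeft ℂ (T (-1)) :=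
    polyRep_el a k .Xi
  induction n with
  | zero => refine LinearMap.ext fun f => ?_; simp
  | succ n ih =>
    rw [zpow_add_one, Units.val_mul, map_mul, ih, hX]
    refine LinearMap.ext fun f => ?_
    rw [Module.End.mul_apply, LinearMap.mulLeft_apply, LinearMap.mulLeft_apply,
      LinearMap.mulLeft_apply, ← mul_assoc, ← T_add]
  | pred n ih =>
    rw [zpow_sub_one, Units.val_mul, map_mul, ih, hXi]
    refine LinearMap.ext fun f => ?_
    rw [Module.End.mul_apply, LinearMap.mulLeft_apply, LinearMap.mulLeft_apply,
      LinearMap.mulLeft_apply, ← mul_assoc, ← T_add, sub_eq_add_neg]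

lemma polyRep_ofX (f : 𝓛) : polyRep a k (ofX a k f) = LinearMap.mulLeft ℂ f := by
  unfold ofX
  induction f using LaurentPolynomial.induction_on' with
  | add p q hp hq =>
    rw [smeval_add, map_add, hp, hq]
    refine LinearMap.ext fun f => ?_
    simp [add_mul]
  | C_mul_T n c =>
    rw [smeval_C_mul_T_n, map_smul, polyRep_unitX_zpow]
    refine LinearMap.ext fun f => ?_
    simp [smul_eq_C_mul]

/-- On the commutative subalgebra generated by `X` the anti-involution is multiplicative, hence
conjugation by `T`. -/
lemma kappa_ofX (f : 𝓛) : kappa a k (ofX a k f) = el a k .Ti * ofX a k f * el a k .T := by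
  have hpow : ∀ n : ℤ, kappa a k ((unitX a k ^ n : (Alg a k)ˣ) : Alg a k) =
      el a k .Ti * ((unitX a k ^ n : (Alg a k)ˣ) : Alg a k) * el a k .T := by
    have hX : kappa a k (unitX a k : Alg a k) = el a k .Ti * (unitX a k : Alg a k) * el a k .T :=
      kappa_el a k .X
    have hXi : kappa a k (((unitX a k)⁻¹ : (Alg a k)ˣ) : Alg a k) =
        el a k .Ti * (((unitX a k)⁻¹ : (Alg a k)ˣ) : Alg a k) * el a k .T := kappa_el a k .Xi
    have hassoc : ∀ u v : Alg a k, el a k .Ti * u * el a k .T * (el a k .Ti * v * el a k .T) =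
        el a k .Ti * (u * v) * el a k .T := fun u v => by
      rw [show el a k .Ti * u * el a k .T * (el a k .Ti * v * el a k .T) =
        el a k .Ti * u * (el a k .T * el a k .Ti) * v * el a k .T by simp only [mul_assoc],
        T_Ti, mul_one]
      simp only [mul_assoc]
    intro n
    induction n with
    | zero => simp [kappa_one, Ti_T]
    | succ n ih =>
      rw [zpow_add_one, Units.val_mul, kappa_mul, ih, hX, hassoc, ← Units.val_mul, ← Units.val_mul,
        (Commute.refl (unitX a k)).zpow_right n |>.eq]
    | pred n ih =>
      rw [zpow_sub_one, Units.val_mul, kappa_mul, ih, hXi, hassoc, ← Units.val_mul, ← Units.val_mul,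
        ((Commute.refl (unitX a k)).inv_left.zpow_right (-n)).eq]
  unfold ofX
  induction f using LaurentPolynomial.induction_on' with
  | add p q hp hq => rw [smeval_add, map_add, hp, hq, mul_add, add_mul]
  | C_mul_T n c =>
    rw [smeval_C_mul_T_n, map_smul, hpow, mul_smul_comm, smul_mul_assoc]

end

end

end DAHA

namespace DAHA

noncomputable section

open Filter Finset

/-! ### The coinvariant -/

section

open LaurentPolynomial

variable (a : ℝ) (k : ℂ)

local notation "𝓛" => LaurentPolynomial ℂ

/-- The functional `X ^ p ↦ ∑ c_n q ^ ((2 n + p)² / 4)`. -/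
def momentLin : 𝓛 →ₗ[ℂ] ℂ := coeffLin (moment a (qpow a k) (qpow a k * qpow a 1))

variable {a}

/-- Linear extension of `moment_antisymm` from monomials. -/
lemma momentLin_antisymm (ha : 0 < a) (g : 𝓛) :
    momentLin a k ((1 - qpow a k • T 2) * g) =
      -momentLin a k ((1 - qpow a k • T 2) * (T (-2) * invert g)) := by
  have h : momentLin a k ∘ₗ LinearMap.mulLeft ℂ (1 - qpow a k • T 2) =
      -(momentLin a k ∘ₗ LinearMap.mulLeft ℂ ((1 - qpow a k • T 2) * T (-2)) ∘ₗ
        (invert (R := ℂ)).toLinearMap) := by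
    refine laurent_linearMap_ext fun p => ?_
    have h1 : (1 - qpow a k • T 2) * T p = (T p - qpow a k • T (p + 2) : 𝓛) := by
      rw [sub_mul, one_mul, smul_mul_assoc, ← T_add, add_comm]
    have h2 : (1 - qpow a k • T 2) * T (-2) * T (-p) = (T (-2 - p) - qpow a k • T (-p) : 𝓛) := by
      rw [mul_assoc, ← T_add, sub_mul, one_mul, smul_mul_assoc, ← T_add]
      congr 3; ring
    simp only [LinearMap.comp_apply, LinearMap.neg_apply, LinearMap.mulLeft_apply,
      AlgEquiv.toLinearMap_apply, invert_T]
    rw [h1, h2]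
    simp only [map_sub, map_smul, momentLin, coeffLin_T, smul_eq_mul]
    exact moment_antisymm ha (qpow a k) p
  have := LinearMap.congr_fun h g
  simpa [mul_assoc] using this

/-- One has `T - t ^ (1/2) = -t ^ (-1/2) (1 - t X²) divDiff`. The image of `divDiff` is fixed by `g
↦ X ^ (-2) g(X⁻¹)`, so the antisymmetry makes the functional vanish on that difference. -/
lemma momentLin_opT (ha : 0 < a) (f : 𝓛) :
    momentLin a k (opTLin a k f) = qpow a (k / 2) * momentLin a k f := by
  have h := momentLin_antisymm k ha (divDiff f)
  have e0 : (T (-2) * T 2 : 𝓛) = 1 := by rw [← T_add]; simp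
  rw [invert_divDiff, ← mul_assoc (T (-2)), e0, one_mul] at h
  have h0 : momentLin a k ((1 - qpow a k • T 2) * divDiff f) = 0 := by
    linear_combination (1 / 2 : ℂ) * h
  have e1 : opTLin a k f = qpow a (k / 2) • f -
      qpow a (-(k / 2)) • ((1 - qpow a k • T 2) * divDiff f) := by
    have h1 := X_sq_sub_one_mul_divDiff f
    have e2 : C (qpow a (-(k / 2))) * C (qpow a k) = (C (qpow a (k / 2)) : 𝓛) := by
      rw [← map_mul, ← qpow_add]; congr 2; ring
    have hd : divDiffLin f = divDiff f := rfl
    simp only [LinearMap.add_apply, LinearMap.smul_apply, opTLin, AlgEquiv.toLinearMap_apply, hd]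
    simp only [smul_eq_C_mul, map_sub]
    linear_combination (-C (qpow a (k / 2))) * h1 - T 2 * divDiff f * e2
  rw [e1, map_sub, map_smul, map_smul, h0, smul_zero, sub_zero, smul_eq_mul]

lemma momentLin_opPi (ha : 0 < a) (f : 𝓛) :
    momentLin a k (qpow a (-(1 / 4)) • (T 1 * opPi a f)) = momentLin a k f := by
  have h : momentLin a k ∘ₗ (qpow a (-(1 / 4)) • (LinearMap.mulLeft ℂ (T 1) ∘ₗ opPi a)) =
      momentLin a k := by
    refine laurent_linearMap_ext fun p => ?_
    simp only [LinearMap.comp_apply, LinearMap.smul_apply, LinearMap.mulLeft_apply, opPi_T,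
      ← T_add, map_smul, momentLin, coeffLin_T, smul_eq_mul]
    rw [← mul_assoc, ← qpow_add, ← moment_one_sub ha (qpow a k) p]
    congr 2
    ring
  exact LinearMap.congr_fun h f

lemma momentLin_one : momentLin a k 1 = moment a (qpow a k) (qpow a k * qpow a 1) 0 := by
  rw [← T_zero, momentLin, coeffLin_T]

/-- Since `ϰ Y = q ^ (-1/4) X π T`, the invariance under `q ^ (-1/4) X π` and the eigenvalue of `T`
combine. -/
lemma momentLin_unitKappaY (ha : 0 < a) (f : 𝓛) :
    momentLin a k (polyRep a k (unitKappaY a k : Alg a k) f) =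
      qpow a (k / 2) * momentLin a k f := by
  have e : (unitKappaY a k : Alg a k) = qpow a (-(1 / 4)) • (el a k .X * el a k .Y) :=
    kappa_el a k .Y
  rw [e, map_smul, map_mul, polyRep_el, polyRep_el, ← momentLin_opT k ha,
    ← momentLin_opPi k ha (opTLin a k f)]
  rfl

lemma qpow_int_add_one_mul (n : ℤ) (z : ℂ) : qpow a ((n + 1 : ℤ) * z) = qpow a (n * z) * qpow a z := by
  rw [← qpow_add]; congr 1; push_cast; ring

lemma momentLin_unitKappaY_zpow (ha : 0 < a) (m : ℤ) : ∀ f : 𝓛,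
    momentLin a k (polyRep a k ((unitKappaY a k ^ m : (Alg a k)ˣ) : Alg a k) f) =
      qpow a (m * (k / 2)) * momentLin a k f := by
  induction m with
  | zero => intro f; simp [qpow_zero]
  | succ n ih =>
    intro f
    rw [zpow_add_one, Units.val_mul, map_mul, Module.End.mul_apply, ih, momentLin_unitKappaY k ha,
      qpow_int_add_one_mul, mul_assoc]
  | pred n ih =>
    intro f
    have h := ih f
    rw [← sub_add_cancel (-(n : ℤ)) 1, zpow_add_one, (Commute.refl _).zpow_left _ |>.eq,
      Units.val_mul, map_mul, Module.End.mul_apply, momentLin_unitKappaY k ha,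
      qpow_int_add_one_mul] at h
    exact mul_left_cancel₀ (qpow_ne_zero a (k / 2)) (by rw [h]; ring)

lemma opTLin_one : opTLin a k 1 = qpow a (k / 2) • 1 := by
  have : divDiffLin (1 : 𝓛) = 0 := divDiff_unique (by simp)
  simp [opTLin, this]

lemma opPi_one : opPi a 1 = 1 := by
  rw [← T_zero, opPi_T]
  simp [qpow_zero]

lemma polyRep_Y_one : polyRep a k (unitY a k : Alg a k) 1 = qpow a (k / 2) • 1 := by
  have e : polyRep a k (unitY a k : Alg a k) = opPi a * opTLin a k := polyRep_el a k .Y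
  rw [e, Module.End.mul_apply, opTLin_one, map_smul, opPi_one]

lemma polyRep_unitY_zpow_one (n : ℤ) :
    polyRep a k ((unitY a k ^ n : (Alg a k)ˣ) : Alg a k) 1 = qpow a (n * (k / 2)) • 1 := by
  induction n with
  | zero => simp [qpow_zero]
  | succ n ih =>
    rw [zpow_add_one, Units.val_mul, map_mul, Module.End.mul_apply, polyRep_Y_one, map_smul, ih,
      smul_smul, qpow_int_add_one_mul, mul_comm]
  | pred n ih =>
    rw [← sub_add_cancel (-(n : ℤ)) 1, zpow_add_one, Units.val_mul, map_mul, Module.End.mul_apply,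
      polyRep_Y_one, map_smul, qpow_int_add_one_mul, mul_comm, mul_smul] at ih
    exact smul_right_injective _ (qpow_ne_zero a (k / 2)) ih

/-- The coinvariant, constructed from the polynomial representation. -/
def coinv (a : ℝ) (k : ℂ) : Alg a k →ₗ[ℂ] ℂ where
  toFun H := (momentLin a k 1)⁻¹ * momentLin a k (polyRep a k H 1)
  map_add' x y := by rw [map_add, LinearMap.add_apply, map_add, mul_add]
  map_smul' c x := by
    rw [map_smul, LinearMap.smul_apply, map_smul, smul_eq_mul, RingHom.id_apply, smul_eq_mul]
    ring

lemma coinv_apply (H : Alg a k) :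
    coinv a k H = (momentLin a k 1)⁻¹ * momentLin a k (polyRep a k H 1) := rfl

/-- Powers of `ϰ Y` on the left are absorbed by the functional; `T` and powers of `Y` on the right
act on `1`, a common eigenvector. -/
lemma isCoinvariant_coinv (ha : 0 < a) (h1 : momentLin a k 1 ≠ 0) :
    IsCoinvariant a k (coinv a k) := by
  intro m n ε
  have hT : polyRep a k (el a k .T ^ (ε : ℕ)) 1 = qpow a ((ε : ℕ) * (k / 2)) • (1 : 𝓛) := by
    rw [map_pow, polyRep_el]
    fin_cases ε
    · simp [qpow_zero]
    · simpa [polyGen] using opTLin_one k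
  rw [coinv_apply, map_mul, map_mul, mul_assoc, Module.End.mul_apply, momentLin_unitKappaY_zpow k ha,
    Module.End.mul_apply, polyRep_unitY_zpow_one, map_smul, hT, map_smul, map_smul, smul_eq_mul,
    smul_eq_mul, show k * (((m : ℂ) + ((ε : ℕ) : ℂ) + (n : ℂ)) / 2) =
      m * (k / 2) + ((ε : ℕ) * (k / 2) + n * (k / 2)) by ring, qpow_add, qpow_add]
  field_simp

/-- The Shapovalov form in terms of the moments. -/
lemma form_coinv (ha : 0 < a) (f g : 𝓛) :
    qpow a (k / 2) * form (coinv a k) (ofX a k f) (ofX a k g) =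
      (momentLin a k 1)⁻¹ * momentLin a k (bigF a k f g) := by
  -- The factor `t ^ (1/2)` is traded for a `T` on the left, which cancels the `T⁻¹` in `ϰ f = T⁻¹ f
  -- T` and leaves `f T(g)` applied to `1`.
  have h := momentLin_opT k ha (polyRep a k (kappa a k (ofX a k f) * ofX a k g) 1)
  rw [form, coinv_apply, mul_left_comm, ← h, kappa_ofX]
  have e : polyRep a k (el a k .Ti * ofX a k f * el a k .T * ofX a k g) =
      polyGen a k .Ti * (LinearMap.mulLeft ℂ f * (opTLin a k * LinearMap.mulLeft ℂ g)) := by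
    simp only [map_mul, polyRep_el, polyRep_ofX, mul_assoc]
    rfl
  rw [e, ← Module.End.mul_apply, ← mul_assoc, show opTLin a k * polyGen a k .Ti = 1 from
    opT_mul_inv a k, one_mul]
  simp [Module.End.mul_apply, bigF, opTLin_apply]

end

end

end DAHA

namespace DAHA

noncomputable section

open Filter Finset

/-! ### Uniqueness of the coinvariant -/

section

variable (a : ℝ) (k : ℂ)

/-- The elements `(ϰ Y) ^ m T ^ ε Y ^ n`. -/
def coinvElem (m : ℤ) (ε : Fin 2) (n : ℤ) : Alg a k :=
  ((unitKappaY a k ^ m : (Alg a k)ˣ) : Alg a k) * el a k .T ^ (ε : ℕ) *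
    ((unitY a k ^ n : (Alg a k)ˣ) : Alg a k)

/-- The span of the elements `(ϰ Y) ^ m T ^ ε Y ^ n`. -/
def coinvSpan : Submodule ℂ (Alg a k) :=
  Submodule.span ℂ {x | ∃ m ε n, x = coinvElem a k m ε n}

lemma coinvElem_mem (m : ℤ) (ε : Fin 2) (n : ℤ) : coinvElem a k m ε n ∈ coinvSpan a k :=
  Submodule.subset_span ⟨m, ε, n, rfl⟩

/-- Left multiplication by `x` preserves the span. -/
def Stable (x : Alg a k) : Prop := ∀ y ∈ coinvSpan a k, x * y ∈ coinvSpan a k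

variable {a k}

lemma Stable.mul {x y : Alg a k} (hx : Stable a k x) (hy : Stable a k y) : Stable a k (x * y) :=
  fun z hz => by rw [mul_assoc]; exact hx _ (hy z hz)

lemma Stable.add {x y : Alg a k} (hx : Stable a k x) (hy : Stable a k y) : Stable a k (x + y) :=
  fun z hz => by rw [add_mul]; exact add_mem (hx z hz) (hy z hz)

lemma Stable.sub {x y : Alg a k} (hx : Stable a k x) (hy : Stable a k y) : Stable a k (x - y) :=
  fun z hz => by rw [sub_mul]; exact sub_mem (hx z hz) (hy z hz)

lemma Stable.smul {x : Alg a k} (c : ℂ) (hx : Stable a k x) : Stable a k (c • x) :=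
  fun z hz => by rw [smul_mul_assoc]; exact Submodule.smul_mem _ c (hx z hz)

lemma Stable.one : Stable a k 1 := fun z hz => by rwa [one_mul]

lemma Stable.of_elem {x : Alg a k}
    (h : ∀ m ε n, x * coinvElem a k m ε n ∈ coinvSpan a k) : Stable a k x := by
  intro y hy
  induction hy using Submodule.span_induction with
  | mem y hy => obtain ⟨m, ε, n, rfl⟩ := hy; exact h m ε n
  | zero => rw [mul_zero]; exact zero_mem _
  | add y z _ _ hy hz => rw [mul_add]; exact add_mem hy hz
  | smul c y _ hy => rw [mul_smul_comm]; exact Submodule.smul_mem _ c hy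

lemma stable_unitKappaY_zpow (l : ℤ) :
    Stable a k ((unitKappaY a k ^ l : (Alg a k)ˣ) : Alg a k) :=
  Stable.of_elem fun m ε n => by
    have : ((unitKappaY a k ^ l : (Alg a k)ˣ) : Alg a k) * coinvElem a k m ε n =
        coinvElem a k (l + m) ε n := by
      rw [coinvElem, coinvElem, zpow_add, Units.val_mul]
      simp only [mul_assoc]
    rw [this]
    exact coinvElem_mem a k _ _ _

variable (a k)

lemma Ti_eq : el a k .Ti = el a k .T - (qpow a (k / 2) - qpow a (-(k / 2))) • 1 := by
  have h := quad a k
  have e := qpow_half_mul_neg a k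
  simp only [Algebra.algebraMap_eq_smul_one, sub_mul, mul_add, mul_smul_comm, smul_mul_assoc,
    mul_one, one_mul] at h
  have h2 := congrArg (fun z => el a k .Ti * z) h
  simp only [mul_add, mul_sub, mul_smul_comm, mul_zero, ← mul_assoc, Ti_T, one_mul, smul_sub,
    mul_one, smul_smul] at h2
  rw [mul_comm (qpow a (-(k / 2))), e, one_smul] at h2
  rw [Algebra.smul_def, map_sub, sub_mul, ← Algebra.smul_def, ← Algebra.smul_def]
  have : el a k .T = el a k .Ti + qpow a (k / 2) • 1 - qpow a (-(k / 2)) • 1 := by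
    rw [← sub_eq_zero, ← h2]; abel
  rw [this]; abel

lemma Ti_Y : el a k .Ti * el a k .Y = el a k .Yi * el a k .T := by
  rw [← TYT, ← mul_assoc, ← mul_assoc, Ti_T, one_mul]

lemma Yi_eq : el a k .Yi = el a k .Ti * el a k .Y * el a k .Ti := by
  rw [Ti_Y, mul_assoc, T_Ti, mul_one]

/-- `ϰ Y`. -/
abbrev kY : Alg a k := kappa a k (el a k .Y)

/-- `ϰ Y⁻¹`. -/
abbrev kYi : Alg a k := kappa a k (el a k .Yi)

lemma kY_eq : kY a k = qpow a (-(1 / 4)) • (el a k .X * el a k .Y) := kappa_el a k .Y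

lemma T_kYi : el a k .T * kYi a k = kY a k * el a k .Ti := by
  have h : el a k .T * kYi a k * el a k .T = kY a k := by
    have := kappa_TYT a k
    rwa [← kappa_el, ← kappa_el, ← kappa_el, kappa_el a k .T] at this
  rw [← h, mul_assoc _ (el a k .T), T_Ti, mul_one]

lemma Ti_kY : el a k .Ti * kY a k = kYi a k * el a k .T := by
  have h := congrArg (fun z => el a k .Ti * z * el a k .T) (T_kYi a k)
  simp only [← mul_assoc, Ti_T, one_mul] at h
  rw [h, mul_assoc _ _ (el a k .T), Ti_T, mul_one]

lemma T_kY : el a k .T * kY a k =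
    kYi a k * el a k .T + (qpow a (k / 2) - qpow a (-(k / 2))) • kY a k := by
  rw [← Ti_kY, Ti_eq, sub_mul, smul_mul_assoc, one_mul]
  abel

/-- This and `Y_kYi` are the rewriting rules that carry `Y` to the right past a power of `ϰ Y`, at
the cost of further factors `T` and `ϰ Y`. -/
lemma Y_kY : el a k .Y * kY a k =
    qpow a (-(1 / 2)) • (kY a k * (el a k .Ti * el a k .Ti * el a k .Y)) := by
  have h := congrArg (fun z => z * (el a k .Ti * el a k .Ti * el a k .Y)) (YXTT a k)
  have e : el a k .Y * el a k .X * el a k .T ^ 2 * (el a k .Ti * el a k .Ti * el a k .Y) =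
      el a k .Y * el a k .X * (el a k .T * (el a k .T * el a k .Ti) * el a k .Ti) * el a k .Y := by
    simp only [sq, mul_assoc]
  rw [e, T_Ti, mul_one, T_Ti, mul_one, smul_mul_assoc] at h
  rw [kY_eq, mul_smul_comm, smul_mul_assoc, smul_comm, ← h, mul_assoc]

lemma Y_kYi : el a k .Y * kYi a k =
    qpow a (1 / 2) • (el a k .T * kY a k * (el a k .Ti * el a k .Y)) := by
  have h1 : el a k .Y * (el a k .Yi * el a k .Xi) = el a k .Xi := by
    rw [← mul_assoc, Y_Yi, one_mul]
  have h2 : el a k .T * (el a k .X * el a k .Y) * (el a k .Yi * el a k .T) = el a k .Xi := by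
    rw [← TXT, show el a k .T * (el a k .X * el a k .Y) * (el a k .Yi * el a k .T) =
      el a k .T * el a k .X * (el a k .Y * el a k .Yi) * el a k .T by simp only [mul_assoc], Y_Yi,
      mul_one]
  rw [kY_eq, Ti_Y, kYi, kappa_el, kappaGen, mul_smul_comm, mul_smul_comm, smul_mul_assoc, h1, h2,
    smul_smul, ← qpow_add]
  norm_num

lemma coinvElem_add_one (m : ℤ) (ε : Fin 2) (n : ℤ) :
    coinvElem a k (m + 1) ε n = kY a k * coinvElem a k m ε n := by
  rw [coinvElem, coinvElem, add_comm, zpow_add, Units.val_mul, zpow_one]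
  simp only [mul_assoc]
  rfl

lemma coinvElem_sub_one (m : ℤ) (ε : Fin 2) (n : ℤ) :
    coinvElem a k (m - 1) ε n = kYi a k * coinvElem a k m ε n := by
  rw [coinvElem, coinvElem, sub_eq_neg_add, zpow_add, Units.val_mul, zpow_neg_one]
  simp only [mul_assoc]
  rfl

lemma stable_kY : Stable a k (kY a k) := by
  have := stable_unitKappaY_zpow (a := a) (k := k) 1
  rwa [zpow_one] at this

lemma stable_kYi : Stable a k (kYi a k) := by
  have := stable_unitKappaY_zpow (a := a) (k := k) (-1)
  rwa [zpow_neg_one] at this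

lemma T_mul_T : el a k .T * el a k .T =
    (qpow a (k / 2) - qpow a (-(k / 2))) • el a k .T + 1 := by
  have h := congrArg (fun z => z * el a k .T) (Ti_eq a k)
  simp only [Ti_T, sub_mul, smul_mul_assoc, one_mul] at h
  rw [h]; abel

/-- Induction on `m` outwards from `0`: `T` crosses `ϰ Y` and its inverse by `T_kY` and `T_kYi`, and
at `m = 0` the quadratic relation reduces `T²`. -/
lemma stable_T : Stable a k (el a k .T) := by
  refine Stable.of_elem fun m => ?_
  induction m with
  | zero =>
    intro ε n
    fin_cases ε
    · have : el a k .T * coinvElem a k 0 0 n = coinvElem a k 0 1 n := by simp [coinvElem]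
      exact this ▸ coinvElem_mem a k 0 1 n
    · have : el a k .T * coinvElem a k 0 1 n =
          (qpow a (k / 2) - qpow a (-(k / 2))) • coinvElem a k 0 1 n + coinvElem a k 0 0 n := by
        simp [coinvElem, ← mul_assoc, T_mul_T, add_mul]
      exact this ▸ add_mem (Submodule.smul_mem _ _ (coinvElem_mem a k 0 1 n))
        (coinvElem_mem a k 0 0 n)
  | succ m ih =>
    intro ε n
    rw [coinvElem_add_one, ← mul_assoc, T_kY, add_mul, mul_assoc, smul_mul_assoc]
    exact add_mem (stable_kYi a k _ (ih ε n))
      (Submodule.smul_mem _ _ (stable_kY a k _ (coinvElem_mem a k _ ε n)))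
  | pred m ih =>
    intro ε n
    rw [coinvElem_sub_one, ← mul_assoc, T_kYi, Ti_eq, mul_assoc, sub_mul, smul_mul_assoc, one_mul]
    exact stable_kY a k _ (sub_mem (ih ε n) (Submodule.smul_mem _ _ (coinvElem_mem a k _ ε n)))

lemma stable_Ti : Stable a k (el a k .Ti) := by
  rw [Ti_eq]
  exact (stable_T a k).sub (Stable.one.smul _)

lemma stable_Y : Stable a k (el a k .Y) := by
  refine Stable.of_elem fun m => ?_
  induction m with
  | zero =>
    intro ε n
    have hY : ∀ n : ℤ, el a k .Y * ((unitY a k ^ n : (Alg a k)ˣ) : Alg a k) =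
        ((unitY a k ^ (n + 1) : (Alg a k)ˣ) : Alg a k) := fun n => by
      rw [add_comm, zpow_add, Units.val_mul, zpow_one]; rfl
    have hYi : ∀ n : ℤ, el a k .Yi * ((unitY a k ^ n : (Alg a k)ˣ) : Alg a k) =
        ((unitY a k ^ (n - 1) : (Alg a k)ˣ) : Alg a k) := fun n => by
      rw [sub_eq_neg_add, zpow_add, Units.val_mul, zpow_neg_one]; rfl
    fin_cases ε
    · have : el a k .Y * coinvElem a k 0 0 n = coinvElem a k 0 0 (n + 1) := by
        simp [coinvElem, hY]
      exact this ▸ coinvElem_mem a k 0 0 _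
    · have hYT : el a k .Y * el a k .T = el a k .T * el a k .Yi +
          (qpow a (k / 2) - qpow a (-(k / 2))) • el a k .Y := by
        rw [T_Yi, Ti_eq, mul_sub, mul_smul_comm, mul_one]; abel
      have : el a k .Y * coinvElem a k 0 1 n = coinvElem a k 0 1 (n - 1) +
          (qpow a (k / 2) - qpow a (-(k / 2))) • coinvElem a k 0 0 (n + 1) := by
        simp only [coinvElem, zpow_zero, Units.val_one, one_mul, Fin.val_one, Fin.val_zero,
          pow_one, pow_zero]
        rw [← mul_assoc, hYT, add_mul, mul_assoc, hYi, smul_mul_assoc, hY]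
      exact this ▸ add_mem (coinvElem_mem a k 0 1 _)
        (Submodule.smul_mem _ _ (coinvElem_mem a k 0 0 _))
  | succ m ih =>
    intro ε n
    rw [coinvElem_add_one, ← mul_assoc, Y_kY, smul_mul_assoc, mul_assoc, mul_assoc, mul_assoc]
    exact Submodule.smul_mem _ _ (stable_kY a k _ (stable_Ti a k _ (stable_Ti a k _ (ih ε n))))
  | pred m ih =>
    intro ε n
    rw [coinvElem_sub_one, ← mul_assoc, Y_kYi, smul_mul_assoc, mul_assoc, mul_assoc, mul_assoc]
    exact Submodule.smul_mem _ _ (stable_T a k _ (stable_kY a k _ (stable_Ti a k _ (ih ε n))))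

/-- `X` is, up to a scalar, `ϰ Y · Y⁻¹`, so stability under `Y`, `T` and `ϰ Y` is enough. -/
lemma stable_el (g : Gen) : Stable a k (el a k g) := by
  have hYi : Stable a k (el a k .Yi) := by
    rw [Yi_eq]
    exact ((stable_Ti a k).mul (stable_Y a k)).mul (stable_Ti a k)
  cases g with
  | X =>
    have : el a k .X = qpow a (1 / 4) • (kY a k * el a k .Yi) := by
      rw [kY_eq, smul_mul_assoc, mul_assoc, Y_Yi, mul_one, smul_smul, ← qpow_add]
      simp [qpow_zero]
    rw [this]
    exact ((stable_kY a k).mul hYi).smul _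
  | Xi =>
    have : el a k .Xi = qpow a (-(1 / 4)) • (el a k .Y * kYi a k) := by
      rw [kYi, kappa_el, kappaGen, mul_smul_comm, ← mul_assoc, Y_Yi, one_mul, smul_smul, ← qpow_add]
      simp [qpow_zero]
    rw [this]
    exact ((stable_Y a k).mul (stable_kYi a k)).smul _
  | Y => exact stable_Y a k
  | Yi => exact hYi
  | T => exact stable_T a k
  | Ti => exact stable_Ti a k

/-- The span is a left ideal containing `1`. -/
lemma coinvSpan_eq_top : coinvSpan a k = ⊤ := by
  have h : ∀ x : Alg a k, Stable a k x := by
    intro x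
    obtain ⟨y, rfl⟩ := RingQuot.mkAlgHom_surjective ℂ (Rel a k) x
    induction y using FreeAlgebra.induction with
    | grade0 r =>
      rw [AlgHom.commutes, Algebra.algebraMap_eq_smul_one]
      exact Stable.one.smul r
    | grade1 g => exact stable_el a k g
    | mul x y hx hy => rw [map_mul]; exact hx.mul hy
    | add x y hx hy => rw [map_add]; exact hx.add hy
  refine eq_top_iff.mpr fun x _ => ?_
  have h1 := h x _ (coinvElem_mem a k 0 0 0)
  simpa [coinvElem] using h1

/-- The coinvariant is unique. -/
lemma IsCoinvariant.unique {ϱ ϱ' : Alg a k →ₗ[ℂ] ℂ} (h : IsCoinvariant a k ϱ)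
    (h' : IsCoinvariant a k ϱ') : ϱ = ϱ' := by
  refine LinearMap.ext_on (coinvSpan_eq_top a k) ?_
  rintro _ ⟨m, ε, n, rfl⟩
  exact (h m n ε).trans (h' m n ε).symm

end

end

end DAHA

namespace DAHA

noncomputable section

open Filter Finset MeasureTheory

/-! ### The integral -/

section

variable {a : ℝ}

/-- The function `X ^ p q ^ (-x²)` at `x = i y`. -/
def gaussFun (a : ℝ) (p : ℤ) (y : ℝ) : ℂ :=
  Complex.exp (Complex.I * (-(p : ℂ) / a) * y) * Complex.exp (-(1 / a : ℂ) * (y : ℂ) ^ 2)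

lemma norm_gaussFun (a : ℝ) (p : ℤ) (y : ℝ) : ‖gaussFun a p y‖ = Real.exp (-(1 / a) * y ^ 2) := by
  have e1 : Complex.I * (-(p : ℂ) / a) * y = ((-(p : ℝ) / a * y : ℝ) : ℂ) * Complex.I := by
    push_cast; ring
  have e2 : -(1 / a : ℂ) * (y : ℂ) ^ 2 = ((-(1 / a) * y ^ 2 : ℝ) : ℂ) := by push_cast; ring
  rw [gaussFun, norm_mul, e1, Complex.norm_exp_ofReal_mul_I, one_mul, e2, Complex.norm_exp_ofReal]

lemma continuous_gaussFun (a : ℝ) (p : ℤ) : Continuous (gaussFun a p) := by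
  unfold gaussFun; fun_prop

lemma integrable_gaussFun (ha : 0 < a) (p : ℤ) : Integrable (gaussFun a p) := by
  refine (integrable_exp_neg_mul_sq (b := 1 / a) (by positivity)).mono'
    (continuous_gaussFun a p).aestronglyMeasurable (.of_forall fun y => ?_)
  rw [norm_gaussFun]

lemma integral_gaussFun (ha : 0 < a) (p : ℤ) :
    ∫ y, gaussFun a p y = (Real.sqrt (Real.pi * a) : ℂ) * qpow a ((p : ℂ) ^ 2 / 4) := by
  have ha' : (a : ℂ) ≠ 0 := by exact_mod_cast ha.ne'
  have hre : 0 < (1 / a : ℂ).re := by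
    rw [← Complex.ofReal_one, ← Complex.ofReal_div, Complex.ofReal_re]; positivity
  have h := fourierIntegral_gaussian hre (-(p : ℂ) / a)
  unfold gaussFun
  rw [h]
  congr 1
  · rw [Real.sqrt_eq_rpow, Complex.ofReal_cpow (by positivity)]
    push_cast
    rw [div_div_eq_mul_div, div_one]
  · rw [qpow]
    congr 1
    field_simp

/-- On the imaginary axis the powers of `u` have modulus `1`, so the series is a bounded continuous
factor times one Gaussian. -/
lemma integrable_tsum_mul_gaussFun (ha : 0 < a) {g : ℤ → ℂ} (hg : Summable g) (p : ℤ) :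
    Integrable fun y : ℝ => ∑' n, g n * gaussFun a (2 * n + p) y := by
  have hmul : ∀ (n : ℤ) (y : ℝ), gaussFun a (2 * n + p) y =
      Complex.exp (Complex.I * (-(2 * n) / a) * y) * gaussFun a p y := by
    intro n y
    rw [gaussFun, gaussFun, ← mul_assoc]
    congr 1
    rw [← Complex.exp_add]
    congr 1
    push_cast
    ring
  have hb : ∀ (n : ℤ) (y : ℝ), ‖g n * Complex.exp (Complex.I * (-(2 * n) / a) * y)‖ ≤ ‖g n‖ := by
    intro n y
    have e1 : Complex.I * (-(2 * n : ℂ) / a) * y = ((-(2 * n : ℝ) / a * y : ℝ) : ℂ) * Complex.I := by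
      push_cast; ring
    rw [norm_mul, e1, Complex.norm_exp_ofReal_mul_I, mul_one]
  have hc : Continuous fun y : ℝ => ∑' n : ℤ, g n * Complex.exp (Complex.I * (-(2 * n) / a) * y) :=
    continuous_tsum (fun n => by fun_prop) hg.norm hb
  have := (integrable_gaussFun ha p).bdd_mul (c := ∑' n, ‖g n‖) hc.aestronglyMeasurable
    (.of_forall fun y => tsum_of_norm_bounded hg.norm.hasSum fun n => hb n y)
  refine this.congr (.of_forall fun y => ?_)
  simp only [hmul, ← tsum_mul_right, mul_assoc]

lemma integral_tsum_mul_gaussFun (ha : 0 < a) {g : ℤ → ℂ} (hg : Summable g) (p : ℤ) :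
    ∫ y, ∑' n, g n * gaussFun a (2 * n + p) y =
      (Real.sqrt (Real.pi * a) : ℂ) * ∑' n, g n * gaussWt a p n := by
  have h := hasSum_integral_of_summable_integral_norm (μ := volume)
    (F := fun (n : ℤ) (y : ℝ) => g n * gaussFun a (2 * n + p) y)
    (fun n => (integrable_gaussFun ha _).const_mul _) (by
      simp only [norm_mul, norm_gaussFun, integral_const_mul]
      exact hg.norm.mul_right _)
  rw [← h.tsum_eq, ← tsum_mul_left]
  refine tsum_congr fun n => ?_
  rw [integral_const_mul, integral_gaussFun ha, gaussWt]
  push_cast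
  ring

/-! ### The integral of `F q ^ (-x²) μ` -/

variable {k : ℂ}

/-- The dictionary `α = t`, `β = tq`, `u = X ^ 2`. It holds at poles too, by the convention for
division by zero. -/
lemma mu_eq_weight (ha : 0 < a) (k x : ℂ) :
    mu a k x = weight (qpow a 1) (qpow a k) (qpow a k * qpow a 1) (qpow a (2 * x)) := by
  rw [weight, ← tprod_div_qPoch (norm_qpow_one_lt ha), mu]
  refine tprod_congr fun i => ?_
  simp only [← qpow_natCast, ← qpow_neg, ← qpow_add]
  congr 4 <;> ring

lemma norm_qpow_gt_one (ha : 0 < a) {z : ℂ} (hz : z.re < 0) : 1 < ‖qpow a z‖ := by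
  rw [norm_qpow, Real.one_lt_exp_iff]
  exact div_pos (by linarith) ha

lemma norm_qpow_lt_one (ha : 0 < a) {z : ℂ} (hz : 0 < z.re) : ‖qpow a z‖ < 1 := by
  rw [norm_qpow, Real.exp_lt_one_iff]
  exact div_neg_of_neg_of_pos (by linarith) ha

lemma lt_zero_of_le_jumps (hk : k.re < 0) (hwall : ∀ n : ℕ, k.re ≠ -(n : ℝ)) {j : ℕ}
    (hj : j ≤ jumps k) : k.re + j < 0 := by
  have h1 : (j : ℝ) ≤ -k.re := by
    have := (Nat.le_floor_iff (show 0 ≤ (-k).re by rw [Complex.neg_re]; linarith)).mp hj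
    simpa using this
  have h2 := hwall j
  rcases h1.lt_or_eq with h | h
  · linarith
  · exact absurd (by linarith) h2

lemma jumps_lt (k : ℂ) : 0 < k.re + (jumps k + 1) := by
  have := Nat.lt_floor_add_one (-k).re
  rw [Complex.neg_re] at this
  have e : ((jumps k : ℕ) : ℝ) = (⌊-k.re⌋₊ : ℝ) := by rw [jumps, Complex.neg_re]
  rw [e]; linarith

lemma qpow_mul_pow (a : ℝ) (z : ℂ) (j : ℕ) : qpow a z * qpow a 1 ^ j = qpow a (z + j) := by
  rw [qpow_add, qpow_natCast]

/-- With `m = jumps k`, `|t q ^ j| > 1` holds exactly for `j ≤ m`. This gives `m + 1` crossed poles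
in the first family and, as `β = tq` starts one step later, `m` in the second. -/
lemma hasExpansion_mu (ha : 0 < a) (hk : k.re < 0) (hwall : ∀ n : ℕ, k.re ≠ -(n : ℝ)) :
    HasExpansion (qpow a 1) (qpow a k) (qpow a k * qpow a 1) (jumps k + 1) (jumps k) := by
  have e : ∀ j : ℕ, qpow a k * qpow a 1 * qpow a 1 ^ j = qpow a (k + (j + 1 : ℕ)) := fun j => by
    rw [← qpow_mul_pow, pow_succ']; ring
  refine hasExpansion (norm_qpow_one_lt ha) (qpow_ne_zero a 1) (fun j hj => ?_) ?_ (fun j hj => ?_) ?_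
  · rw [qpow_mul_pow]
    refine norm_qpow_gt_one ha ?_
    simpa using lt_zero_of_le_jumps hk hwall (Nat.lt_succ_iff.mp hj)
  · rw [qpow_mul_pow]
    refine norm_qpow_lt_one ha ?_
    simpa using jumps_lt k
  · rw [e]
    refine norm_qpow_gt_one ha ?_
    have := lt_zero_of_le_jumps hk hwall (show j + 1 ≤ jumps k from hj)
    simpa using this
  · rw [e]
    refine norm_qpow_lt_one ha ?_
    simpa using jumps_lt k

open LaurentPolynomial in
lemma evalq_T (a : ℝ) (p : ℤ) (x : ℂ) : evalq a (T p) x = qpow a (p * x) := by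
  rw [evalq, eval₂_T, qpow_int_mul]
  simp

/-- Evaluation as a linear map. -/
def evalqLin (a : ℝ) (x : ℂ) : LaurentPolynomial ℂ →ₗ[ℂ] ℂ where
  toFun F := evalq a F x
  map_add' F F' := by rw [evalq, map_add]; rfl
  map_smul' c F := by
    rw [LaurentPolynomial.smul_eq_C_mul, evalq, map_mul, LaurentPolynomial.eval₂_C]; rfl

lemma evalqLin_apply (a : ℝ) (x : ℂ) (F : LaurentPolynomial ℂ) : evalqLin a x F = evalq a F x := rfl

/-- The normalising constant `(q)_∞ (t² q)_∞`. -/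
def muConst (a : ℝ) (k : ℂ) : ℂ :=
  qPoch (qpow a 1) (qpow a 1) * qPoch (qpow a 1) (qpow a k * (qpow a k * qpow a 1))

lemma muConst_ne_zero (ha : 0 < a) (hpole : ∀ n : ℕ, qpow a (2 * k + (n + 1)) ≠ 1) :
    muConst a k ≠ 0 := by
  refine mul_ne_zero (qPoch_self_ne_zero (norm_qpow_one_lt ha))
    (qPoch_ne_zero (norm_qpow_one_lt ha) fun i hi => hpole i (Eq.trans ?_ hi))
  rw [← qpow_natCast, ← qpow_add, ← qpow_add, ← qpow_add]
  congr 1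
  ring

/-- The corrected coefficients of `μ`. -/
abbrev muCorr (a : ℝ) (k : ℂ) : ℤ → ℂ :=
  corr (qpow a 1) (qpow a k) (qpow a k * qpow a 1) (jumps k + 1) (jumps k)

lemma integrand_T (ha : 0 < a) (hk : k.re < 0) (hwall : ∀ n : ℕ, k.re ≠ -(n : ℝ))
    (hpole : ∀ n : ℕ, qpow a (2 * k + (n + 1)) ≠ 1) (p : ℤ) (y : ℝ) :
    integrand a k 0 (LaurentPolynomial.T p) y =
      (muConst a k)⁻¹ * ∑' n, muCorr a k n * gaussFun a (2 * n + p) y := by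
  have hu : ‖qpow a (2 * (Complex.I * y))‖ = 1 := by
    rw [norm_qpow]; simp
  have h := (hasExpansion_mu ha hk hwall).2 _ hu
  rw [integrand, mu_eq_weight ha, Complex.ofReal_zero, zero_add, evalq_T]
  rw [← muConst] at h
  rw [eq_inv_mul_iff_mul_eq₀ (muConst_ne_zero ha hpole), mul_left_comm, ← h, ← tsum_mul_left]
  refine tsum_congr fun n => ?_
  have e : qpow a (p * (Complex.I * y)) * qpow a (-(Complex.I * y) ^ 2) *
      qpow a (2 * (Complex.I * y)) ^ n = gaussFun a (2 * n + p) y := by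
    rw [← qpow_int_mul, ← qpow_add, ← qpow_add, gaussFun, ← Complex.exp_add, qpow]
    congr 1
    have hI : (Complex.I * (y : ℂ)) ^ 2 = -(y : ℂ) ^ 2 := by rw [mul_pow, Complex.I_sq]; ring
    rw [hI]
    push_cast
    ring
  rw [← e]
  ring

lemma integrand_add (a : ℝ) (k : ℂ) (F F' : LaurentPolynomial ℂ) :
    integrand a k 0 (F + F') = fun y => integrand a k 0 F y + integrand a k 0 F' y := by
  funext y
  simp only [integrand, ← evalqLin_apply, map_add]
  ring

lemma integrand_smul (a : ℝ) (k c : ℂ) (F : LaurentPolynomial ℂ) :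
    integrand a k 0 (c • F) = fun y => c * integrand a k 0 F y := by
  funext y
  simp only [integrand, ← evalqLin_apply, map_smul, smul_eq_mul]
  ring

lemma integrable_integrand (ha : 0 < a) (hk : k.re < 0) (hwall : ∀ n : ℕ, k.re ≠ -(n : ℝ))
    (hpole : ∀ n : ℕ, qpow a (2 * k + (n + 1)) ≠ 1) (F : LaurentPolynomial ℂ) :
    Integrable (integrand a k 0 F) := by
  induction F using LaurentPolynomial.induction_on' with
  | add p q hp hq => rw [integrand_add]; exact hp.add hq
  | C_mul_T n c =>
    rw [← LaurentPolynomial.smul_eq_C_mul, integrand_smul]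
    refine Integrable.const_mul ?_ c
    rw [funext (integrand_T ha hk hwall hpole n)]
    exact (integrable_tsum_mul_gaussFun ha (hasExpansion_mu ha hk hwall).1 n).const_mul _

lemma Phi_eq (ha : 0 < a) (hk : k.re < 0) (hwall : ∀ n : ℕ, k.re ≠ -(n : ℝ))
    (hpole : ∀ n : ℕ, qpow a (2 * k + (n + 1)) ≠ 1) (F : LaurentPolynomial ℂ) :
    Phi a k 0 F = (Real.sqrt (Real.pi * a) : ℂ) * (muConst a k)⁻¹ *
      coeffLin (fun p => ∑' n, muCorr a k n * gaussWt a p n) F := by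
  have hi := integrable_integrand ha hk hwall hpole
  induction F using LaurentPolynomial.induction_on' with
  | add p q hp hq =>
    rw [Phi, integrand_add, integral_add (hi p) (hi q), map_add, mul_add, ← hp, ← hq]
    rfl
  | C_mul_T n c =>
    rw [← LaurentPolynomial.smul_eq_C_mul, Phi, integrand_smul, integral_const_mul,
      funext (integrand_T ha hk hwall hpole n), integral_const_mul,
      integral_tsum_mul_gaussFun ha (hasExpansion_mu ha hk hwall).1, map_smul, coeffLin_T,
      smul_eq_mul]
    ring

end

end

end DAHA

namespace DAHA

noncomputable section

open Filter Finset

section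

variable {a : ℝ} {k : ℂ}

/-! ### Theta functions -/

lemma summable_half (ha : 0 < a) (z : ℂ) :
    Summable fun m : ℤ => qpow a ((m : ℂ) ^ 2 / 4 + m * z) := by
  refine (summable_zpow_mul_gaussWt (a := 4 * a) (by positivity) (qpow_ne_zero a z) 0).congr
    fun m => ?_
  rw [← qpow_int_mul, gaussWt, qpow, qpow, qpow, ← Complex.exp_add]
  congr 1
  have ha' : (a : ℂ) ≠ 0 := by exact_mod_cast ha.ne'
  push_cast
  field_simp
  ring

lemma qpow_int_mul_pi (ha : 0 < a) (m : ℤ) : qpow a (m * (Real.pi * Complex.I * a)) = (-1) ^ m := by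
  have ha' : (a : ℂ) ≠ 0 := by exact_mod_cast ha.ne'
  rw [qpow_int_mul, qpow, show -(Real.pi * Complex.I * a) / (a : ℂ) = -(Real.pi * Complex.I) by
    field_simp, Complex.exp_neg, Complex.exp_pi_mul_I]
  norm_num

/-- The doubled summation turns into a single theta series. -/
lemma Ahalf_add (ha : 0 < a) (z : ℂ) (p : ℤ) :
    Ahalf a z * qpow a (p * z) + Ahalf a (z + Real.pi * Complex.I * a) *
      qpow a (p * (z + Real.pi * Complex.I * a)) =
    (Real.sqrt (Real.pi * a) : ℂ) * ∑' n : ℤ, qpow a (-(2 * z)) ^ n * gaussWt a p n := by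
  set f : ℤ → ℂ := fun m => (1 + (-1) ^ (m + p)) * (qpow a ((m : ℂ) ^ 2 / 4 + m * z) * qpow a (p * z))
    with hf
  have h1 : Ahalf a z * qpow a (p * z) + Ahalf a (z + Real.pi * Complex.I * a) *
      qpow a (p * (z + Real.pi * Complex.I * a)) =
      (Real.sqrt (Real.pi * a) : ℂ) / 2 * ∑' m, f m := by
    have s1 := (summable_half ha z).mul_right (qpow a (p * z))
    have s2 := (summable_half ha (z + Real.pi * Complex.I * a)).mul_right
      (qpow a (p * (z + Real.pi * Complex.I * a)))
    rw [Ahalf, Ahalf, mul_assoc, mul_assoc, ← tsum_mul_right, ← tsum_mul_right, ← mul_add,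
      ← s1.tsum_add s2]
    congr 1
    refine tsum_congr fun m => ?_
    rw [hf]
    simp only [mul_add, ← add_assoc, qpow_add, qpow_int_mul_pi ha,
      zpow_add₀ (show (-1 : ℂ) ≠ 0 by norm_num)]
    ring
  have hinj : Function.Injective fun n : ℤ => -(2 * n + p) := fun x y h => by
    simp only at h; omega
  -- Passing from `z` to `z + πia` contributes the sign `(-1) ^ (m + p)`, so only `m` of the same
  -- parity as `p` survive.
  have hsupp : Function.support f ⊆ Set.range fun n : ℤ => -(2 * n + p) := by
    intro m hm
    rcases Int.even_or_odd (m + p) with h | h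
    · obtain ⟨r, hr⟩ := h
      exact ⟨-r, by simp only; omega⟩
    · exact absurd (by simp [hf, h.neg_one_zpow]) hm
  rw [h1, ← hinj.tsum_eq hsupp, div_mul_eq_mul_div, mul_div_assoc, ← tsum_div_const]
  congr 1
  refine tsum_congr fun n => ?_
  rw [hf]
  simp only
  rw [show -(2 * n + p) + p = -(2 * n) by ring, (even_two_mul n).neg.neg_one_zpow, ← qpow_add,
    ← qpow_int_mul, gaussWt, ← qpow_add]
  rw [show ((1 : ℂ) + 1) = 2 by norm_num, mul_div_cancel_left₀ _ (two_ne_zero)]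
  congr 1
  push_cast
  ring

/-- For even `p` the substitution `m = -p/2 - n` is already integral and a single theta series
suffices. -/
lemma A_mul (a : ℝ) (z : ℂ) {p : ℤ} (hp : Even p) :
    A a z * qpow a (p * z) =
    (Real.sqrt (Real.pi * a) : ℂ) * ∑' n : ℤ, qpow a (-(2 * z)) ^ n * gaussWt a p n := by
  obtain ⟨r, rfl⟩ := hp
  rw [A, mul_assoc, ← tsum_mul_right, ← (Equiv.subLeft (-r)).tsum_eq]
  congr 1
  refine tsum_congr fun n => ?_
  rw [Equiv.subLeft_apply, ← qpow_int_mul, gaussWt, ← qpow_add, ← qpow_add]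
  congr 1
  push_cast
  ring

/-! ### Values of `μ•` -/

/-- The reflection `x ↦ 1/2 - x` exchanges the two factors in the numerator and the two in the
denominator, which transfers results from one family of poles to the other. -/
lemma muBullet_reflect (a : ℝ) (k x : ℂ) : muBullet a k (1 / 2 - x) = muBullet a k x := by
  refine tprod_congr fun i => ?_
  rw [show (i : ℂ) + 2 * (1 / 2 - x) = i + 1 - 2 * x by ring,
    show (i : ℂ) + k + 2 * (1 / 2 - x) = i + k + 1 - 2 * x by ring,
    show (i : ℂ) + 1 - 2 * (1 / 2 - x) = i + 2 * x by ring,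
    show (i : ℂ) + k + 1 - 2 * (1 / 2 - x) = i + k + 2 * x by ring, mul_comm (1 - _),
    mul_comm (omitZero _)]

lemma mu_reflect (a : ℝ) (k x : ℂ) : mu a k (1 / 2 - x) = mu a k x := by
  refine tprod_congr fun i => ?_
  rw [show (i : ℂ) + 2 * (1 / 2 - x) = i + 1 - 2 * x by ring,
    show (i : ℂ) + k + 2 * (1 / 2 - x) = i + k + 1 - 2 * x by ring,
    show (i : ℂ) + 1 - 2 * (1 / 2 - x) = i + 2 * x by ring,
    show (i : ℂ) + k + 1 - 2 * (1 / 2 - x) = i + k + 2 * x by ring, mul_comm (1 - _),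
    mul_comm (1 - qpow a (i + k + 2 * x))]

lemma prod_inv_pow_eq {q : ℂ} (hq0 : q ≠ 0) (j : ℕ) :
    ∏ i ∈ range j, (1 - (q ^ j)⁻¹ * q ^ i) = ∏ i ∈ range j, (1 - (q ^ (i + 1))⁻¹) := by
  rw [← prod_range_reflect]
  refine prod_congr rfl fun i hi => ?_
  have hi' := mem_range.mp hi
  rw [show j = (j - 1 - i) + (i + 1) by omega, pow_add,
    show j - 1 - i + (i + 1) - 1 - i = j - 1 - i by omega, mul_inv]
  field_simp

/-- Only the factor `i = j` vanishes. Those before it give the finite product and those after it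
give `(q)_∞`. -/
lemma hasProd_omitZero {q : ℂ} (hq : ‖q‖ < 1) (hq0 : q ≠ 0) (j : ℕ) :
    HasProd (fun i : ℕ => omitZero (1 - (q ^ j)⁻¹ * q ^ i))
      ((∏ i ∈ range j, (1 - (q ^ (i + 1))⁻¹)) * qPoch q q) := by
  have hj : omitZero (1 - (q ^ j)⁻¹ * q ^ j) = 1 := by
    rw [inv_mul_cancel₀ (pow_ne_zero _ hq0), sub_self, omitZero, if_pos rfl]
  have h1 : ∀ i < j, omitZero (1 - (q ^ j)⁻¹ * q ^ i) = 1 - (q ^ j)⁻¹ * q ^ i := by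
    intro i hi
    have hne : ∏ i ∈ range j, (1 - (q ^ j)⁻¹ * q ^ i) ≠ 0 := by
      rw [prod_inv_pow_eq hq0]
      exact prod_ne_zero_iff.mpr fun i _ => one_sub_inv_pow_ne_zero hq i
    rw [omitZero, if_neg (prod_ne_zero_iff.mp hne i (mem_range.mpr hi))]
  have h2 : ∀ i : ℕ, omitZero (1 - (q ^ j)⁻¹ * q ^ (i + (j + 1))) = 1 - q * q ^ i := by
    intro i
    have e : (q ^ j)⁻¹ * q ^ (i + (j + 1)) = q * q ^ i := by
      have := pow_ne_zero j hq0
      field_simp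
      ring
    rw [e, omitZero, if_neg]
    intro h
    exact qPoch_self_ne_zero hq (qPoch_eq_zero hq (i := i) (by linear_combination -h))
  have h3 : HasProd (fun i : ℕ => omitZero (1 - (q ^ j)⁻¹ * q ^ (i + (j + 1)))) (qPoch q q) := by
    simp only [h2]
    exact hasProd_qPoch hq q
  have h4 := h3.prod_range_mul (f := fun i : ℕ => omitZero (1 - (q ^ j)⁻¹ * q ^ i))
  rwa [prod_range_succ, hj, mul_one, prod_congr rfl fun i hi => h1 i (mem_range.mp hi),
    prod_inv_pow_eq hq0] at h4

lemma pole_pow (hpole : ∀ n : ℕ, qpow a (2 * k + (n + 1)) ≠ 1) (n : ℕ) :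
    qpow a k ^ 2 * qpow a 1 ^ (n + 1) ≠ 1 := by
  intro h
  refine hpole n (Eq.trans ?_ h)
  rw [← qpow_natCast, sq, ← qpow_add, ← qpow_add]
  congr 1
  push_cast
  ring

lemma hasProd_muBullet (ha : 0 < a) (hpole : ∀ n : ℕ, qpow a (2 * k + (n + 1)) ≠ 1) (j : ℕ) :
    muBullet a k (-((k + j) / 2)) =
      qPoch (qpow a 1) (qpow a k * qpow a 1 ^ j)⁻¹ *
        qPoch (qpow a 1) (qpow a k * qpow a 1 ^ (j + 1)) /
      ((∏ i ∈ range j, (1 - (qpow a 1 ^ (i + 1))⁻¹)) * qPoch (qpow a 1) (qpow a 1) *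
        qPoch (qpow a 1) (qpow a k ^ 2 * qpow a 1 ^ (j + 1))) := by
  have hq := norm_qpow_one_lt ha
  have hq0 := qpow_ne_zero a 1
  set q := qpow a 1 with hqdef
  set t := qpow a k with htdef
  have hd : ∀ i : ℕ, t ^ 2 * q ^ (j + 1) * q ^ i ≠ 1 := fun i hi => by
    refine pole_pow hpole (j + i) (Eq.trans ?_ hi)
    rw [← hqdef, ← htdef]; ring
  have hne : (∏ i ∈ range j, (1 - (q ^ (i + 1))⁻¹)) * qPoch q q *
      qPoch q (t ^ 2 * q ^ (j + 1)) ≠ 0 :=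
    mul_ne_zero (mul_ne_zero (prod_ne_zero_iff.mpr fun i _ => one_sub_inv_pow_ne_zero hq i)
      (qPoch_self_ne_zero hq)) (qPoch_ne_zero hq hd)
  have h2 : HasProd (fun i : ℕ => omitZero (1 - t ^ 2 * q ^ (j + 1) * q ^ i))
      (qPoch q (t ^ 2 * q ^ (j + 1))) := by
    have : ∀ i : ℕ, omitZero (1 - t ^ 2 * q ^ (j + 1) * q ^ i) = 1 - t ^ 2 * q ^ (j + 1) * q ^ i :=
      fun i => by rw [omitZero, if_neg fun h => hd i (by linear_combination -h)]
    simp only [this]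
    exact hasProd_qPoch hq _
  have h := hasProd_div ((hasProd_qPoch hq (t * q ^ j)⁻¹).mul (hasProd_qPoch hq (t * q ^ (j + 1))))
    ((hasProd_omitZero hq hq0 j).mul h2) hne
  rw [← h.tprod_eq, muBullet]
  refine tprod_congr fun i => ?_
  rw [hqdef, htdef, sq]
  simp only [← qpow_natCast, ← qpow_add, ← qpow_neg]
  push_cast
  congr 4
  · ring
  · ring
  · ring_nf
  · congr 2
    ring

/-- The residues were defined through the bilateral series; this identifies them with the values of
`μ•`, the constant being `(q)_∞ (t²q)_∞`. -/
lemma muBullet_eq_res (ha : 0 < a) (hpole : ∀ n : ℕ, qpow a (2 * k + (n + 1)) ≠ 1) (j : ℕ) :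
    muBullet a k (-((k + j) / 2)) =
      (muConst a k)⁻¹ * res (qpow a 1) (qpow a k) (qpow a k * qpow a 1) j := by
  have hq := norm_qpow_one_lt ha
  have hK := muConst_ne_zero ha hpole
  have e := qPoch_eq_prod_mul hq (qpow a k * (qpow a k * qpow a 1)) j
  rw [hasProd_muBullet ha hpole, res, muConst, e, prod_div_distrib]
  rw [muConst, e] at hK
  rw [show qpow a k * (qpow a k * qpow a 1) * qpow a 1 ^ j = qpow a k ^ 2 * qpow a 1 ^ (j + 1) by
    ring] at hK ⊢
  have h1 : ∏ i ∈ range j, (1 - (qpow a 1 ^ (i + 1))⁻¹) ≠ 0 :=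
    prod_ne_zero_iff.mpr fun i _ => one_sub_inv_pow_ne_zero hq i
  have h2 := left_ne_zero_of_mul hK
  have h3 := left_ne_zero_of_mul (right_ne_zero_of_mul hK)
  have h4 := right_ne_zero_of_mul (right_ne_zero_of_mul hK)
  rw [div_eq_iff (mul_ne_zero (mul_ne_zero h1 h2) h4), mul_inv, mul_inv, div_eq_mul_inv]
  generalize ∏ i ∈ range j, (1 - (qpow a 1 ^ (i + 1))⁻¹) = D at *
  generalize ∏ i ∈ range j, (1 - qpow a k * (qpow a k * qpow a 1) * qpow a 1 ^ i) = E at *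
  generalize qPoch (qpow a 1) (qpow a 1) = U at *
  generalize qPoch (qpow a 1) (qpow a k ^ 2 * qpow a 1 ^ (j + 1)) = V at *
  generalize qPoch (qpow a 1) (qpow a k * qpow a 1 ^ j)⁻¹ = x
  generalize qPoch (qpow a 1) (qpow a k * qpow a 1 ^ (j + 1)) = y
  field_simp

/-- Matches the residues of the two families under `x ↦ 1/2 - x`; the factor `-t q ^ (j + 1)` is
minus the value of `u` at the second pole. -/
lemma res_reflect {q : ℂ} (hq : ‖q‖ < 1) (hq0 : q ≠ 0) {t : ℂ} (ht : t ≠ 0) (j : ℕ) :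
    -(t * q * q ^ j) * res q (t * q) t j = res q t (t * q) j := by
  have hv : t * q ^ (j + 1) ≠ 0 := mul_ne_zero ht (pow_ne_zero _ hq0)
  have h1 := qPoch_eq_mul hq (t * q ^ (j + 1))⁻¹
  have h2 := qPoch_eq_mul hq (t * q ^ (j + 1))
  have e1 : (t * q ^ (j + 1))⁻¹ * q = (t * q ^ j)⁻¹ := by
    rw [pow_succ, ← mul_assoc, mul_inv]
    field_simp
  rw [e1] at h1
  rw [res, res, show t * q * q ^ j = t * q ^ (j + 1) by ring,
    show t * q * q ^ (j + 1) = t * q ^ (j + 1) * q by ring, h1, h2, mul_comm (t * q) t]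
  linear_combination (qPoch q (t * q ^ j)⁻¹ * qPoch q (t * q ^ (j + 1) * q) *
    ∏ i ∈ range j, (1 - t * (t * q) * q ^ i) / (1 - (q ^ (i + 1))⁻¹)) * mul_inv_cancel₀ hv

lemma muBullet_pos_eq (a : ℝ) (k : ℂ) (j : ℕ) :
    muBullet a k ((k + (j + 1 : ℕ)) / 2) = muBullet a k (-((k + j) / 2)) := by
  rw [← muBullet_reflect]
  congr 1
  push_cast
  ring

/-- The ratios of the values of `μ•`. -/
lemma res_ratio {q : ℂ} (hq : ‖q‖ < 1) (hq0 : q ≠ 0) {t : ℂ} (ht : t ≠ 0)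
    (j : ℕ) :
    res q t (t * q) j = res q t (t * q) 0 *
      ((t ^ j)⁻¹ * ∏ i ∈ Icc 1 j, (1 - t ^ 2 * q ^ i) / (1 - q ^ i)) := by
  induction j with
  | zero => simp
  | succ j ih =>
    have hr : q ^ (j + 1) ≠ 0 := pow_ne_zero _ hq0
    have hv : t * q ^ (j + 1) ≠ 0 := mul_ne_zero ht hr
    have h1 := qPoch_eq_mul hq (t * q ^ (j + 1))⁻¹
    have h2 := qPoch_eq_mul hq (t * q ^ (j + 1))
    have e1 : (t * q ^ (j + 1))⁻¹ * q = (t * q ^ j)⁻¹ := by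
      rw [pow_succ, ← mul_assoc, mul_inv]
      field_simp
    rw [e1] at h1
    -- Raising `j` by one moves one factor into `(t q ^ j)⁻¹`'s symbol and one out of the other, and
    -- adds one factor to the finite product.
    have hstep : res q t (t * q) (j + 1) = res q t (t * q) j *
        (t⁻¹ * ((1 - t ^ 2 * q ^ (j + 1)) / (1 - q ^ (j + 1)))) := by
      have h3 := one_sub_inv_pow_ne_zero hq j
      have h4 : 1 - q ^ (j + 1) ≠ 0 := by
        intro h0
        apply h3
        rw [show q ^ (j + 1) = 1 by linear_combination -h0]
        simp
      have e3 : (1 - (t * q ^ (j + 1))⁻¹) * ((1 - t ^ 2 * q ^ (j + 1)) / (1 - (q ^ (j + 1))⁻¹)) =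
          (1 - t * q ^ (j + 1)) * (t⁻¹ * ((1 - t ^ 2 * q ^ (j + 1)) / (1 - q ^ (j + 1)))) := by
        have e4 : 1 - (q ^ (j + 1))⁻¹ = -(1 - q ^ (j + 1)) / q ^ (j + 1) := by field_simp; ring
        rw [e4]
        generalize q ^ (j + 1) = r at *
        field_simp
        ring
      rw [res, res, h1, h2, prod_range_succ, show t * q ^ (j + 1) * q = t * q ^ (j + 1 + 1) by ring,
        show t * (t * q) * q ^ j = t ^ 2 * q ^ (j + 1) by ring]
      linear_combination (qPoch q (t * q ^ j)⁻¹ * qPoch q (t * q ^ (j + 1 + 1)) *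
        ∏ i ∈ range j, (1 - t * (t * q) * q ^ i) / (1 - (q ^ (i + 1))⁻¹)) * e3
    rw [hstep, ih, prod_Icc_succ_top (by omega), pow_succ t j, mul_inv]
    ring

end

end

end DAHA

namespace DAHA

noncomputable section

open Filter Finset

section

variable {a : ℝ} {k : ℂ}

/-! ### The residue sum -/

/-- The theta series attached to a residue. -/
def thetaSum (a : ℝ) (w : ℂ) (p : ℤ) : ℂ := ∑' n : ℤ, w ^ n * gaussWt a p n

lemma tsum_corr_mul_gaussWt (ha : 0 < a) {α β : ℂ} (hα : α ≠ 0) (hβ : β ≠ 0) (A B : ℕ) (p : ℤ) :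
    ∑' n, corr (qpow a 1) α β A B n * gaussWt a p n = moment a α β p -
      ∑ j ∈ range A, res (qpow a 1) α β j * thetaSum a (α * qpow a 1 ^ j) p +
      ∑ j ∈ range B, res (qpow a 1) β α j * (β * qpow a 1 ^ j) *
        thetaSum a (β * qpow a 1 ^ j)⁻¹ p := by
  have hne : ∀ {α : ℂ} (j : ℕ), α ≠ 0 → α * qpow a 1 ^ j ≠ 0 := fun j h =>
    mul_ne_zero h (pow_ne_zero _ (qpow_ne_zero a 1))
  have h1 := (summable_coef_mul_gaussWt ha α β p).hasSum
  have h2 := hasSum_sum fun (j : ℕ) (_ : j ∈ range A) =>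
    (summable_zpow_mul_gaussWt ha (hne j hα) p).hasSum.mul_left (res (qpow a 1) α β j)
  have h3 := hasSum_sum fun (j : ℕ) (_ : j ∈ range B) =>
    (summable_zpow_mul_gaussWt ha (inv_ne_zero (hne j hβ)) p).hasSum.mul_left
      (res (qpow a 1) β α j * (β * qpow a 1 ^ j))
  refine ((h1.sub h2).add h3).congr_fun ?_ |>.tsum_eq
  intro n
  rw [corr, add_mul, sub_mul, sum_mul, sum_mul]
  congr 1
  · congr 1
    exact sum_congr rfl fun j _ => by ring
  · refine sum_congr rfl fun j _ => ?_
    rw [zpow_sub₀ (hne j hβ), zpow_one, inv_zpow]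
    ring

lemma two_mul_add_ne_zero (hpole : ∀ n : ℕ, qpow a (2 * k + (n + 1)) ≠ 1) (n : ℕ) :
    2 * k + (n + 1) ≠ 0 := fun h => hpole n (by rw [h, qpow_zero])

/-- A collision between the branches `n ≤ 0` and `n > 0` would force `2k + r = 0` for an integer `r
≥ 1`, a pole of `G`. Thus the sum over the set `K̃` loses no term. -/
lemma sharp_injective (hpole : ∀ n : ℕ, qpow a (2 * k + (n + 1)) ≠ 1) :
    Function.Injective (sharp k) := by
  have key : ∀ n n' : ℤ, n ≤ 0 → 0 < n' → ((n : ℂ) - k) / 2 ≠ ((n' : ℂ) + k) / 2 := by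
    intro n n' hn hn' h
    obtain ⟨r, hr⟩ : ∃ r : ℕ, n' - n = r + 1 := ⟨(n' - n - 1).toNat, by omega⟩
    have hr' : (n' : ℂ) - n = r + 1 := by exact_mod_cast hr
    exact two_mul_add_ne_zero hpole r (by linear_combination -2 * h - hr')
  intro n n' h
  unfold sharp at h
  split_ifs at h with h1 h2 h2
  · exact_mod_cast show (n : ℂ) = n' by linear_combination 2 * h
  · exact absurd h (key n n' h1 (by omega))
  · exact absurd h.symm (key n' n h2 (by omega))
  · exact_mod_cast show (n : ℂ) = n' by linear_combination 2 * h

lemma sharp_neg_natCast (k : ℂ) (j : ℕ) : sharp k (-(j : ℤ)) = -((k + j) / 2) := by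
  rw [sharp, if_pos (by omega)]
  push_cast
  ring

lemma sharp_natCast_succ (k : ℂ) (j : ℕ) : sharp k ((j + 1 : ℕ) : ℤ) = (k + (j + 1 : ℕ)) / 2 := by
  rw [sharp, if_neg (by omega)]
  push_cast
  ring

lemma sum_Icc_neg (f : ℤ → ℂ) (m : ℕ) :
    ∑ n ∈ Icc (-(m : ℤ)) m, f n =
      ∑ j ∈ range (m + 1), f (-(j : ℤ)) + ∑ j ∈ range m, f ((j + 1 : ℕ) : ℤ) := by
  have e : Icc (-(m : ℤ)) m = (range (m + 1)).image (fun j : ℕ => -(j : ℤ)) ∪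
      (range m).image (fun j : ℕ => ((j + 1 : ℕ) : ℤ)) := by
    ext n
    simp only [mem_Icc, mem_union, mem_image, mem_range]
    constructor
    · intro h
      rcases le_or_gt n 0 with h0 | h0
      · exact .inl ⟨(-n).toNat, by omega, by omega⟩
      · exact .inr ⟨(n - 1).toNat, by omega, by omega⟩
    · rintro (⟨j, hj, rfl⟩ | ⟨j, hj, rfl⟩) <;> omega
  rw [e, sum_union, sum_image, sum_image]
  · intro x _ y _ h; simp only at h; omega
  · intro x _ y _ h; simp only at h; omega
  · rw [disjoint_left]
    simp only [mem_image, mem_range]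
    rintro n ⟨j, _, rfl⟩ ⟨i, _, h⟩
    omega

lemma sum_Ktilde (hpole : ∀ n : ℕ, qpow a (2 * k + (n + 1)) ≠ 1) (f : ℂ → ℂ) :
    ∑ z ∈ Ktilde k, f z = ∑ j ∈ range (jumps k + 1), f (-((k + j) / 2)) +
      ∑ j ∈ range (jumps k), f ((k + (j + 1 : ℕ)) / 2) := by
  rw [Ktilde, sum_image (sharp_injective hpole).injOn, sum_Icc_neg]
  simp only [sharp_neg_natCast, sharp_natCast_succ]

lemma coe_Ktilde (k : ℂ) : (Ktilde k : Set ℂ) = {-k / 2} ∪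
    {z : ℂ | ∃ j : ℕ, 1 ≤ j ∧ j ≤ jumps k ∧ (z = (k + j) / 2 ∨ z = -((k + j) / 2))} := by
  ext z
  simp only [Ktilde, coe_image, coe_Icc, Set.mem_image, Set.mem_Icc, Set.mem_union,
    Set.mem_singleton_iff, Set.mem_ofPred_eq]
  constructor
  · rintro ⟨n, ⟨h1, h2⟩, rfl⟩
    rcases le_or_gt n 0 with h0 | h0
    · obtain ⟨j, rfl⟩ : ∃ j : ℕ, n = -(j : ℤ) := ⟨(-n).toNat, by omega⟩
      rw [sharp_neg_natCast]
      rcases j.eq_zero_or_pos with rfl | hj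
      · left; push_cast; ring
      · exact .inr ⟨j, hj, by omega, .inr rfl⟩
    · obtain ⟨j, rfl⟩ : ∃ j : ℕ, n = ((j + 1 : ℕ) : ℤ) := ⟨(n - 1).toNat, by omega⟩
      exact .inr ⟨j + 1, by omega, by omega, .inl (sharp_natCast_succ k j)⟩
  · rintro (rfl | ⟨j, h1, h2, rfl | rfl⟩)
    · exact ⟨-((0 : ℕ) : ℤ), by omega, by rw [sharp_neg_natCast]; push_cast; ring⟩
    · obtain ⟨i, rfl⟩ := Nat.exists_eq_add_of_le' h1
      exact ⟨((i + 1 : ℕ) : ℤ), by omega, sharp_natCast_succ k i⟩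
    · exact ⟨-(j : ℤ), by omega, sharp_neg_natCast k j⟩

/-- The two correction sums merge into one sum over `K̃`: poles `u = (t q ^ j)⁻¹` and `u = t q ^ (j
+ 1)` correspond to `x = -(k + j)/2` and `x = (k + j + 1)/2`, and `res_reflect` aligns the signs. -/
lemma tsum_muCorr (ha : 0 < a) (hpole : ∀ n : ℕ, qpow a (2 * k + (n + 1)) ≠ 1) (p : ℤ) :
    (muConst a k)⁻¹ * ∑' n, muCorr a k n * gaussWt a p n =
      (muConst a k)⁻¹ * moment a (qpow a k) (qpow a k * qpow a 1) p -
      ∑ z ∈ Ktilde k, muBullet a k z * thetaSum a (qpow a (-(2 * z))) p := by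
  have hq := norm_qpow_one_lt ha
  have hq0 := qpow_ne_zero a 1
  have ht := qpow_ne_zero a k
  rw [tsum_corr_mul_gaussWt ha ht (mul_ne_zero ht hq0), sum_Ktilde hpole]
  have e1 : ∀ j : ℕ, qpow a (-(2 * -((k + j) / 2))) = qpow a k * qpow a 1 ^ j := fun j => by
    rw [qpow_mul_pow]; congr 1; ring
  have e2 : ∀ j : ℕ, qpow a (-(2 * ((k + (j + 1 : ℕ)) / 2))) =
      (qpow a k * qpow a 1 * qpow a 1 ^ j)⁻¹ := fun j => by
    rw [← qpow_add, qpow_mul_pow, ← qpow_neg]; congr 1; push_cast; ring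
  have e3 : ∀ j : ℕ, res (qpow a 1) (qpow a k * qpow a 1) (qpow a k) j *
      (qpow a k * qpow a 1 * qpow a 1 ^ j) = -res (qpow a 1) (qpow a k) (qpow a k * qpow a 1) j :=
    fun j => by linear_combination -res_reflect hq hq0 ht j
  simp only [e1, e2, e3, muBullet_pos_eq, muBullet_eq_res ha hpole, neg_mul, sum_neg_distrib]
  simp only [mul_assoc (muConst a k)⁻¹, ← mul_sum]
  ring

lemma coeffLin_congr_of_isEven {v w : ℤ → ℂ} (h : ∀ p, Even p → v p = w p)
    {F : LaurentPolynomial ℂ} (hF : IsEven F) : coeffLin v F = coeffLin w F :=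
  Finsupp.sum_congr fun n hn => by simp only [h n (hF n hn)]

/-- The contribution of the points `z` and `z + π i a`. -/
def residueLin (a : ℝ) (z : ℂ) : LaurentPolynomial ℂ →ₗ[ℂ] ℂ :=
  Ahalf a z • evalqLin a z +
    Ahalf a (z + Real.pi * Complex.I * a) • evalqLin a (z + Real.pi * Complex.I * a)

lemma residueLin_T (ha : 0 < a) (z : ℂ) (p : ℤ) :
    residueLin a z (LaurentPolynomial.T p) =
      (Real.sqrt (Real.pi * a) : ℂ) * thetaSum a (qpow a (-(2 * z))) p := by
  rw [thetaSum, ← Ahalf_add ha]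
  simp only [residueLin, LinearMap.add_apply, LinearMap.smul_apply, smul_eq_mul, evalqLin_apply,
    evalq_T]

lemma residueLin_of_isEven (ha : 0 < a) (z : ℂ) {F : LaurentPolynomial ℂ} (hF : IsEven F) :
    residueLin a z F = A a z * evalq a F z := by
  have h1 : residueLin a z = coeffLin fun p =>
      (Real.sqrt (Real.pi * a) : ℂ) * thetaSum a (qpow a (-(2 * z))) p :=
    laurent_linearMap_ext fun n => by rw [residueLin_T ha, coeffLin_T]
  have h2 : A a z • evalqLin a z = coeffLin fun p => A a z * qpow a (p * z) :=
    laurent_linearMap_ext fun n => by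
      rw [LinearMap.smul_apply, evalqLin_apply, evalq_T, coeffLin_T, smul_eq_mul]
  have h3 : A a z * evalq a F z = (A a z • evalqLin a z) F := rfl
  rw [h3, h1, h2]
  exact coeffLin_congr_of_isEven (fun p hp => (A_mul a z hp).symm) hF

/-- The residues cancel the corrections in the Fourier coefficients, leaving the pure moment
functional. -/
lemma Phi_add_residues (ha : 0 < a) (hk : k.re < 0) (hwall : ∀ n : ℕ, k.re ≠ -(n : ℝ))
    (hpole : ∀ n : ℕ, qpow a (2 * k + (n + 1)) ≠ 1) (F : LaurentPolynomial ℂ) :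
    Phi a k 0 F + ∑ z ∈ Ktilde k, muBullet a k z * residueLin a z F =
      (Real.sqrt (Real.pi * a) : ℂ) * (muConst a k)⁻¹ * momentLin a k F := by
  have h : (((Real.sqrt (Real.pi * a) : ℂ) * (muConst a k)⁻¹) •
      coeffLin (fun p => ∑' n, muCorr a k n * gaussWt a p n)) +
      ∑ z ∈ Ktilde k, muBullet a k z • residueLin a z =
      ((Real.sqrt (Real.pi * a) : ℂ) * (muConst a k)⁻¹) • momentLin a k := by
    refine laurent_linearMap_ext fun p => ?_
    simp only [LinearMap.add_apply, LinearMap.smul_apply, LinearMap.sum_apply, smul_eq_mul,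
      residueLin_T ha, momentLin, coeffLin_T, mul_left_comm _ (Real.sqrt (Real.pi * a) : ℂ),
      ← mul_sum]
    rw [mul_assoc, tsum_muCorr ha hpole]
    ring
  have := LinearMap.congr_fun h F
  rw [Phi_eq ha hk hwall hpole]
  simpa using this

/-! ### Normalisation -/

lemma norm_qpow_mul_pow_ne_one (ha : 0 < a) (hwall : ∀ n : ℕ, k.re ≠ -(n : ℝ)) (j : ℕ) :
    ‖qpow a k * qpow a 1 ^ j‖ ≠ 1 := by
  rw [qpow_mul_pow, norm_qpow, Ne, Real.exp_eq_one_iff, div_eq_zero_iff, not_or]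
  refine ⟨fun h => hwall j ?_, ha.ne'⟩
  simp at h
  linarith

lemma qPoch_mul_ne_zero (ha : 0 < a) (hwall : ∀ n : ℕ, k.re ≠ -(n : ℝ)) :
    qPoch (qpow a 1) (qpow a k * qpow a 1) ≠ 0 :=
  qPoch_ne_zero (norm_qpow_one_lt ha) fun i hi => norm_qpow_mul_pow_ne_one ha hwall (i + 1) (by
    rw [pow_succ', ← mul_assoc, hi, norm_one])

lemma momentLin_one_eq (ha : 0 < a) (hwall : ∀ n : ℕ, k.re ≠ -(n : ℝ))
    (hpole : ∀ n : ℕ, qpow a (2 * k + (n + 1)) ≠ 1) :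
    momentLin a k 1 =
      qPoch (qpow a 1) (qpow a k * qpow a 1) * qPoch (qpow a 1) (qpow a 1) := by
  rw [momentLin_one, moment_zero ha (pole_pow hpole) fun n hn =>
    norm_qpow_mul_pow_ne_one ha hwall (n + 1) (by rw [hn, norm_neg, norm_one])]

lemma momentLin_one_ne_zero (ha : 0 < a) (hwall : ∀ n : ℕ, k.re ≠ -(n : ℝ))
    (hpole : ∀ n : ℕ, qpow a (2 * k + (n + 1)) ≠ 1) : momentLin a k 1 ≠ 0 := by
  rw [momentLin_one_eq ha hwall hpole]
  exact mul_ne_zero (qPoch_mul_ne_zero ha hwall) (qPoch_self_ne_zero (norm_qpow_one_lt ha))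

lemma G_eq (ha : 0 < a) (hpole : ∀ n : ℕ, qpow a (2 * k + (n + 1)) ≠ 1) :
    G a k = (Real.sqrt (Real.pi * a) : ℂ) * (qPoch (qpow a 1) (qpow a k * qpow a 1) /
      qPoch (qpow a 1) (qpow a k * (qpow a k * qpow a 1))) := by
  have hq := norm_qpow_one_lt ha
  rw [G, ← (hasProd_div (hasProd_qPoch hq (qpow a k * qpow a 1))
    (hasProd_qPoch hq (qpow a k * (qpow a k * qpow a 1)))
    (right_ne_zero_of_mul (muConst_ne_zero ha hpole))).tprod_eq]
  congr 1
  refine tprod_congr fun j => ?_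
  simp only [← qpow_natCast, ← qpow_add]
  congr 3 <;> ring_nf

/-- The factor `(tq)_∞` of `G(k)` cancels against `momentLin 1`, leaving exactly the constant in
front of the integral. -/
lemma G_mul_inv_momentLin (ha : 0 < a) (hwall : ∀ n : ℕ, k.re ≠ -(n : ℝ))
    (hpole : ∀ n : ℕ, qpow a (2 * k + (n + 1)) ≠ 1) :
    G a k * (momentLin a k 1)⁻¹ = (Real.sqrt (Real.pi * a) : ℂ) * (muConst a k)⁻¹ := by
  have h1 := muConst_ne_zero ha hpole
  have h2 := qPoch_mul_ne_zero ha hwall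
  rw [G_eq ha hpole, momentLin_one_eq ha hwall hpole, muConst]
  rw [muConst] at h1
  have h3 := left_ne_zero_of_mul h1
  have h4 := right_ne_zero_of_mul h1
  generalize qPoch (qpow a 1) (qpow a k * (qpow a k * qpow a 1)) = U at *
  generalize qPoch (qpow a 1) (qpow a k * qpow a 1) = V at *
  generalize qPoch (qpow a 1) (qpow a 1) = W at *
  field_simp

lemma form_coinv_eq (ha : 0 < a) (hk : k.re < 0) (hwall : ∀ n : ℕ, k.re ≠ -(n : ℝ))
    (hpole : ∀ n : ℕ, qpow a (2 * k + (n + 1)) ≠ 1) (f g : LaurentPolynomial ℂ) :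
    qpow a (k / 2) * G a k * form (coinv a k) (ofX a k f) (ofX a k g) =
      Phi a k 0 (bigF a k f g) +
        ∑ z ∈ Ktilde k, muBullet a k z * residueLin a z (bigF a k f g) := by
  rw [Phi_add_residues ha hk hwall hpole, ← G_mul_inv_momentLin ha hwall hpole]
  linear_combination G a k * form_coinv k ha f g

/-! ### The values of `μ•` -/

/-- Up to a nonzero constant the value is `(t⁻¹)_∞ (tq)_∞`: the first factor is nonzero because `|t|
> 1`, the second because `Re k` avoids the walls. -/
lemma muBullet_neg_half_ne_zero (ha : 0 < a) (hwall : ∀ n : ℕ, k.re ≠ -(n : ℝ)) (hk : k.re < 0)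
    (hpole : ∀ n : ℕ, qpow a (2 * k + (n + 1)) ≠ 1) : muBullet a k (-k / 2) ≠ 0 := by
  have hq := norm_qpow_one_lt ha
  have e : -k / 2 = -((k + (0 : ℕ)) / 2) := by push_cast; ring
  rw [e, muBullet_eq_res ha hpole]
  refine mul_ne_zero (inv_ne_zero (muConst_ne_zero ha hpole)) ?_
  simp only [res, pow_zero, mul_one, zero_add, pow_one, range_zero, prod_empty]
  refine mul_ne_zero (qPoch_ne_zero hq fun i hi => ?_) (qPoch_mul_ne_zero ha hwall)
  have h1 : ‖(qpow a k)⁻¹‖ < 1 := by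
    rw [norm_inv]
    exact inv_lt_one_of_one_lt₀ (norm_qpow_gt_one ha hk)
  have h2 : ‖(qpow a k)⁻¹ * qpow a 1 ^ i‖ < 1 := by
    rw [norm_mul, norm_pow]
    exact mul_lt_one_of_nonneg_of_lt_one_left (norm_nonneg _) h1
      (pow_le_one₀ (norm_nonneg _) hq.le)
  rw [hi, norm_one] at h2
  exact lt_irrefl _ h2

lemma muBullet_neg_ratio (ha : 0 < a) (hk : k.re < 0) (hwall : ∀ n : ℕ, k.re ≠ -(n : ℝ))
    (hpole : ∀ n : ℕ, qpow a (2 * k + (n + 1)) ≠ 1) (j : ℕ) :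
    muBullet a k (-((k + j) / 2)) / muBullet a k (-k / 2) =
      (qpow a k ^ j)⁻¹ * ∏ i ∈ Icc 1 j, (1 - qpow a k ^ 2 * qpow a i) / (1 - qpow a i) := by
  have h0 := muBullet_neg_half_ne_zero ha hwall hk hpole
  rw [div_eq_iff h0]
  have e : -k / 2 = -((k + (0 : ℕ)) / 2) := by push_cast; ring
  rw [e, muBullet_eq_res ha hpole, muBullet_eq_res ha hpole,
    res_ratio (norm_qpow_one_lt ha) (qpow_ne_zero a 1) (qpow_ne_zero a k)]
  simp only [qpow_natCast]
  ring

end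

end

end DAHA

namespace DAHA

noncomputable section

open Filter Finset

section

variable {a : ℝ} {k : ℂ}

/-! ### Cancelling the vanishing factor of the denominator -/

lemma hasDerivAt_qpow (a : ℝ) (c b x : ℂ) :
    HasDerivAt (fun x => qpow a (c + b * x)) (qpow a (c + b * x) * (-b / a)) x := by
  have h : HasDerivAt (fun x : ℂ => -(c + b * x) / a) (-b / a) x := by
    simpa using ((((hasDerivAt_id x).const_mul b).const_add c).neg.div_const (a : ℂ))
  exact h.cexp

lemma differentiable_qpow_two_mul (a : ℝ) : Differentiable ℂ fun x => qpow a (2 * x) := fun x => by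
  simpa using (hasDerivAt_qpow a 0 2 x).differentiableAt

lemma tendsto_mul_mu (ha : 0 < a) (hpole : ∀ n : ℕ, qpow a (2 * k + (n + 1)) ≠ 1) (j : ℕ) :
    Tendsto (fun x : ℂ => (1 - qpow a (j + k + 2 * x)) * mu a k x)
      (𝓝[≠] (-((k + j) / 2))) (𝓝 (muBullet a k (-((k + j) / 2)))) := by
  have hq := norm_qpow_one_lt ha
  have hq0 := qpow_ne_zero a 1
  have ha' : (a : ℂ) ≠ 0 := by exact_mod_cast ha.ne'
  set x₀ := -((k + j) / 2) with hx₀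
  have hu : Continuous fun x => qpow a (2 * x) := (differentiable_qpow_two_mul a).continuous
  have hu' : Continuous fun x => (qpow a (2 * x))⁻¹ := hu.inv₀ fun x => qpow_ne_zero a _
  have hP := continuous_qPoch hq
  have hN : Continuous fun x => qPoch (qpow a 1) (qpow a (2 * x)) *
      qPoch (qpow a 1) (qpow a 1 * (qpow a (2 * x))⁻¹) := by fun_prop
  have hD : Continuous fun x => (∏ i ∈ range j, (1 - qpow a k * qpow a (2 * x) * qpow a 1 ^ i)) *
      qPoch (qpow a 1) (qpow a k * qpow a (2 * x) * qpow a 1 ^ (j + 1)) *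
      qPoch (qpow a 1) (qpow a k * qpow a 1 * (qpow a (2 * x))⁻¹) := by fun_prop
  have hu₀ : qpow a (2 * x₀) = (qpow a k * qpow a 1 ^ j)⁻¹ := by
    rw [qpow_mul_pow, ← qpow_neg, hx₀]; congr 1; ring
  have hr := pow_ne_zero j hq0
  have ht := qpow_ne_zero a k
  have e1 : qpow a k * (qpow a k * qpow a 1 ^ j)⁻¹ = (qpow a 1 ^ j)⁻¹ := by field_simp
  have e2 : (qpow a 1 ^ j)⁻¹ * qpow a 1 ^ (j + 1) = qpow a 1 := by
    rw [pow_succ, ← mul_assoc, inv_mul_cancel₀ hr, one_mul]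
  have hval : muBullet a k x₀ = qPoch (qpow a 1) (qpow a (2 * x₀)) *
      qPoch (qpow a 1) (qpow a 1 * (qpow a (2 * x₀))⁻¹) /
      ((∏ i ∈ range j, (1 - qpow a k * qpow a (2 * x₀) * qpow a 1 ^ i)) *
      qPoch (qpow a 1) (qpow a k * qpow a (2 * x₀) * qpow a 1 ^ (j + 1)) *
      qPoch (qpow a 1) (qpow a k * qpow a 1 * (qpow a (2 * x₀))⁻¹)) := by
    rw [hx₀, hasProd_muBullet ha hpole, ← hx₀, hu₀, inv_inv, e1, e2, prod_inv_pow_eq hq0,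
      show qpow a 1 * (qpow a k * qpow a 1 ^ j) = qpow a k * qpow a 1 ^ (j + 1) by ring,
      show qpow a k * qpow a 1 * (qpow a k * qpow a 1 ^ j) = qpow a k ^ 2 * qpow a 1 ^ (j + 1) by
        ring]
  have hne : (∏ i ∈ range j, (1 - qpow a k * qpow a (2 * x₀) * qpow a 1 ^ i)) *
      qPoch (qpow a 1) (qpow a k * qpow a (2 * x₀) * qpow a 1 ^ (j + 1)) *
      qPoch (qpow a 1) (qpow a k * qpow a 1 * (qpow a (2 * x₀))⁻¹) ≠ 0 := by
    rw [hu₀, inv_inv, e1, e2, prod_inv_pow_eq hq0]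
    refine mul_ne_zero (mul_ne_zero (prod_ne_zero_iff.mpr fun i _ => one_sub_inv_pow_ne_zero hq i)
      (qPoch_self_ne_zero hq)) (qPoch_ne_zero hq fun i hi => pole_pow hpole (j + i) (Eq.trans ?_ hi))
    ring
  rw [hval]
  refine ((hN.tendsto x₀).div (hD.tendsto x₀) hne).mono_left nhdsWithin_le_nhds |>.congr' ?_
  -- A nonzero derivative makes the zero of the cancelled factor isolated, so it may be divided out
  -- near the point.
  have hder : qpow a (j + k + 2 * x₀) * (-2 / a) ≠ 0 :=
    mul_ne_zero (qpow_ne_zero _ _) (div_ne_zero (by norm_num) ha')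
  filter_upwards [(hasDerivAt_qpow a (j + k) 2 x₀).eventually_ne (c := 1) hder] with x hx
  have e3 : qpow a (j + k + 2 * x) = qpow a k * qpow a (2 * x) * qpow a 1 ^ j := by
    rw [← qpow_natCast, ← qpow_add, ← qpow_add]; congr 1; ring
  rw [e3] at hx ⊢
  have hx' : 1 - qpow a k * qpow a (2 * x) * qpow a 1 ^ j ≠ 0 := sub_ne_zero.mpr (Ne.symm hx)
  rw [mu_eq_weight ha, weight, qPoch_eq_prod_mul hq (qpow a k * qpow a (2 * x)) (j + 1),
    prod_range_succ, ← mul_div_assoc, mul_comm (∏ i ∈ range j, _) (1 - _), mul_assoc (1 - _),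
    mul_assoc (1 - _), mul_div_mul_left _ _ hx', Pi.div_apply]

/-- The previous limit transported by `x ↦ 1/2 - x`, which lowers the index by one. -/
lemma tendsto_mul_mu_succ (ha : 0 < a) (hpole : ∀ n : ℕ, qpow a (2 * k + (n + 1)) ≠ 1) (j : ℕ) :
    Tendsto (fun x : ℂ => (1 - qpow a ((j + 1 : ℕ) + k - 2 * x)) * mu a k x)
      (𝓝[≠] ((k + (j + 1 : ℕ)) / 2)) (𝓝 (muBullet a k ((k + (j + 1 : ℕ)) / 2))) := by
  rw [muBullet_pos_eq]
  have hr : Tendsto (fun x : ℂ => 1 / 2 - x) (𝓝[≠] ((k + (j + 1 : ℕ)) / 2))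
      (𝓝[≠] (-((k + j) / 2))) := by
    have hx : 1 / 2 - (k + (j + 1 : ℕ)) / 2 = -((k + j) / 2) := by push_cast; ring
    rw [← hx]
    refine tendsto_nhdsWithin_of_tendsto_nhds_of_eventually_within _
      ((continuous_const.sub continuous_id).continuousAt.mono_left nhdsWithin_le_nhds) ?_
    filter_upwards [self_mem_nhdsWithin] with x hx h
    exact hx (sub_right_injective h)
  refine ((tendsto_mul_mu ha hpole j).comp hr).congr fun x => ?_
  rw [Function.comp_apply, mu_reflect]
  congr 3
  push_cast
  ring

/-! ### Poles -/

lemma re_eq_zero_of_qpow_eq_one (ha : 0 < a) {z : ℂ} (h : qpow a z = 1) : z.re = 0 := by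
  have h1 := congrArg norm h
  rw [norm_qpow, norm_one, Real.exp_eq_one_iff, div_eq_zero_iff] at h1
  simpa using h1.resolve_right ha.ne'

lemma re_ne_intCast (hk : k.re < 0) (hwall : ∀ n : ℕ, k.re ≠ -(n : ℝ)) (n : ℤ) : k.re ≠ n := by
  intro h
  have hn : n < 0 := by rw [h] at hk; exact_mod_cast hk
  refine hwall n.natAbs ?_
  rw [h, Nat.cast_natAbs, abs_of_neg hn]
  push_cast
  ring

/-- The numerator of `μ`. -/
def muNum (a : ℝ) (x : ℂ) : ℂ :=
  qPoch (qpow a 1) (qpow a (2 * x)) * qPoch (qpow a 1) (qpow a 1 * (qpow a (2 * x))⁻¹)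

/-- The denominator of `μ`. -/
def muDen (a : ℝ) (k x : ℂ) : ℂ :=
  qPoch (qpow a 1) (qpow a k * qpow a (2 * x)) *
    qPoch (qpow a 1) (qpow a k * qpow a 1 * (qpow a (2 * x))⁻¹)

lemma mu_eq_div (ha : 0 < a) (k : ℂ) : mu a k = muNum a / muDen a k :=
  funext fun x => mu_eq_weight ha k x

lemma differentiable_muNum (ha : 0 < a) : Differentiable ℂ (muNum a) := by
  have hP := differentiable_qPoch (norm_qpow_one_lt ha)
  have h := differentiable_qpow_two_mul a
  have h' : Differentiable ℂ fun x => (qpow a (2 * x))⁻¹ := h.inv fun x => qpow_ne_zero a _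
  unfold muNum
  fun_prop

lemma differentiable_muDen (ha : 0 < a) (k : ℂ) : Differentiable ℂ (muDen a k) := by
  have hP := differentiable_qPoch (norm_qpow_one_lt ha)
  have h := differentiable_qpow_two_mul a
  have h' : Differentiable ℂ fun x => (qpow a (2 * x))⁻¹ := h.inv fun x => qpow_ne_zero a _
  unfold muDen
  fun_prop

lemma muDen_eq_zero_iff (ha : 0 < a) (k x : ℂ) : muDen a k x = 0 ↔
    ∃ i : ℕ, qpow a (k + 2 * x + i) = 1 ∨ qpow a (k + 1 - 2 * x + i) = 1 := by
  have hq := norm_qpow_one_lt ha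
  have h : ∀ z : ℂ, qPoch (qpow a 1) z = 0 ↔ ∃ i : ℕ, z * qpow a 1 ^ i = 1 := fun z => by
    simpa using (qPoch_ne_zero_iff hq (z := z)).not
  rw [muDen, mul_eq_zero, h, h, ← exists_or]
  simp only [← qpow_neg, ← qpow_add, qpow_mul_pow, ← sub_eq_add_neg]

/-- A common zero of numerator and denominator would, on taking real parts of exponents, make `Re k`
an integer. Hence no pole is cancelled. -/
lemma muNum_ne_zero (ha : 0 < a) (hk : k.re < 0) (hwall : ∀ n : ℕ, k.re ≠ -(n : ℝ)) {x : ℂ}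
    (h : muDen a k x = 0) : muNum a x ≠ 0 := by
  have hq := norm_qpow_one_lt ha
  obtain ⟨i, hi⟩ := (muDen_eq_zero_iff ha k x).mp h
  have h1 : k.re + 2 * x.re + i = 0 ∨ k.re + 1 - 2 * x.re + i = 0 := by
    refine hi.imp (fun h => ?_) fun h => ?_ <;> simpa using re_eq_zero_of_qpow_eq_one ha h
  refine mul_ne_zero (qPoch_ne_zero hq fun l hl => ?_) (qPoch_ne_zero hq fun l hl => ?_)
  · rw [qpow_mul_pow] at hl
    have h2 : 2 * x.re + l = 0 := by simpa using re_eq_zero_of_qpow_eq_one ha hl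
    rcases h1 with h1 | h1
    · exact re_ne_intCast hk hwall (l - i) (by push_cast; linarith)
    · exact re_ne_intCast hk hwall (-l - 1 - i) (by push_cast; linarith)
  · rw [← qpow_neg, ← qpow_add, qpow_mul_pow] at hl
    have h2 : 1 + -(2 * x.re) + l = 0 := by simpa using re_eq_zero_of_qpow_eq_one ha hl
    rcases h1 with h1 | h1
    · exact re_ne_intCast hk hwall (-i - 1 - l) (by push_cast; linarith)
    · exact re_ne_intCast hk hwall (l - i) (by push_cast; linarith)

/-- Otherwise the entire function `muDen` would vanish identically, but the wall condition makes it
nonzero at `x = 0`. -/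
lemma eventually_muDen_ne_zero (ha : 0 < a) (hwall : ∀ n : ℕ, k.re ≠ -(n : ℝ)) (x : ℂ) :
    ∀ᶠ y in 𝓝[≠] x, muDen a k y ≠ 0 := by
  have han : AnalyticOnNhd ℂ (muDen a k) Set.univ := fun y _ => (differentiable_muDen ha k).analyticAt y
  refine ((han x trivial).eventually_eq_zero_or_eventually_ne_zero).resolve_left fun h => ?_
  have h0 := han.eqOn_zero_of_preconnected_of_eventuallyEq_zero isPreconnected_univ trivial h
    (Set.mem_univ 0)
  obtain ⟨i, hi | hi⟩ := (muDen_eq_zero_iff ha k 0).mp h0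
  · refine hwall i ?_
    have := re_eq_zero_of_qpow_eq_one ha hi
    simp at this
    linarith
  · refine hwall (i + 1) ?_
    have := re_eq_zero_of_qpow_eq_one ha hi
    simp at this
    push_cast
    linarith

lemma meromorphicOrderAt_mu_neg_iff (ha : 0 < a) (hk : k.re < 0)
    (hwall : ∀ n : ℕ, k.re ≠ -(n : ℝ)) (x : ℂ) :
    meromorphicOrderAt (mu a k) x < 0 ↔ muDen a k x = 0 := by
  have hN := (differentiable_muNum ha).analyticAt x
  have hD := (differentiable_muDen ha k).analyticAt x
  rw [mu_eq_div ha]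
  constructor
  · contrapose!
    exact fun h => (hN.div hD h).meromorphicOrderAt_nonneg
  · intro h
    rw [← tendsto_cobounded_iff_meromorphicOrderAt_neg (hN.meromorphicAt.div hD.meromorphicAt),
      ← tendsto_norm_atTop_iff_cobounded]
    have h1 : Tendsto (muDen a k) (𝓝[≠] x) (𝓝[≠] 0) := by
      refine tendsto_nhdsWithin_of_tendsto_nhds_of_eventually_within _ ?_
        (eventually_muDen_ne_zero ha hwall x)
      rw [← h]
      exact hD.continuousAt.mono_left nhdsWithin_le_nhds
    have h2 : Tendsto (fun y => ‖(muDen a k y)⁻¹‖) (𝓝[≠] x) atTop :=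
      tendsto_norm_atTop_iff_cobounded.mpr (tendsto_inv₀_nhdsNE_zero.comp h1)
    have h3 : Tendsto (fun y => ‖muNum a y‖) (𝓝[≠] x) (𝓝 ‖muNum a x‖) :=
      hN.continuousAt.norm.mono_left nhdsWithin_le_nhds
    refine (h3.pos_mul_atTop (norm_pos_iff.mpr (muNum_ne_zero ha hk hwall h)) h2).congr fun y => ?_
    rw [Pi.div_apply, div_eq_mul_inv, norm_mul]

/-- The sign in the description of the poles arises because `μ` depends only on `X ^ 2`. -/
lemma exists_sign_mul_eq_iff (z w : ℂ) : (∃ σ : ℂ, (σ = 1 ∨ σ = -1) ∧ z = σ * w) ↔ z ^ 2 = w ^ 2 := by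
  rw [sq_eq_sq_iff_eq_or_eq_neg]
  constructor
  · rintro ⟨σ, rfl | rfl, h⟩
    · exact .inl (by rw [h, one_mul])
    · exact .inr (by rw [h]; ring)
  · rintro (h | h)
    · exact ⟨1, .inl rfl, by rw [h, one_mul]⟩
    · exact ⟨-1, .inr rfl, by rw [h]; ring⟩

lemma qpow_eq_iff (a : ℝ) (z w : ℂ) : qpow a z = qpow a w ↔ qpow a (w - z) = 1 := by
  rw [sub_eq_add_neg, qpow_add, qpow_neg, mul_inv_eq_one₀ (qpow_ne_zero a z), eq_comm]

lemma meromorphicOrderAt_mu_neg_iff_exists (ha : 0 < a) (hk : k.re < 0)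
    (hwall : ∀ n : ℕ, k.re ≠ -(n : ℝ)) (x : ℂ) : meromorphicOrderAt (mu a k) x < 0 ↔
      ∃ n : ℕ, ∃ σ : ℂ, (σ = 1 ∨ σ = -1) ∧
        (qpow a (-(1 / 2)) * qpow a x = σ * (qpow a (n / 2) * qpow a (k / 2)) ∨
          (qpow a x)⁻¹ = σ * (qpow a (n / 2) * qpow a (k / 2))) := by
  rw [meromorphicOrderAt_mu_neg_iff ha hk hwall, muDen_eq_zero_iff ha]
  refine exists_congr fun n => ?_
  simp only [and_or_left, exists_or, exists_sign_mul_eq_iff]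
  rw [or_comm]
  simp only [← qpow_neg, ← qpow_add, ← qpow_nat_mul]
  rw [qpow_eq_iff, qpow_eq_iff]
  refine or_congr (iff_of_eq ?_) (iff_of_eq ?_) <;>
  · congr 2
    push_cast
    ring

end

end

end DAHA

/-! ### Assembly of the theorem -/

theorem theorem6p2 (a : ℝ) (ha : 0 < a) (k : ℂ) (hk : k.re < 0)
    (hwall : ∀ n : ℕ, k.re ≠ -(n : ℝ))
    (hpole : ∀ n : ℕ, DAHA.qpow a (2 * k + (n + 1)) ≠ 1) :
    -- the coinvariant exists, is unique, and its form is given by the formula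
    (∃ ϱ : DAHA.Alg a k →ₗ[ℂ] ℂ, DAHA.IsCoinvariant a k ϱ ∧
      (∀ ϱ' : DAHA.Alg a k →ₗ[ℂ] ℂ, DAHA.IsCoinvariant a k ϱ' → ϱ' = ϱ) ∧
      ∀ f g : LaurentPolynomial ℂ,
        MeasureTheory.Integrable (DAHA.integrand a k 0 (DAHA.bigF a k f g)) ∧
        -- the case of even `F`
        (DAHA.IsEven (DAHA.bigF a k f g) →
          DAHA.qpow a (k / 2) * DAHA.G a k * DAHA.form ϱ (DAHA.ofX a k f) (DAHA.ofX a k g) =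
            DAHA.Phi a k 0 (DAHA.bigF a k f g) +
              DAHA.muBullet a k (-k / 2) * ∑ z ∈ DAHA.Ktilde k,
                DAHA.A a z * (DAHA.muBullet a k z / DAHA.muBullet a k (-k / 2)) *
                  DAHA.evalq a (DAHA.bigF a k f g) z) ∧
        -- the general case, with the doubled summation over `z` and `z + π i a`
        DAHA.qpow a (k / 2) * DAHA.G a k * DAHA.form ϱ (DAHA.ofX a k f) (DAHA.ofX a k g) =
          DAHA.Phi a k 0 (DAHA.bigF a k f g) +
            DAHA.muBullet a k (-k / 2) * ∑ z ∈ DAHA.Ktilde k,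
              (DAHA.muBullet a k z / DAHA.muBullet a k (-k / 2)) *
                (DAHA.Ahalf a z * DAHA.evalq a (DAHA.bigF a k f g) z +
                  DAHA.Ahalf a (z + Real.pi * Complex.I * a) *
                    DAHA.evalq a (DAHA.bigF a k f g) (z + Real.pi * Complex.I * a))) ∧
    -- the summation set
    ((DAHA.Ktilde k : Set ℂ) = {-k / 2} ∪
      {z : ℂ | ∃ j : ℕ, 1 ≤ j ∧ j ≤ DAHA.jumps k ∧ (z = (k + j) / 2 ∨ z = -((k + j) / 2))}) ∧
    -- `μ•` is `μ` with the vanishing denominator factor cancelled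
    (∀ j : ℕ, j ≤ DAHA.jumps k →
      Filter.Tendsto (fun x : ℂ => (1 - DAHA.qpow a (j + k + 2 * x)) * DAHA.mu a k x)
        (𝓝[≠] (-((k + j) / 2))) (𝓝 (DAHA.muBullet a k (-((k + j) / 2))))) ∧
    (∀ j : ℕ, 1 ≤ j → j ≤ DAHA.jumps k →
      Filter.Tendsto (fun x : ℂ => (1 - DAHA.qpow a (j + k - 2 * x)) * DAHA.mu a k x)
        (𝓝[≠] ((k + j) / 2)) (𝓝 (DAHA.muBullet a k ((k + j) / 2)))) ∧
    -- the ratios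
    DAHA.muBullet a k (-k / 2) ≠ 0 ∧
    (∀ j : ℕ, 1 ≤ j → j ≤ DAHA.jumps k →
      DAHA.muBullet a k ((k + j) / 2) / DAHA.muBullet a k (-k / 2) =
        (DAHA.qpow a k ^ (j - 1))⁻¹ * ∏ i ∈ Finset.Icc 1 (j - 1),
          (1 - DAHA.qpow a k ^ 2 * DAHA.qpow a i) / (1 - DAHA.qpow a i) ∧
      DAHA.muBullet a k (-((k + j) / 2)) / DAHA.muBullet a k (-k / 2) =
        (DAHA.qpow a k ^ j)⁻¹ * ∏ i ∈ Finset.Icc 1 j,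
          (1 - DAHA.qpow a k ^ 2 * DAHA.qpow a i) / (1 - DAHA.qpow a i)) ∧
    -- the poles of `μ`: `q ^ (-1/2) X` or `X⁻¹` lies in `± q ^ (n/2) t ^ (1/2)`, `n ≥ 0`
    (∀ x : ℂ, meromorphicOrderAt (DAHA.mu a k) x < 0 ↔
      ∃ n : ℕ, ∃ σ : ℂ, (σ = 1 ∨ σ = -1) ∧
        (DAHA.qpow a (-(1 / 2)) * DAHA.qpow a x =
            σ * (DAHA.qpow a (n / 2) * DAHA.qpow a (k / 2)) ∨
          (DAHA.qpow a x)⁻¹ = σ * (DAHA.qpow a (n / 2) * DAHA.qpow a (k / 2)))) := by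
  have h0 := DAHA.muBullet_neg_half_ne_zero ha hwall hk hpole
  have hneg := DAHA.muBullet_neg_ratio ha hk hwall hpole
  refine ⟨⟨DAHA.coinv a k, ?_, fun ϱ' h' => ?_, fun f g =>
    ⟨DAHA.integrable_integrand ha hk hwall hpole _, fun hF => ?_, ?_⟩⟩, DAHA.coe_Ktilde k,
    fun j _ => DAHA.tendsto_mul_mu ha hpole j, fun j h1 _ => ?_, h0, fun j h1 _ => ⟨?_, hneg j⟩,
    DAHA.meromorphicOrderAt_mu_neg_iff_exists ha hk hwall⟩
  · exact DAHA.isCoinvariant_coinv k ha (DAHA.momentLin_one_ne_zero ha hwall hpole)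
  · exact h'.unique a k (DAHA.isCoinvariant_coinv k ha (DAHA.momentLin_one_ne_zero ha hwall hpole))
  · rw [DAHA.form_coinv_eq ha hk hwall hpole, Finset.mul_sum]
    congr 1
    refine Finset.sum_congr rfl fun z _ => ?_
    rw [DAHA.residueLin_of_isEven ha z hF]
    linear_combination (-DAHA.A a z * DAHA.evalq a (DAHA.bigF a k f g) z) *
      mul_div_cancel₀ (DAHA.muBullet a k z) h0
  · rw [DAHA.form_coinv_eq ha hk hwall hpole, Finset.mul_sum]
    congr 1
    refine Finset.sum_congr rfl fun z _ => ?_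
    rw [← mul_assoc, mul_div_cancel₀ _ h0]
    rfl
  · obtain ⟨i, rfl⟩ := Nat.exists_eq_add_of_le' h1
    exact DAHA.tendsto_mul_mu_succ ha hpole i
  · obtain ⟨i, rfl⟩ := Nat.exists_eq_add_of_le' h1
    rw [DAHA.muBullet_pos_eq, Nat.add_sub_cancel]
    exact hneg i
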